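/- Consider two-sorted structures $M=(V,K)$ in which $K$ is a field, $V$ is an infinite-dimensional $K$-vector space, and the language consists of $0_V,0_K,1_K$, the additions of $V$ and of $K$, the multiplication of $K$, the scalar multiplication, and a nondegenerate $K$-bilinear form $[\cdot,\cdot]:V\times V\to K$. Call $M$ a model of $T_\infty$ if $K$ is algebraically closed of characteristic different from $2$ and $[\cdot,\cdot]$ is symmetric or alternating; call $M$ a model of $T^{RCF}_\infty$ if $K$ is real closed and $[\cdot,\cdot]$ is alternating, or symmetric and positive-definite. "Definable" means definable with parameters. A field definable in $M$ is a definable set $F\subseteq V^k\times K^m$ (for some $k,m\in\mathbb N$) with a field structure whose addition and multiplication have definable graphs. Dimension. An approximating sequence is an increasing sequence $(N_j)_{j\in\mathbb N}$ of finite-dimensional $K$-subspaces of $V$ on each of which the form is nondegenerate, with $\dim_K N_j=j$ if the form is symmetric and $\dim_K N_j=2j$ if it is alternating. For a definable set $X$ write $X\cap N_j=X\cap(N_j^k\times K^m)$, and let $\mathrm{rk}_{N_j}(X\cap N_j)$ be its rank in the structure $(N_j,K)$: the Morley rank for $T_\infty$; for $T^{RCF}_\infty$ the topological ($o$-minimal)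 dimension of any definable copy $Y\subseteq K^n$ of it, i.e. the greatest $d$ such that some nonempty definable open subset of $K^d$ embeds definably into $Y$. A nonempty definable set $X$ has finite dimension $d\in\mathbb N$ if, for approximating sequences $(N_j)_j$ such that $X$ is definable over vector parameters from $\bigcup_jN_j$ and scalar parameters from $K$ (such sequences exist, and the choice does not matter), $\mathrm{rk}_{N_j}(X\cap N_j)=d$ for all but finitely many $j$. Theorem. Let $M=(V,K)$ be a model of $T_\infty$ or of $T^{RCF}_\infty$. Then every field $F$ definable in $M$ has finite dimension, and it is definable in the field of scalars $K$: there are a field $E$, with underlying set contained in some $K^n$, definable in the pure field $(K,+,\cdot)$, and a field isomorphism $F\to E$ definable in $M$. In particular, for no $k\in\mathbb N$ is there a definable field structure on the whole of $V^k$. -/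

import Mathlib

/-!
# Definable sets and fields in vector spaces with a bilinear form

Structures are two-sorted: a sort of vectors `V` and a sort of scalars `K`, with the constants
`0_V`, `0_K`, `1_K` and the operations `+_V`, `+_K`, `·_K`, scalar multiplication and a bilinear
form `B`. "Definable" always means definable with parameters.
-/

namespace BilinStr

universe u v

/-! ### The two-sorted first-order language -/

/-- First-order formulas whose free variables are indexed by `ι` (vectors) and `κ` (scalars).
The atomic formulas are the unnested ones: equalities of two variables, and the graphs of the
constants and operations of the language on variables. Equations between compound terms are
expressed through existential quantifiers, so these formulas define the same sets as
formulas with arbitrary terms. The quantifiers bind the extra variable `none`. -/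
inductive Fml : Type → Type → Type 1 where
  | eqV {ι κ : Type} (i j : ι) : Fml ι κ
  | zeroV {ι κ : Type} (i : ι) : Fml ι κ
  | addV {ι κ : Type} (i j l : ι) : Fml ι κ
  | eqK {ι κ : Type} (a b : κ) : Fml ι κ
  | zeroK {ι κ : Type} (a : κ) : Fml ι κ
  | oneK {ι κ : Type} (a : κ) : Fml ι κ
  | addK {ι κ : Type} (a b c : κ) : Fml ι κ
  | mulK {ι κ : Type} (a b c : κ) : Fml ι κ
  | smul {ι κ : Type} (a : κ) (i j : ι) : Fml ι κ
  | form {ι κ : Type} (i j : ι) (a : κ) : Fml ι κ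
  | neg {ι κ : Type} (φ : Fml ι κ) : Fml ι κ
  | and {ι κ : Type} (φ ψ : Fml ι κ) : Fml ι κ
  | exV {ι κ : Type} (φ : Fml (Option ι) κ) : Fml ι κ
  | exK {ι κ : Type} (φ : Fml ι (Option κ)) : Fml ι κ

section Semantics

variable {K : Type u} {V : Type v} [Field K] [AddCommGroup V] [Module K V]

/-- Truth of a formula in the structure `(V, K, B)` under an assignment of the free variables. -/
def Fml.Realize (B : LinearMap.BilinForm K V) :
    {ι κ : Type} → Fml ι κ → (ι → V) → (κ → K) → Prop
  | _, _, .eqV i j, x, _ => x i = x j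
  | _, _, .zeroV i, x, _ => x i = 0
  | _, _, .addV i j l, x, _ => x i + x j = x l
  | _, _, .eqK a b, _, y => y a = y b
  | _, _, .zeroK a, _, y => y a = 0
  | _, _, .oneK a, _, y => y a = 1
  | _, _, .addK a b c, _, y => y a + y b = y c
  | _, _, .mulK a b c, _, y => y a * y b = y c
  | _, _, .smul a i j, x, y => y a • x i = x j
  | _, _, .form i j a, x, y => B (x i) (x j) = y a
  | _, _, .neg φ, x, y => ¬ Fml.Realize B φ x y
  | _, _, .and φ ψ, x, y => Fml.Realize B φ x y ∧ Fml.Realize B ψ x y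
  | _, _, .exV φ, x, y => ∃ w : V, Fml.Realize B φ (fun o => o.elim w x) y
  | _, _, .exK φ, x, y => ∃ c : K, Fml.Realize B φ x (fun o => o.elim c y)

end Semantics

/-- Tuples consisting of vectors (indexed by `ι`) and scalars (indexed by `κ`); for
`ι = Fin k` and `κ = Fin m` this is `V ^ k × K ^ m`. -/
abbrev Tup (K : Type u) (V : Type v) (ι κ : Type) : Type (max u v) := (ι → V) × (κ → K)

/-- Concatenation of tuples. -/
def Tup.append {K : Type u} {V : Type v} {ι κ ι' κ' : Type} (x : Tup K V ι κ)
    (y : Tup K V ι' κ') : Tup K V (ι ⊕ ι') (κ ⊕ κ') :=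
  (Sum.elim x.1 y.1, Sum.elim x.2 y.2)

section Definable

variable {K : Type u} {V : Type v} [Field K] [AddCommGroup V] [Module K V]

/-- `X` is definable in `(V, K, B)` with vector parameters from `A` and arbitrary scalar
parameters. -/
def DefinableOver (B : LinearMap.BilinForm K V) (A : Set V) {ι κ : Type}
    (X : Set (Tup K V ι κ)) : Prop :=
  ∃ (a b : ℕ) (φ : Fml (Fin a ⊕ ι) (Fin b ⊕ κ)) (p : Fin a → V) (q : Fin b → K),
    (∀ i, p i ∈ A) ∧ X = {x | φ.Realize B (Sum.elim p x.1) (Sum.elim q x.2)}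

/-- `X` is definable (with parameters) in `(V, K, B)`. -/
def Definable (B : LinearMap.BilinForm K V) {ι κ : Type} (X : Set (Tup K V ι κ)) : Prop :=
  DefinableOver B Set.univ X

/-- `S ⊆ K ^ α` is definable (with parameters) in the pure field `(K, +, ·)`. -/
def FieldDefinable {α : Type} (S : Set (α → K)) : Prop :=
  letI : FirstOrder.Ring.CompatibleRing K := FirstOrder.Ring.compatibleRingOfRing K
  Set.Definable (Set.univ : Set K) FirstOrder.Language.ring S

/-- The graph, as a set of tuples, of a map from a set of tuples to a set of tuples of scalars. -/
def scalarGraph {ι κ α : Type} {X : Set (Tup K V ι κ)} {Y : Set (α → K)} (f : X → Y) :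
    Set (Tup K V ι (κ ⊕ α)) :=
  {z | ∃ x : X, z = (x.1.1, Sum.elim x.1.2 (f x).1)}

/-- A field definable in `(V, K, B)`: a definable set `carrier ⊆ V ^ k × K ^ m` with a field
structure whose addition and multiplication have definable graphs. -/
structure DefinableField (B : LinearMap.BilinForm K V) (k m : ℕ) where
  carrier : Set (Tup K V (Fin k) (Fin m))
  [field : Field carrier]
  definable_carrier : Definable B carrier
  definable_add : Definable B
    {z | ∃ x y : carrier, z = (x.1.append y.1).append (x + y : carrier).1}
  definable_mul : Definable B
    {z | ∃ x y : carrier, z = (x.1.append y.1).append (x * y : carrier).1}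

/-- A field definable in the pure field `(K, +, ·)`, with underlying set contained in `K ^ n`. -/
structure FieldDefinableField (K : Type u) [Field K] (n : ℕ) where
  carrier : Set (Fin n → K)
  [field : Field carrier]
  definable_carrier : FieldDefinable carrier
  definable_add : FieldDefinable
    {z : (Fin n ⊕ Fin n) ⊕ Fin n → K |
      ∃ x y : carrier, z = Sum.elim (Sum.elim x.1 y.1) (x + y : carrier).1}
  definable_mul : FieldDefinable
    {z : (Fin n ⊕ Fin n) ⊕ Fin n → K |
      ∃ x y : carrier, z = Sum.elim (Sum.elim x.1 y.1) (x * y : carrier).1}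

attribute [instance] DefinableField.field FieldDefinableField.field

/-- A field `F` definable in `(V, K, B)` is definable in the field of scalars: it is isomorphic,
by an isomorphism definable in `(V, K, B)`, to a field definable in the pure field `K`. -/
def DefinableField.IsDefinableInScalars {B : LinearMap.BilinForm K V} {k m : ℕ}
    (F : DefinableField B k m) : Prop :=
  ∃ (n : ℕ) (E : FieldDefinableField K n) (e : F.carrier ≃+* E.carrier),
    Definable B (scalarGraph e)

/-! ### The theories -/

/-- `(V, K, B)` is a model of `T_∞`: `K` is an algebraically closed field of characteristic
different from `2`, `V` is infinite-dimensional, `B` is nondegenerate, and `B` is symmetric or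
alternating. -/
structure IsModelACF (B : LinearMap.BilinForm K V) : Prop where
  isAlgClosed : IsAlgClosed K
  two_ne_zero : (2 : K) ≠ 0
  infinite : ¬ FiniteDimensional K V
  nondegenerate : B.Nondegenerate
  symm_or_alt : B.IsSymm ∨ B.IsAlt

/-- `(V, K, B)` is a model of `T^RCF_∞`: `K` is a real closed field, `V` is infinite-dimensional,
`B` is nondegenerate, and `B` is alternating or symmetric positive-definite. -/
structure IsModelRCF [LinearOrder K] (B : LinearMap.BilinForm K V) : Prop where
  isRealClosed : IsRealClosed K
  infinite : ¬ FiniteDimensional K V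
  nondegenerate : B.Nondegenerate
  posDef_or_alt : (B.IsSymm ∧ ∀ x, x ≠ 0 → 0 < B x x) ∨ B.IsAlt

/-! ### Ranks of definable sets -/

/-- The Morley rank of `S` is at least `d`. The witnessing sets are taken definable in the
structure itself: this structure will be `(W, K)` with `W` finite-dimensional over an algebraically
closed field, where passing to an elementary extension does not change the rank. -/
def MorleyRankGE (B : LinearMap.BilinForm K V) {ι κ : Type} : ℕ → Set (Tup K V ι κ) → Prop
  | 0, S => S.Nonempty
  | d + 1, S => ∀ n : ℕ, ∃ X : Fin n → Set (Tup K V ι κ),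
      Pairwise (fun i j => Disjoint (X i) (X j)) ∧
        ∀ i, Definable B (X i) ∧ X i ⊆ S ∧ MorleyRankGE B d (X i)

/-- The Morley rank of `S` is the natural number `d`. -/
def HasMorleyRank (B : LinearMap.BilinForm K V) {ι κ : Type} (S : Set (Tup K V ι κ)) (d : ℕ) :
    Prop :=
  MorleyRankGE B d S ∧ ¬ MorleyRankGE B (d + 1) S

/-- Some nonempty subset of `K ^ d`, open in the (product of the) order topology and definable in
the field `K`, embeds definably into `Y`. -/
def TopDimGE [LinearOrder K] {n : ℕ} (Y : Set (Fin n → K)) (d : ℕ) : Prop :=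
  letI : TopologicalSpace K := Preorder.topology K
  ∃ U : Set (Fin d → K), U.Nonempty ∧ IsOpen U ∧ FieldDefinable U ∧
    ∃ f : U → Y, Function.Injective f ∧
      FieldDefinable {z : Fin d ⊕ Fin n → K | ∃ u : U, z = Sum.elim u.1 (f u).1}

/-- The o-minimal (topological) dimension of `S` is `d`: there is a definable bijection of `S` with
a subset `Y` of a power of `K`, definable in the field `K`, and `d` is greatest such that a
nonempty definable open subset of `K ^ d` embeds definably into `Y`. -/
def HasTopDim [LinearOrder K] (B : LinearMap.BilinForm K V) {ι κ : Type}
    (S : Set (Tup K V ι κ)) (d : ℕ) : Prop :=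
  ∃ (n : ℕ) (Y : Set (Fin n → K)) (f : S ≃ Y),
    FieldDefinable Y ∧ Definable B (scalarGraph f) ∧ IsGreatest {d | TopDimGE Y d} d

/-! ### Dimension -/

/-- `N` is an approximating sequence of the model `(⋃ j, N j, K)`: an increasing sequence of
subspaces on which the form is nondegenerate, where `N j` has dimension `j` if the form is
symmetric, and `2 * j` if it is alternating. -/
structure IsApproximatingSequence (B : LinearMap.BilinForm K V) (N : ℕ → Submodule K V) :
    Prop where
  mono : Monotone N
  finiteDimensional : ∀ j, FiniteDimensional K (N j)
  nondegenerate : ∀ j, (B.restrict (N j)).Nondegenerate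
  finrank_of_symm : B.IsSymm → ∀ j, Module.finrank K (N j) = j
  finrank_of_alt : B.IsAlt → ∀ j, Module.finrank K (N j) = 2 * j

/-- The intersection of `X` with the substructure `(W, K)`. -/
def trace (W : Submodule K V) {ι κ : Type} (X : Set (Tup K V ι κ)) : Set (Tup K W ι κ) :=
  {x | ((fun i => (x.1 i : V), x.2) : Tup K V ι κ) ∈ X}

/-- The set `X` has finite dimension `d` relative to the rank `rk`: there are approximating
sequences `N` such that `X` is definable over `⋃ j, N j`, and for each of them the rank of
`X ∩ N j`, computed in `(N j, K)`, is equal to `d` for all but finitely many `j`. -/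
def HasFiniteDim (B : LinearMap.BilinForm K V) {ι κ : Type}
    (rk : (W : Submodule K V) → Set (Tup K W ι κ) → ℕ → Prop) (X : Set (Tup K V ι κ)) (d : ℕ) :
    Prop :=
  (∃ N, IsApproximatingSequence B N ∧ DefinableOver B (⋃ j, (N j : Set V)) X) ∧
    ∀ N, IsApproximatingSequence B N → DefinableOver B (⋃ j, (N j : Set V)) X →
      ∀ᶠ j in Filter.atTop, rk (N j) (trace (N j) X) d

/-- In models of `T_∞`: `dim X` is a natural number, the dimension being computed with Morley
rank. -/
def IsFiniteDimACF (B : LinearMap.BilinForm K V) {ι κ : Type} (X : Set (Tup K V ι κ)) : Prop :=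
  ∃ d : ℕ, HasFiniteDim B (fun W => HasMorleyRank (B.restrict W)) X d

/-- In models of `T^RCF_∞`: `dim X` is a natural number, the dimension being computed with the
topological dimension. -/
def IsFiniteDimRCF [LinearOrder K] (B : LinearMap.BilinForm K V) {ι κ : Type}
    (X : Set (Tup K V ι κ)) : Prop :=
  ∃ d : ℕ, HasFiniteDim B (fun W => HasTopDim (B.restrict W)) X d

end Definable

end BilinStr

/-!
The vector sort contributes nothing to a definable field beyond finitely many parameters, and what
is left is a definable set of matrices over the field of scalars.

*Elimination of vector quantifiers.* In each of the structures considered, and also in the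
finite-dimensional ones, whether an independent tuple of vectors can be extended by one vector with
given products is a condition on the Gram matrix which is definable in `K` (`IsHomogeneous`, with
the instances `isHomogeneous_of_isAlt`, `isHomogeneous_of_isSymm`, `isHomogeneous_of_posDef` and
`isHomogeneous_of_finiteDimensional`). By induction on formulas, a definable set of tuples of
vectors written in coordinates over an independent tuple `e` is a definable set over `K` in the
coordinates and the Gram matrix of `e` (`exists_polyDef_realize`, `polyDef_coord`). In particular
partial linear isometries between finite-dimensional subspaces preserve the truth of all formulas
(`IsPartialIso.realize_iff`).

*Fields live in finite-dimensional subspaces.* Let `W` be the span of the vector parameters of a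
definable field `F`, and let the support of `a ∈ F` be the span of `W` and the vectors occurring in
`a`. Partial isometries over `W` act on `F` compatibly with supports (`IsSupport`), so that supports
behave like the closures of a pregeometry, and their dimensions are bounded and satisfy the modular
law. In the configuration of a line `y = a * x + b` with independent coefficients of the greatest
dimension and a point on it, modularity is incompatible with two points determining the line, unless
all supports are equal to `W` (`IsSupport.support_eq`). Hence the vectors occurring in `F` lie in a
finite-dimensional subspace (`DefinableField.exists_finiteDimensional`). Coordinates with respect to
a basis of it give an isomorphism onto a field definable in `K`
(`DefinableField.isDefinableInScalars`), and as `V` has infinite dimension, `F` is not all of `V ^ k`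
with `k > 0`; for `k = 0` there is just one point.

*Dimension.* A definable set whose vectors lie in a finite-dimensional subspace is a coordinate copy
of a fixed set `Y` definable in `K`, and so are its traces on all large terms of an approximating
sequence; a rank which only depends on `Y` is therefore eventually constant (`exists_hasFiniteDim`).
Approximating sequences through the given parameters exist (`exists_isApproximatingSequence`). It
remains to see that the rank of `Y` is finite.

* If `K` is algebraically closed, then definable sets are constructible, by Chevalley's theorem
  (`PolyDef.exists_isConstructible`), and the Morley rank of a constructible set is bounded by the
  Krull dimension of the affine space (`not_rankGE_of_heightLT`, `exists_not_rankGE_polyDef`).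
* If `K` is real closed, then every polynomial splits into factors of degree at most two, because a
  Galois extension of `K` has degree at most two (`finrank_le_two_of_isGalois`, by way of a Sylow
  subgroup). This yields the intermediate and mean value theorems for polynomials. Two points of
  the parameter space at which the coefficients have the same signs then have matching sign tables
  (`IsExtensionStep.exists_matching`, `exists_isSignMatching`), whence definable sets are
  semialgebraic (`PolyDef.isSemialgebraic`). Finally, an open subset of `K ^ d` does not embed
  definably into `K ^ n` for `n < d` (`TopDimGE.le`). The coordinates of a point of the open set are
  roots of nonzero polynomials in those of its image, and a count on a large grid bounds the number
  of such points by way of the number of zero patterns of finitely many polynomials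
  (`card_image_filter_eval_ne_zero_le`, `le_of_forall_exists_root`).
-/

namespace BilinStr

universe u v w

/-! ### Definable sets in the field of scalars -/

/-- The subsets of powers of `K` obtained from zero sets of polynomials by complements,
intersections and projections along one coordinate. These are exactly the sets definable in the
field `K` (`fieldDefinable_iff_polyDef`). -/
inductive PolyDef (K : Type u) [Field K] : {α : Type} → Set (α → K) → Prop
  | zero {α : Type} (p : MvPolynomial α K) : PolyDef K {v | MvPolynomial.eval v p = 0}
  | compl {α : Type} {S : Set (α → K)} : PolyDef K S → PolyDef K Sᶜ
  | inter {α : Type} {S T : Set (α → K)} : PolyDef K S → PolyDef K T → PolyDef K (S ∩ T)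
  | ex {α : Type} {S : Set (Option α → K)} : PolyDef K S →
      PolyDef K {v : α → K | ∃ c, (fun o => Option.elim o c v) ∈ S}

namespace PolyDef

variable {K : Type u} [Field K] {α β γ : Type}

theorem subst {S : Set (α → K)} (hS : PolyDef K S) :
    ∀ {β : Type} (q : α → MvPolynomial β K),
      PolyDef K {w : β → K | (fun a => MvPolynomial.eval w (q a)) ∈ S} := by
  induction hS with
  | zero p =>
    intro β q
    convert! PolyDef.zero (MvPolynomial.bind₁ q p) using 2
    simp only [Set.mem_ofPred_eq, MvPolynomial.eval, MvPolynomial.eval₂Hom_bind₁]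
  | compl _ ih =>
    intro β q
    exact (ih q).compl
  | inter _ _ ih1 ih2 =>
    intro β q
    exact (ih1 q).inter (ih2 q)
  | ex _ ih =>
    intro β q
    convert! (ih (fun o => Option.elim o (MvPolynomial.X none)
      (fun a => MvPolynomial.rename some (q a)))).ex using 3 with w
    refine exists_congr fun c => ?_
    simp only [Set.mem_ofPred_eq]
    refine iff_of_eq (congrArg (· ∈ _) ?_)
    funext o
    cases o with
    | none => simp
    | some a =>
      simp only [Option.elim_some, MvPolynomial.eval_rename]
      rfl

theorem preimage {S : Set (α → K)} (hS : PolyDef K S) (f : α → β) :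
    PolyDef K {w : β → K | w ∘ f ∈ S} := by
  convert! hS.subst (fun a => MvPolynomial.X (f a)) using 3
  simp [Function.comp_def]

theorem union {S T : Set (α → K)} (hS : PolyDef K S) (hT : PolyDef K T) : PolyDef K (S ∪ T) := by
  have := (hS.compl.inter hT.compl).compl
  rwa [Set.compl_inter, compl_compl, compl_compl] at this

theorem univ : PolyDef K (Set.univ : Set (α → K)) := by
  convert! PolyDef.zero (0 : MvPolynomial α K) using 1
  ext; simp

theorem empty : PolyDef K (∅ : Set (α → K)) := by
  convert! (univ (α := α) (K := K)).compl using 1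
  simp

theorem iInter {ι : Type*} [Finite ι] {S : ι → Set (α → K)} (hS : ∀ i, PolyDef K (S i)) :
    PolyDef K (⋂ i, S i) := by
  classical
  cases nonempty_fintype ι
  suffices h : ∀ s : Finset ι, PolyDef K (⋂ i ∈ s, S i) by simpa using h Finset.univ
  intro s
  induction s using Finset.induction with
  | empty => simpa using univ
  | insert a s _ ih =>
    rw [Finset.set_biInter_insert]
    exact (hS a).inter ih

theorem exFinite [Finite γ] : ∀ {α : Type} {S : Set (γ ⊕ α → K)}, PolyDef K S →
    PolyDef K {v : α → K | ∃ c : γ → K, Sum.elim c v ∈ S} := by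
  refine Finite.induction_empty_option (P := fun γ => ∀ {α : Type} {S : Set (γ ⊕ α → K)},
    PolyDef K S → PolyDef K {v : α → K | ∃ c : γ → K, Sum.elim c v ∈ S}) ?_ ?_ ?_ γ
  · intro γ γ' e ih α S hS
    convert! ih (hS.preimage (Sum.map e.symm id)) using 3 with v
    constructor
    · rintro ⟨c, hc⟩
      refine ⟨c ∘ e, ?_⟩
      simp only [Set.mem_ofPred_eq, Sum.elim_comp_map]
      simpa [Function.comp_assoc] using hc
    · rintro ⟨c, hc⟩
      refine ⟨c ∘ e.symm, ?_⟩
      simpa only [Set.mem_ofPred_eq, Sum.elim_comp_map, Function.comp_id] using hc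
  · intro α S hS
    convert! hS.preimage (Sum.elim PEmpty.elim id) using 3 with v
    constructor
    · rintro ⟨c, hc⟩
      convert! hc using 1
      funext x
      rcases x with x | x
      · exact x.elim
      · rfl
    · intro h
      refine ⟨PEmpty.elim, ?_⟩
      convert! h using 1
      funext x
      rcases x with x | x
      · exact x.elim
      · rfl
  · intro γ _ ih α S hS
    have h1 := (hS.preimage (β := Option (γ ⊕ α)) (Sum.elim
      (fun o => Option.elim o none (fun g => some (Sum.inl g))) (fun a => some (Sum.inr a)))).ex
    convert! ih h1 using 3 with v
    constructor
    · rintro ⟨c, hc⟩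
      refine ⟨fun g => c (some g), c none, ?_⟩
      simp only [Set.mem_ofPred_eq]
      convert! hc using 1
      funext x
      rcases x with (_ | x) | x <;> rfl
    · rintro ⟨c, d, hc⟩
      refine ⟨fun o => Option.elim o d c, ?_⟩
      simp only [Set.mem_ofPred_eq] at hc
      convert! hc using 1
      funext x
      rcases x with (_ | x) | x <;> rfl

/-- A polynomial identity between coordinates is definable. -/
theorem eqPoly (p q : MvPolynomial α K) :
    PolyDef K {v : α → K | MvPolynomial.eval v p = MvPolynomial.eval v q} := by
  convert! PolyDef.zero (p - q) using 2
  simp [sub_eq_zero]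

open FirstOrder in
theorem fieldDefinable {S : Set (α → K)} (hS : PolyDef K S) : FieldDefinable S := by
  let : FirstOrder.Ring.CompatibleRing K := FirstOrder.Ring.compatibleRingOfRing K
  change Set.Definable (Set.univ : Set K) FirstOrder.Language.ring S
  induction hS with
  | zero p =>
    refine Set.Definable.mono (A := ⋃ p' ∈ ({p} : Finset _), p'.coeff '' p'.support) ?_
      (Set.subset_univ _)
    convert! FirstOrder.Ring.mvPolynomial_zeroLocus_definable {p} using 1
    rw [MvPolynomial.zeroLocus_span]
    ext v
    simp [MvPolynomial.aeval_eq_eval]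
  | compl _ ih => exact ih.compl
  | inter _ _ ih1 ih2 => exact ih1.inter ih2
  | @ex α S _ ih =>
    have h := (ih.preimage_comp (β := α ⊕ Fin 1)
      (fun o => Option.elim o (Sum.inr 0) Sum.inl)).image_comp_sumInl_fin 1
    convert! h using 1
    ext v
    simp only [Set.mem_ofPred_eq, Set.mem_image, Set.mem_preimage]
    constructor
    · rintro ⟨c, hc⟩
      refine ⟨Sum.elim v (fun _ => c), ?_, by simp⟩
      convert! hc using 1
      funext o
      cases o <;> rfl
    · rintro ⟨g, hg, rfl⟩
      refine ⟨g (Sum.inr 0), ?_⟩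
      convert! hg using 1
      funext o
      cases o <;> rfl

end PolyDef

section

variable {K : Type u} [Field K] {α : Type}

open FirstOrder

/-- Terms of the language of rings with parameters are polynomial functions. -/
theorem exists_polynomial_of_term [FirstOrder.Ring.CompatibleRing K] {γ : Type} (A : Set K)
    (t : (FirstOrder.Language.ring[[A]]).Term γ) :
    ∃ p : MvPolynomial γ K, ∀ v : γ → K, t.realize v = MvPolynomial.eval v p := by
  induction t with
  | var a => exact ⟨MvPolynomial.X a, by simp⟩
  | @func l f ts ih =>
    choose p hp using ih
    rcases f with f | f
    · cases f with
      | add =>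
        refine ⟨p 0 + p 1, fun v => ?_⟩
        simp only [Language.Term.realize, map_add, ← hp]
        exact FirstOrder.Ring.CompatibleRing.funMap_add _
      | mul =>
        refine ⟨p 0 * p 1, fun v => ?_⟩
        simp only [Language.Term.realize, map_mul, ← hp]
        exact FirstOrder.Ring.CompatibleRing.funMap_mul _
      | neg =>
        refine ⟨-p 0, fun v => ?_⟩
        simp only [Language.Term.realize, map_neg, ← hp]
        exact FirstOrder.Ring.CompatibleRing.funMap_neg _
      | zero =>
        refine ⟨0, fun v => ?_⟩
        simp only [Language.Term.realize, map_zero]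
        exact FirstOrder.Ring.CompatibleRing.funMap_zero _
      | one =>
        refine ⟨1, fun v => ?_⟩
        simp only [Language.Term.realize, map_one]
        exact FirstOrder.Ring.CompatibleRing.funMap_one _
    · cases l with
      | zero =>
        refine ⟨MvPolynomial.C ((f : A) : K), fun v => ?_⟩
        simp only [Language.Term.realize, MvPolynomial.eval_C]
        rfl
      | succ n => exact f.elim

theorem polyDef_of_boundedFormula [FirstOrder.Ring.CompatibleRing K] (A : Set K) {n : ℕ}
    (φ : (FirstOrder.Language.ring[[A]]).BoundedFormula α n) :
    PolyDef K {v : α ⊕ Fin n → K | φ.Realize (v ∘ Sum.inl) (v ∘ Sum.inr)} := by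
  induction φ with
  | falsum =>
    convert! PolyDef.empty using 1
  | equal t₁ t₂ =>
    obtain ⟨p, hp⟩ := exists_polynomial_of_term A t₁
    obtain ⟨q, hq⟩ := exists_polynomial_of_term A t₂
    convert! PolyDef.eqPoly p q using 2 with v
    simp [Language.BoundedFormula.Realize, hp, hq, Sum.elim_comp_inl_inr]
  | rel R ts =>
    rcases R with R | R
    · exact R.elim
    · exact R.elim
  | imp φ ψ ih1 ih2 =>
    convert! ih1.compl.union ih2 using 1
    ext v
    simp [imp_iff_not_or]
  | @all n φ ih =>
    have h := (ih.preimage (β := Option (α ⊕ Fin n)) (Sum.elim (fun a => some (Sum.inl a))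
      (Fin.snoc (α := fun _ => Option (α ⊕ Fin n)) (fun i => some (Sum.inr i)) none))).compl.ex.compl
    convert! h using 1
    ext v
    simp only [Set.mem_ofPred_eq, Language.BoundedFormula.realize_all, Set.mem_compl_iff, not_exists,
      not_not]
    refine forall_congr' fun c => iff_of_eq ?_
    congr 1
    funext i
    refine Fin.lastCases ?_ (fun i => ?_) i <;> simp

theorem fieldDefinable_iff_polyDef {S : Set (α → K)} : FieldDefinable S ↔ PolyDef K S := by
  refine ⟨fun h => ?_, fun h => h.fieldDefinable⟩
  let : FirstOrder.Ring.CompatibleRing K := FirstOrder.Ring.compatibleRingOfRing K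
  obtain ⟨φ, rfl⟩ := h
  convert! (polyDef_of_boundedFormula _ φ).preimage (Sum.elim id Fin.elim0) using 1
  ext v
  exact iff_of_eq (congrArg (Language.BoundedFormula.Realize φ v) (Subsingleton.elim _ _))

end

/-! ### Closure properties of the definable sets of a bilinear space -/

/-- Renaming of the free variables of a formula. -/
def Fml.rename : {ι κ : Type} → Fml ι κ → {ι' κ' : Type} → (ι → ι') → (κ → κ') → Fml ι' κ'
  | _, _, .eqV i j, _, _, f, _ => .eqV (f i) (f j)
  | _, _, .zeroV i, _, _, f, _ => .zeroV (f i)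
  | _, _, .addV i j l, _, _, f, _ => .addV (f i) (f j) (f l)
  | _, _, .eqK a b, _, _, _, g => .eqK (g a) (g b)
  | _, _, .zeroK a, _, _, _, g => .zeroK (g a)
  | _, _, .oneK a, _, _, _, g => .oneK (g a)
  | _, _, .addK a b c, _, _, _, g => .addK (g a) (g b) (g c)
  | _, _, .mulK a b c, _, _, _, g => .mulK (g a) (g b) (g c)
  | _, _, .smul a i j, _, _, f, g => .smul (g a) (f i) (f j)
  | _, _, .form i j a, _, _, f, g => .form (f i) (f j) (g a)
  | _, _, .neg φ, _, _, f, g => .neg (φ.rename f g)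
  | _, _, .and φ ψ, _, _, f, g => .and (φ.rename f g) (ψ.rename f g)
  | _, _, .exV φ, _, _, f, g => .exV (φ.rename (Option.map f) g)
  | _, _, .exK φ, _, _, f, g => .exK (φ.rename f (Option.map g))

section

variable {K : Type u} {V : Type v} [Field K] [AddCommGroup V] [Module K V]
  {B : LinearMap.BilinForm K V}

theorem option_elim_comp_map {ι ι' X : Type*} (w : X) (x : ι' → X) (f : ι → ι') :
    (fun o => Option.elim o w x) ∘ Option.map f = fun o => Option.elim o w (x ∘ f) := by
  funext o
  cases o <;> rfl

theorem Fml.realize_rename {ι κ : Type} (φ : Fml ι κ) :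
    ∀ {ι' κ' : Type} (f : ι → ι') (g : κ → κ') (x : ι' → V) (y : κ' → K),
      (φ.rename f g).Realize B x y ↔ φ.Realize B (x ∘ f) (y ∘ g) := by
  induction φ with
  | neg φ ih => intros; exact not_congr (ih ..)
  | and φ ψ ih1 ih2 => intros; exact and_congr (ih1 ..) (ih2 ..)
  | exV φ ih =>
    intro ι' κ' f g x y
    refine exists_congr fun w => ?_
    rw [ih, option_elim_comp_map]
  | exK φ ih =>
    intro ι' κ' f g x y
    refine exists_congr fun w => ?_
    rw [ih, option_elim_comp_map]
  | _ => intros; rfl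

namespace Definable

variable {ι κ ι' κ' : Type}

/-- Parameters may be indexed by arbitrary finite types. -/
theorem of_fml {I J : Type} [Finite I] [Finite J] (φ : Fml (I ⊕ ι) (J ⊕ κ)) (p : I → V)
    (q : J → K) {X : Set (Tup K V ι κ)}
    (hX : ∀ x, x ∈ X ↔ φ.Realize B (Sum.elim p x.1) (Sum.elim q x.2)) : Definable B X := by
  obtain ⟨a, ⟨e⟩⟩ := Finite.exists_equiv_fin I
  obtain ⟨b, ⟨e'⟩⟩ := Finite.exists_equiv_fin J
  refine ⟨a, b, φ.rename (Sum.map e id) (Sum.map e' id), p ∘ e.symm, q ∘ e'.symm,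
    fun _ => trivial, ?_⟩
  ext x
  rw [hX]
  simp [Fml.realize_rename, Sum.elim_comp_map, Function.comp_assoc]

/-- A set defined by a formula without parameters. -/
theorem of_fml' (φ : Fml ι κ) : Definable B {x : Tup K V ι κ | φ.Realize B x.1 x.2} :=
  of_fml (I := Empty) (J := Empty) (φ.rename Sum.inr Sum.inr) Empty.elim Empty.elim fun x => by
    simp [Fml.realize_rename]

theorem compl {X : Set (Tup K V ι κ)} (hX : Definable B X) : Definable B Xᶜ := by
  obtain ⟨a, b, φ, p, q, -, rfl⟩ := hX
  exact ⟨a, b, φ.neg, p, q, fun _ => trivial, rfl⟩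

theorem inter {X Y : Set (Tup K V ι κ)} (hX : Definable B X) (hY : Definable B Y) :
    Definable B (X ∩ Y) := by
  obtain ⟨a, b, φ, p, q, -, rfl⟩ := hX
  obtain ⟨a', b', ψ, p', q', -, rfl⟩ := hY
  refine of_fml (I := Fin a ⊕ Fin a') (J := Fin b ⊕ Fin b')
    (.and (φ.rename (Sum.map Sum.inl id) (Sum.map Sum.inl id))
      (ψ.rename (Sum.map Sum.inr id) (Sum.map Sum.inr id))) (Sum.elim p p') (Sum.elim q q')
    fun x => ?_
  simp [Fml.Realize, Fml.realize_rename, Sum.elim_comp_map]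

theorem exV {X : Set (Tup K V (Option ι) κ)} (hX : Definable B X) :
    Definable B {x : Tup K V ι κ | ∃ w, ((fun o => Option.elim o w x.1, x.2) : Tup K V _ _) ∈ X} := by
  obtain ⟨a, b, φ, p, q, -, rfl⟩ := hX
  refine of_fml (.exV (φ.rename (Sum.elim (fun i => some (Sum.inl i)) (Option.map Sum.inr)) id)) p q
    fun x => ?_
  simp only [Set.mem_ofPred_eq, Fml.Realize, Fml.realize_rename]
  refine exists_congr fun w => ?_
  convert! Iff.rfl using 2
  funext i
  rcases i with i | _ | i <;> rfl

theorem exK {X : Set (Tup K V ι (Option κ))} (hX : Definable B X) :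
    Definable B {x : Tup K V ι κ | ∃ c, ((x.1, fun o => Option.elim o c x.2) : Tup K V _ _) ∈ X} := by
  obtain ⟨a, b, φ, p, q, -, rfl⟩ := hX
  refine of_fml (.exK (φ.rename id (Sum.elim (fun i => some (Sum.inl i)) (Option.map Sum.inr)))) p q
    fun x => ?_
  simp only [Set.mem_ofPred_eq, Fml.Realize, Fml.realize_rename]
  refine exists_congr fun w => ?_
  convert! Iff.rfl using 2
  funext i
  rcases i with i | _ | i <;> rfl

theorem preimage {X : Set (Tup K V ι κ)} (hX : Definable B X) (f : ι → ι') (g : κ → κ') :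
    Definable B {x : Tup K V ι' κ' | ((x.1 ∘ f, x.2 ∘ g) : Tup K V _ _) ∈ X} := by
  obtain ⟨a, b, φ, p, q, -, rfl⟩ := hX
  refine of_fml (φ.rename (Sum.map id f) (Sum.map id g)) p q fun x => ?_
  simp [Fml.realize_rename, Sum.elim_comp_map]

theorem univ : Definable B (Set.univ : Set (Tup K V ι κ)) := by
  convert! of_fml (I := Unit) (J := Empty) (B := B) (ι := ι) (κ := κ) (.zeroV (Sum.inl ()))
    (fun _ => 0) Empty.elim fun x => ?_
  simp [Fml.Realize]

theorem iInter {γ : Type*} [Finite γ] {S : γ → Set (Tup K V ι κ)} (hS : ∀ i, Definable B (S i)) :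
    Definable B (⋂ i, S i) := by
  classical
  cases nonempty_fintype γ
  suffices h : ∀ s : Finset γ, Definable B (⋂ i ∈ s, S i) by simpa using h Finset.univ
  intro s
  induction s using Finset.induction with
  | empty => simpa using univ
  | insert a s _ ih =>
    rw [Finset.set_biInter_insert]
    exact (hS a).inter ih

theorem exFiniteK {γ : Type} [Finite γ] : ∀ {κ : Type} {S : Set (Tup K V ι (γ ⊕ κ))},
    Definable B S → Definable B
      {x : Tup K V ι κ | ∃ c : γ → K, ((x.1, Sum.elim c x.2) : Tup K V _ _) ∈ S} := by
  refine Finite.induction_empty_option (P := fun γ => ∀ {κ : Type} {S : Set (Tup K V ι (γ ⊕ κ))},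
    Definable B S → Definable B
      {x : Tup K V ι κ | ∃ c : γ → K, ((x.1, Sum.elim c x.2) : Tup K V _ _) ∈ S}) ?_ ?_ ?_ γ
  · intro γ γ' e ih κ S hS
    convert! ih (hS.preimage id (Sum.map e.symm id)) using 1
    ext x
    constructor
    · rintro ⟨c, hc⟩
      refine ⟨c ∘ e, ?_⟩
      simp only [Set.mem_ofPred_eq, Sum.elim_comp_map]
      simpa [Function.comp_assoc] using hc
    · rintro ⟨c, hc⟩
      refine ⟨c ∘ e.symm, ?_⟩
      simpa only [Set.mem_ofPred_eq, Sum.elim_comp_map, Function.comp_id] using hc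
  · intro κ S hS
    convert! hS.preimage id (Sum.elim PEmpty.elim id) using 1
    ext x
    have : ∀ c : PEmpty → K, Sum.elim c x.2 = x.2 ∘ Sum.elim PEmpty.elim id := fun c => by
      funext z
      rcases z with z | z
      · exact z.elim
      · rfl
    constructor
    · rintro ⟨c, hc⟩
      rwa [this] at hc
    · intro h
      refine ⟨PEmpty.elim, ?_⟩
      rwa [this]
  · intro γ _ ih κ S hS
    have h1 := (hS.preimage id (κ' := Option (γ ⊕ κ)) (Sum.elim
      (fun o => Option.elim o none (fun g => some (Sum.inl g))) (fun a => some (Sum.inr a)))).exK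
    convert! ih h1 using 1
    ext x
    constructor
    · rintro ⟨c, hc⟩
      refine ⟨fun g => c (some g), c none, ?_⟩
      simp only [Set.mem_ofPred_eq]
      convert! hc using 2
      funext x
      rcases x with (_ | x) | x <;> rfl
    · rintro ⟨c, d, hc⟩
      refine ⟨fun o => Option.elim o d c, ?_⟩
      simp only [Set.mem_ofPred_eq] at hc
      convert! hc using 2
      funext x
      rcases x with (_ | x) | x <;> rfl

theorem eqConstV (i : ι) (e : V) : Definable B {x : Tup K V ι κ | x.1 i = e} :=
  of_fml (I := Unit) (J := Empty) (.eqV (Sum.inr i) (Sum.inl ())) (fun _ => e) Empty.elim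
    fun x => by simp [Fml.Realize]

theorem eqConstK (a : κ) (c : K) : Definable B {x : Tup K V ι κ | x.2 a = c} :=
  of_fml (I := Empty) (J := Unit) (.eqK (Sum.inr a) (Sum.inl ())) Empty.elim (fun _ => c)
    fun x => by simp [Fml.Realize]

theorem evalEq (p : MvPolynomial κ K) :
    ∀ {κ' : Type} (f : κ → κ') (a : κ'), Definable B
      {x : Tup K V ι κ' | MvPolynomial.eval (x.2 ∘ f) p = x.2 a} := by
  induction p using MvPolynomial.induction_on with
  | C c =>
    intro κ' f a
    simpa [eq_comm] using! eqConstK a c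
  | add p q ih1 ih2 =>
    intro κ' f a
    convert! (((ih1 (some ∘ some ∘ f) none).inter (ih2 (some ∘ some ∘ f) (some none))).inter
      (of_fml' (B := B) (ι := ι) (.addK none (some none) (some (some a))))).exK.exK using 1
    ext x
    simp [Fml.Realize, Function.comp_def]
  | mul_X p n ih =>
    intro κ' f a
    convert! ((ih (some ∘ f) none).inter
      (of_fml' (B := B) (ι := ι) (.mulK none (some (f n)) (some a)))).exK using 1
    ext x
    simp [Fml.Realize, Function.comp_def]

/-- A set of scalars definable in the field is definable in the bilinear space. -/
theorem of_polyDef {S : Set (κ → K)} (hS : PolyDef K S) :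
    Definable B {x : Tup K V ι κ | x.2 ∈ S} := by
  induction hS with
  | @zero κ p =>
    convert! ((evalEq (B := B) (ι := ι) (MvPolynomial.rename some p) id none).inter
      (of_fml' (.zeroK none))).exK using 1
    ext x
    simp [Fml.Realize, MvPolynomial.eval_rename, Function.comp_def]
  | compl _ ih => exact ih.compl
  | inter _ _ ih1 ih2 => exact ih1.inter ih2
  | ex _ ih => exact ih.exK

theorem linComb {r : ℕ} (e : Fin r → V) : ∀ {ι κ : Type} (g : Fin r → κ) (i : ι), Definable B
    {x : Tup K V ι κ | x.1 i = ∑ l, x.2 (g l) • e l} := by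
  induction r with
  | zero =>
    intro ι κ g i
    simpa using! eqConstV i (0 : V)
  | succ r ih =>
    intro ι κ g i
    convert! ((((eqConstV none (e 0)).inter
      (of_fml' (.smul (g 0) none (some none)))).inter
      (ih (fun l => e l.succ) (fun l => g l.succ) (some (some none)))).inter
      (of_fml' (B := B) (.addV (some none) (some (some none)) (some (some (some i)))))).exV.exV.exV
      using 1
    ext x
    simp [Fml.Realize, Fin.sum_univ_succ, eq_comm]

/-- The coordinate map `z ↦ (∑ l, z (i, l) • e l, z)` sends definable sets of scalars to
definable sets. -/
theorem coordImage [Finite ι] [Finite κ] {r : ℕ} (e : Fin r → V) {S : Set ((ι × Fin r) ⊕ κ → K)}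
    (hS : PolyDef K S) : Definable B
      {x : Tup K V ι κ | ∃ z ∈ S, x = (fun i => ∑ l, z (Sum.inl (i, l)) • e l, z ∘ Sum.inr)} := by
  have h1 : Definable B (⋂ i : ι, {x : Tup K V ι (((ι × Fin r) ⊕ κ) ⊕ κ) |
      x.1 i = ∑ l, x.2 (Sum.inl (Sum.inl (i, l))) • e l}) :=
    iInter fun i => linComb e (fun l => Sum.inl (Sum.inl (i, l))) i
  have h2 : Definable B (⋂ a : κ, {x : Tup K V ι (((ι × Fin r) ⊕ κ) ⊕ κ) |
      x.2 (Sum.inr a) = x.2 (Sum.inl (Sum.inr a))}) :=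
    iInter fun a => of_fml' (.eqK (Sum.inr a) (Sum.inl (Sum.inr a)))
  have h3 := (of_polyDef (B := B) (ι := ι) hS).preimage id
    (Sum.inl : (ι × Fin r) ⊕ κ → ((ι × Fin r) ⊕ κ) ⊕ κ)
  convert! ((h1.inter h2).inter h3).exFiniteK using 1
  ext x
  simp only [Set.mem_ofPred_eq, Set.mem_inter_iff, Set.mem_iInter, Sum.elim_inl, Sum.elim_inr]
  refine exists_congr fun z => ?_
  rw [Prod.ext_iff, funext_iff, funext_iff, and_comm]
  simp [Function.comp_def]

end Definable

end

/-! ### Extending linear isometries by one vector -/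

section

variable {K : Type u} {V : Type v} [Field K] [AddCommGroup V] [Module K V]

/-- The products of a tuple `e` with itself (the Gram matrix), of `e` with a vector `w`, and of `w`
with itself. -/
def gramExt (B : LinearMap.BilinForm K V) {r : ℕ} (e : Fin r → V) (w : V) :
    (Fin r × Fin r) ⊕ Option (Fin r) → K :=
  Sum.elim (fun ij => B (e ij.1) (e ij.2)) (fun o => Option.elim o (B w w) (fun i => B (e i) w))

/-- Homogeneity of a bilinear space, in a form that covers both the infinite-dimensional models and
the finite-dimensional nondegenerate spaces. For independent tuples of a length in `R`, it depends
only on the Gram matrix, and in a way definable in the field, which products can be realized by a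
vector outside the span; such a vector can then be found outside any finite-dimensional subspace. In
a finite-dimensional space, `R` consists of the dimension only, and there is nothing to extend. -/
structure IsHomogeneous (B : LinearMap.BilinForm K V) (R : Set ℕ) : Prop where
  swap : ∃ ε : K, ∀ x y, B y x = ε * B x y
  ext : ∀ r ∈ R, ∃ A : Set ((Fin r × Fin r) ⊕ Option (Fin r) → K), PolyDef K A ∧
    (A.Nonempty → r + 1 ∈ R) ∧
    (∀ e : Fin r → V, LinearIndependent K e → ∀ w ∉ Submodule.span K (Set.range e),
      gramExt B e w ∈ A) ∧
    (∀ e : Fin r → V, LinearIndependent K e → ∀ G ∈ A, (∀ i j, G (Sum.inl (i, j)) = B (e i) (e j)) →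
      ∀ T : Submodule K V, FiniteDimensional K T → ∃ w ∉ T, gramExt B e w = G)
  cofinal : ∀ T : Submodule K V, FiniteDimensional K T →
    ∃ T' : Submodule K V, T ≤ T' ∧ FiniteDimensional K T' ∧ Module.finrank K T' ∈ R

theorem isHomogeneous_of_finiteDimensional [FiniteDimensional K V] {B : LinearMap.BilinForm K V}
    (hB : ∃ ε : K, ∀ x y, B y x = ε * B x y) : IsHomogeneous B {Module.finrank K V} where
  swap := hB
  ext := by
    rintro r rfl
    refine ⟨∅, PolyDef.empty, fun h => absurd h Set.not_nonempty_empty, fun e he w hw => ?_,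
      fun _ _ G hG => absurd hG (Set.notMem_empty G)⟩
    rw [he.span_eq_top_of_card_eq_finrank' (by simp)] at hw
    exact absurd Submodule.mem_top hw
  cofinal T _ := ⟨⊤, le_top, inferInstance, by simp⟩

variable {B : LinearMap.BilinForm K V}

/-- The products with an independent tuple can be prescribed. -/
theorem exists_form_eq (hB : B.SeparatingLeft) {ι : Type*} [Finite ι] {e : ι → V}
    (he : LinearIndependent K e) (g : ι → K) : ∃ w, ∀ i, B (e i) w = g i := by
  classical
  cases nonempty_fintype ι
  let f : V →ₗ[K] ι → K := LinearMap.pi fun i => B (e i)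
  suffices h : LinearMap.range f = ⊤ by
    obtain ⟨w, hw⟩ := LinearMap.range_eq_top.1 h g
    exact ⟨w, fun i => congrFun hw i⟩
  by_contra h
  obtain ⟨φ, hφ, hle⟩ := Submodule.exists_le_ker_of_lt_top _ (lt_top_iff_ne_top.2 h)
  apply hφ
  have hsum : ∀ x, φ x = ∑ i, x i * φ (Pi.single i 1) := fun x => by
    conv_lhs => rw [← Finset.univ_sum_single x]
    rw [map_sum]
    refine Finset.sum_congr rfl fun i _ => ?_
    rw [← smul_eq_mul, ← map_smul, ← Pi.single_smul, smul_eq_mul, mul_one]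
  have h0 : ∑ i, φ (Pi.single i 1) • e i = 0 := by
    refine hB _ fun w => ?_
    have : φ (f w) = 0 := hle ⟨w, rfl⟩
    rw [hsum] at this
    rw [map_sum, LinearMap.sum_apply, ← this]
    refine Finset.sum_congr rfl fun i _ => ?_
    simp [f, mul_comm]
  have h1 := Fintype.linearIndependent_iff.1 he _ h0
  ext i
  simpa using h1 i

theorem exists_orthogonal_notMem (hV : ¬ FiniteDimensional K V) (T T' : Submodule K V)
    [FiniteDimensional K T] [FiniteDimensional K T'] :
    ∃ u, (∀ t ∈ T, B t u = 0) ∧ u ∉ T' := by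
  by_contra! h
  let f : V →ₗ[K] T →ₗ[K] K := (B.flip).compl₂ T.subtype
  have hle : LinearMap.ker f ≤ T' := fun u hu => h u fun t ht =>
    LinearMap.congr_fun (LinearMap.mem_ker.1 hu) (⟨t, ht⟩ : T)
  have h1 : FiniteDimensional K (LinearMap.ker f) := Submodule.finiteDimensional_of_le hle
  have h2 : FiniteDimensional K (V ⧸ LinearMap.ker f) :=
    Module.Finite.equiv f.quotKerEquivRange.symm
  exact hV (Module.Finite.of_submodule_quotient (LinearMap.ker f))

/-- A vector `u` outside `T` can be told apart from `T` by a vector orthogonal to `T`. -/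
theorem exists_orthogonal_form_ne_zero (hB : B.SeparatingLeft) (T : Submodule K V)
    [FiniteDimensional K T] {u : V} (hu : u ∉ T) : ∃ w, (∀ t ∈ T, B t w = 0) ∧ B u w ≠ 0 := by
  let b := Module.finBasis K T
  have hli : LinearIndependent K (fun o : Option (Fin (Module.finrank K T)) =>
      Option.elim o u (fun i => (b i : V))) := by
    rw [linearIndependent_option]
    constructor
    · exact b.linearIndependent.map' T.subtype (Submodule.ker_subtype T)
    · refine fun h => hu (Submodule.span_le.2 ?_ h)
      rintro _ ⟨i, rfl⟩
      exact (b i).2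
  obtain ⟨w, hw⟩ := exists_form_eq hB hli (fun o => Option.elim o 1 0)
  refine ⟨w, fun t ht => ?_, by simp [show B u w = 1 from hw none]⟩
  have : (⟨t, ht⟩ : T) ∈ LinearMap.ker ((B.flip w).comp T.subtype) := by
    have hle : Submodule.span K (Set.range b) ≤ LinearMap.ker ((B.flip w).comp T.subtype) := by
      rw [Submodule.span_le]
      rintro _ ⟨i, rfl⟩
      exact hw (some i)
    exact hle (b.span_eq ▸ Submodule.mem_top)
  exact this

theorem exists_orthogonal_anisotropic (hV : ¬ FiniteDimensional K V) (h2 : (2 : K) ≠ 0)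
    (hB : B.SeparatingLeft) (hs : B.IsSymm) (T : Submodule K V) [FiniteDimensional K T] :
    ∃ u, (∀ t ∈ T, B t u = 0) ∧ B u u ≠ 0 := by
  by_contra! h
  obtain ⟨u, hu, huT⟩ := exists_orthogonal_notMem (B := B) hV T T
  obtain ⟨w, hw, huw⟩ := exists_orthogonal_form_ne_zero hB T huT
  apply huw
  have h3 := h (u + w) fun t ht => by rw [map_add, hu t ht, hw t ht, add_zero]
  simp only [map_add, LinearMap.add_apply, h u hu, h w hw, hs.eq w u, zero_add, add_zero] at h3
  rw [← two_mul] at h3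
  exact (mul_eq_zero.1 h3).resolve_left h2

theorem span_range_finiteDimensional {r : ℕ} (e : Fin r → V) :
    FiniteDimensional K (Submodule.span K (Set.range e)) :=
  FiniteDimensional.span_of_finite K (Set.finite_range e)

theorem gramExt_eq {r : ℕ} {e : Fin r → V} {w : V} {G : (Fin r × Fin r) ⊕ Option (Fin r) → K}
    (h1 : ∀ i j, G (Sum.inl (i, j)) = B (e i) (e j)) (h2 : ∀ i, B (e i) w = G (Sum.inr (some i)))
    (h3 : B w w = G (Sum.inr none)) : gramExt B e w = G := by
  funext x
  rcases x with ⟨i, j⟩ | _ | i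
  · exact (h1 i j).symm
  · exact h3
  · exact h2 i

theorem cofinal_univ (T : Submodule K V) (hT : FiniteDimensional K T) :
    ∃ T' : Submodule K V, T ≤ T' ∧ FiniteDimensional K T' ∧
      Module.finrank K T' ∈ (Set.univ : Set ℕ) :=
  ⟨T, le_rfl, hT, trivial⟩

theorem isHomogeneous_of_isAlt (hV : ¬ FiniteDimensional K V) (hB : B.SeparatingLeft)
    (ha : B.IsAlt) : IsHomogeneous B Set.univ where
  swap := ⟨-1, fun x y => by rw [← ha.neg_eq]; ring⟩
  ext r _ := by
    refine ⟨{G | MvPolynomial.eval G (MvPolynomial.X (Sum.inr none)) = 0}, PolyDef.zero _,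
      fun _ => trivial, fun e _ w _ => ?_, fun e he G hG hGe T hT => ?_⟩
    · simpa [gramExt] using! ha.self_eq_zero w
    · obtain ⟨w0, hw0⟩ := exists_form_eq hB he (fun i => G (Sum.inr (some i)))
      have := span_range_finiteDimensional (K := K) e
      obtain ⟨u, hu, huT⟩ := exists_orthogonal_notMem (B := B) hV
        (Submodule.span K (Set.range e)) (T ⊔ Submodule.span K {w0})
      refine ⟨w0 + u, fun h => huT ?_, gramExt_eq hGe (fun i => ?_) ?_⟩
      · have := Submodule.sub_mem _ (Submodule.mem_sup_left (T := Submodule.span K {w0}) h)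
          (Submodule.mem_sup_right (Submodule.mem_span_singleton_self w0))
        rwa [add_sub_cancel_left] at this
      · rw [map_add, hw0, hu _ (Submodule.subset_span ⟨i, rfl⟩), add_zero]
      · rw [ha.self_eq_zero]
        simpa using! hG.symm
  cofinal := cofinal_univ

/-- If the orthogonal complement of any finite-dimensional subspace represents `c`, by a vector
outside the subspace, then `c` can be added to the square of a vector without changing its
products with an independent tuple. -/
theorem exists_gramExt_eq {c : K} (hc : ∀ T : Submodule K V, FiniteDimensional K T →
      ∃ u, (∀ t ∈ T, B t u = 0) ∧ u ∉ T ∧ B u u = c) (hs : B.IsSymm)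
    {r : ℕ} {e : Fin r → V} {w0 : V} {G : (Fin r × Fin r) ⊕ Option (Fin r) → K}
    (h1 : ∀ i j, G (Sum.inl (i, j)) = B (e i) (e j)) (h2 : ∀ i, B (e i) w0 = G (Sum.inr (some i)))
    (h3 : B w0 w0 + c = G (Sum.inr none)) (T : Submodule K V) [FiniteDimensional K T] :
    ∃ w ∉ T, gramExt B e w = G := by
  have := span_range_finiteDimensional (K := K) e
  obtain ⟨u, hu, huT, huu⟩ := hc (T ⊔ Submodule.span K (Set.range e) ⊔ Submodule.span K {w0})
    inferInstance
  have hw0 : w0 ∈ T ⊔ Submodule.span K (Set.range e) ⊔ Submodule.span K {w0} :=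
    Submodule.mem_sup_right (Submodule.mem_span_singleton_self w0)
  refine ⟨w0 + u, fun h => huT ?_, gramExt_eq h1 (fun i => ?_) ?_⟩
  · have := Submodule.sub_mem _ (Submodule.mem_sup_left (Submodule.mem_sup_left h)) hw0
    rwa [add_sub_cancel_left] at this
  · rw [map_add, h2, hu _ (Submodule.mem_sup_left (Submodule.mem_sup_right
      (Submodule.subset_span ⟨i, rfl⟩))), add_zero]
  · rw [LinearMap.BilinForm.add_left, LinearMap.BilinForm.add_right, LinearMap.BilinForm.add_right,
      hu _ hw0, hs.eq u w0, hu _ hw0, huu, ← h3]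
    ring

theorem exists_orthogonal_form_self_eq (hV : ¬ FiniteDimensional K V) (h2 : (2 : K) ≠ 0)
    [IsAlgClosed K] (hB : B.SeparatingLeft) (hs : B.IsSymm) (c : K) (T : Submodule K V)
    (hT : FiniteDimensional K T) : ∃ u, (∀ t ∈ T, B t u = 0) ∧ u ∉ T ∧ B u u = c := by
  obtain ⟨u, hu, huu⟩ := exists_orthogonal_anisotropic hV h2 hB hs T
  by_cases hc : c = 0
  · obtain ⟨u', hu', huu'⟩ := exists_orthogonal_anisotropic hV h2 hB hs (T ⊔ Submodule.span K {u})
    have h0 : B u u' = 0 :=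
      hu' u (Submodule.mem_sup_right (Submodule.mem_span_singleton_self u))
    obtain ⟨s, hs'⟩ := IsAlgClosed.exists_pow_nat_eq (-(B u u) / B u' u') (n := 2) two_pos
    refine ⟨u + s • u', fun t ht => ?_, fun h => huu ?_, ?_⟩
    · simp [hu t ht, hu' t (Submodule.mem_sup_left ht)]
    · have := hu _ h
      simpa [hs.eq u' u, h0] using this
    · simp only [map_add, map_smul, LinearMap.add_apply, LinearMap.smul_apply, smul_eq_mul, h0,
        hs.eq u' u, mul_zero, zero_add, add_zero, ← mul_assoc, ← pow_two, hs', hc]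
      field_simp
      ring
  · obtain ⟨s, hs'⟩ := IsAlgClosed.exists_pow_nat_eq (c / B u u) (n := 2) two_pos
    have h1 : B (s • u) (s • u) = c := by
      simp only [map_smul, LinearMap.smul_apply, smul_eq_mul, ← mul_assoc, ← pow_two, hs']
      field_simp
    refine ⟨s • u, fun t ht => by simp [hu t ht], fun h => hc ?_, h1⟩
    rw [← h1, map_smul, hu _ h, smul_zero]

theorem isHomogeneous_of_isSymm (hV : ¬ FiniteDimensional K V) (h2 : (2 : K) ≠ 0)
    [IsAlgClosed K] (hB : B.SeparatingLeft) (hs : B.IsSymm) : IsHomogeneous B Set.univ where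
  swap := ⟨1, fun x y => by rw [hs.eq, one_mul]⟩
  ext r _ := by
    refine ⟨Set.univ, PolyDef.univ, fun _ => trivial, fun _ _ _ _ => trivial,
      fun e he G _ hGe T hT => ?_⟩
    obtain ⟨w0, hw0⟩ := exists_form_eq hB he (fun i => G (Sum.inr (some i)))
    exact exists_gramExt_eq (exists_orthogonal_form_self_eq hV h2 hB hs
      (G (Sum.inr none) - B w0 w0)) hs hGe hw0 (by ring) T
  cofinal := cofinal_univ

/-- The form of two linear combinations is given by the matrix of the values `B (e i) (f j)`. -/
theorem form_linComb {ι κ : Type*} [Fintype ι] [Fintype κ] (e : ι → V) (f : κ → V) (a : ι → K)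
    (b : κ → K) :
    B (∑ i, a i • e i) (∑ j, b j • f j) = ∑ i, ∑ j, a i * b j * B (e i) (f j) := by
  simp only [map_sum, LinearMap.sum_apply, map_smul, LinearMap.smul_apply, smul_eq_mul]
  rw [Finset.sum_comm]
  refine Finset.sum_congr rfl fun i _ => ?_
  rw [Finset.mul_sum]
  exact Finset.sum_congr rfl fun j _ => by ring

theorem isHomogeneous_of_posDef [LinearOrder K] [IsStrictOrderedRing K] [IsRealClosed K]
    (hV : ¬ FiniteDimensional K V) (hs : B.IsSymm) (hpos : ∀ x, x ≠ 0 → 0 < B x x) :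
    IsHomogeneous B Set.univ where
  swap := ⟨1, fun x y => by rw [hs.eq, one_mul]⟩
  ext r _ := by
    -- `G` is realized if and only if the products with the tuple are those of a combination `α`
    -- of the tuple, and the square exceeds that of the combination.
    let S : Set ((Fin r ⊕ Unit) ⊕ ((Fin r × Fin r) ⊕ Option (Fin r)) → K) :=
      (⋂ i : Fin r, {v | MvPolynomial.eval v (MvPolynomial.X (Sum.inr (Sum.inr (some i)))) =
        MvPolynomial.eval v (∑ j, MvPolynomial.X (Sum.inl (Sum.inl j)) *
          MvPolynomial.X (Sum.inr (Sum.inl (i, j))))}) ∩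
      ({v | MvPolynomial.eval v (MvPolynomial.X (Sum.inr (Sum.inr none))) =
        MvPolynomial.eval v (∑ i, ∑ j, MvPolynomial.X (Sum.inl (Sum.inl i)) *
          MvPolynomial.X (Sum.inl (Sum.inl j)) * MvPolynomial.X (Sum.inr (Sum.inl (i, j))) +
          MvPolynomial.X (Sum.inl (Sum.inr ())) ^ 2)} ∩
      {v | MvPolynomial.eval v (MvPolynomial.X (Sum.inl (Sum.inr ()))) = 0}ᶜ)
    have hS : PolyDef K S := (PolyDef.iInter fun i => PolyDef.eqPoly _ _).inter
      ((PolyDef.eqPoly _ _).inter (PolyDef.zero _).compl)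
    have hmem : ∀ c G, Sum.elim c G ∈ S ↔
        (∀ i, G (Sum.inr (some i)) = ∑ j, c (Sum.inl j) * G (Sum.inl (i, j))) ∧
        (G (Sum.inr none) = ∑ i, ∑ j, c (Sum.inl i) * c (Sum.inl j) * G (Sum.inl (i, j)) +
          c (Sum.inr ()) ^ 2 ∧ c (Sum.inr ()) ≠ 0) := fun c G => by
      simp [S, Set.mem_inter_iff, Set.mem_iInter]
    refine ⟨_, hS.exFinite, fun _ => trivial, fun e he w hw => ?_, fun e he G hG hGe T hT => ?_⟩
    · set W := Submodule.span K (Set.range e) with hW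
      let e' : Fin r → W := fun i => ⟨e i, Submodule.subset_span ⟨i, rfl⟩⟩
      have he' : LinearIndependent K e' := LinearIndependent.of_comp W.subtype he
      have hsep : (B.restrict W).SeparatingLeft := fun x hx => by
        by_contra hne
        exact (hpos x (by simpa using hne)).ne' (hx x)
      obtain ⟨p, hp⟩ := exists_form_eq hsep he' (fun i => B (e i) w)
      obtain ⟨α, hα⟩ := (Submodule.mem_span_range_iff_exists_fun K).1 p.2
      have hp' : ∀ i, B (e i) p = B (e i) w := hp
      have hpw : ∀ x ∈ W, B x (w - p) = 0 := fun x hx => by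
        obtain ⟨β, rfl⟩ := (Submodule.mem_span_range_iff_exists_fun K).1 hx
        rw [map_sum, LinearMap.sum_apply]
        refine Finset.sum_eq_zero fun i _ => ?_
        simp [hp' i]
      have hne : w - p ≠ 0 := fun h => hw (by rw [sub_eq_zero.1 h]; exact p.2)
      obtain ⟨z, hz⟩ := IsRealClosed.nonneg_iff_isSquare.1 (hpos _ hne).le
      refine ⟨Sum.elim α fun _ => z, (hmem _ _).2 ⟨fun i => ?_, ?_, ?_⟩⟩
      · simp only [gramExt, Sum.elim_inl, Sum.elim_inr, Option.elim]
        rw [← hp' i, ← hα, map_sum]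
        simp
      · simp only [gramExt, Sum.elim_inl, Sum.elim_inr, Option.elim]
        rw [← form_linComb, hα, pow_two, ← hz]
        have h1 : w = p + (w - p) := by abel
        conv_lhs => rw [h1]
        rw [LinearMap.BilinForm.add_left, LinearMap.BilinForm.add_right, LinearMap.BilinForm.add_right,
          hpw p p.2, hs.eq (w - p) (p : V), hpw p p.2]
        ring
      · rintro h0
        simp only [Sum.elim_inr] at h0
        rw [h0, mul_zero] at hz
        exact (hpos _ hne).ne' hz
    · obtain ⟨c, hc⟩ := hG
      obtain ⟨h1, h2, h3⟩ := (hmem _ _).1 hc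
      have hc : ∀ T : Submodule K V, FiniteDimensional K T →
          ∃ u, (∀ t ∈ T, B t u = 0) ∧ u ∉ T ∧ B u u = c (Sum.inr ()) ^ 2 := fun T hT => by
        obtain ⟨u, hu, huT⟩ := exists_orthogonal_notMem (B := B) hV T T
        have hu0 : 0 < B u u := hpos u fun h => huT (h ▸ T.zero_mem)
        obtain ⟨z, hz⟩ := IsRealClosed.nonneg_iff_isSquare.1 hu0.le
        have hz0 : z ≠ 0 := fun h => hu0.ne' (by rw [hz, h, mul_zero])
        refine ⟨(c (Sum.inr ()) / z) • u, fun t ht => by simp [hu t ht], fun h => huT ?_, ?_⟩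
        · exact (Submodule.smul_mem_iff _ (div_ne_zero h3 hz0)).1 h
        · simp only [map_smul, LinearMap.smul_apply, smul_eq_mul, hz]
          field_simp
      refine exists_gramExt_eq hc hs (w0 := ∑ j, c (Sum.inl j) • e j) hGe (fun i => ?_) ?_ T
      · rw [h1, map_sum]
        simp [hGe]
      · rw [form_linComb, h2]
        simp [hGe]
  cofinal := cofinal_univ

end

/-! ### Elimination of vector quantifiers -/

section

variable {K : Type u} {V : Type v} [Field K] [AddCommGroup V] [Module K V]
  {B : LinearMap.BilinForm K V} {R : Set ℕ}

theorem linComb_eq_iff {r : ℕ} {e : Fin r → V} (he : LinearIndependent K e) (a b : Fin r → K) :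
    ∑ l, a l • e l = ∑ l, b l • e l ↔ ∀ l, a l = b l := by
  refine ⟨fun h => ?_, fun h => by simp [h]⟩
  have h1 : ∑ l, (a l - b l) • e l = 0 := by
    simp only [sub_smul, Finset.sum_sub_distrib, h, sub_self]
  exact fun l => sub_eq_zero.1 (Fintype.linearIndependent_iff.1 he _ h1 l)

open MvPolynomial in
/-- For vectors written as combinations `∑ l, A (i, l) • e l` of an independent tuple `e`, the truth
of a formula is a condition on `A`, the Gram matrix of `e` and the scalars, and this condition is
definable in the field. -/
theorem exists_polyDef_realize (hB : IsHomogeneous B R) {ι κ : Type} (φ : Fml ι κ) :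
    ∀ r ∈ R, ∃ D : Set (((ι × Fin r) ⊕ (Fin r × Fin r)) ⊕ κ → K), PolyDef K D ∧
      ∀ e : Fin r → V, LinearIndependent K e → ∀ (A : ι × Fin r → K) (y : κ → K),
        φ.Realize B (fun i => ∑ l, A (i, l) • e l) y ↔
          Sum.elim (Sum.elim A fun ij => B (e ij.1) (e ij.2)) y ∈ D := by
  induction φ with
  | eqV i j =>
    intro r _
    refine ⟨_, PolyDef.iInter fun l : Fin r =>
      PolyDef.eqPoly (X (Sum.inl (Sum.inl (i, l)))) (X (Sum.inl (Sum.inl (j, l)))),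
      fun e he A y => ?_⟩
    simp [Fml.Realize, linComb_eq_iff he]
  | zeroV i =>
    intro r _
    refine ⟨_, PolyDef.iInter fun l : Fin r =>
      PolyDef.eqPoly (X (Sum.inl (Sum.inl (i, l)))) 0, fun e he A y => ?_⟩
    simpa [Fml.Realize] using linComb_eq_iff he (fun l => A (i, l)) 0
  | addV i j k =>
    intro r _
    refine ⟨_, PolyDef.iInter fun l : Fin r =>
      PolyDef.eqPoly (X (Sum.inl (Sum.inl (i, l))) + X (Sum.inl (Sum.inl (j, l))))
        (X (Sum.inl (Sum.inl (k, l)))), fun e he A y => ?_⟩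
    simpa [Fml.Realize, add_smul, Finset.sum_add_distrib] using
      linComb_eq_iff he (fun l => A (i, l) + A (j, l)) fun l => A (k, l)
  | eqK a b =>
    intro r _
    exact ⟨_, PolyDef.eqPoly (X (Sum.inr a)) (X (Sum.inr b)), fun e he A y => by
      simp [Fml.Realize]⟩
  | zeroK a =>
    intro r _
    exact ⟨_, PolyDef.eqPoly (X (Sum.inr a)) 0, fun e he A y => by simp [Fml.Realize]⟩
  | oneK a =>
    intro r _
    exact ⟨_, PolyDef.eqPoly (X (Sum.inr a)) 1, fun e he A y => by simp [Fml.Realize]⟩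
  | addK a b c =>
    intro r _
    exact ⟨_, PolyDef.eqPoly (X (Sum.inr a) + X (Sum.inr b)) (X (Sum.inr c)),
      fun e he A y => by simp [Fml.Realize]⟩
  | mulK a b c =>
    intro r _
    exact ⟨_, PolyDef.eqPoly (X (Sum.inr a) * X (Sum.inr b)) (X (Sum.inr c)),
      fun e he A y => by simp [Fml.Realize]⟩
  | smul a i j =>
    intro r _
    refine ⟨_, PolyDef.iInter fun l : Fin r =>
      PolyDef.eqPoly (X (Sum.inr a) * X (Sum.inl (Sum.inl (i, l))))
        (X (Sum.inl (Sum.inl (j, l)))), fun e he A y => ?_⟩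
    simpa [Fml.Realize, Finset.smul_sum, smul_smul] using
      linComb_eq_iff he (fun l => y a * A (i, l)) fun l => A (j, l)
  | form i j a =>
    intro r _
    refine ⟨_, PolyDef.eqPoly (∑ l : Fin r, ∑ m : Fin r, X (Sum.inl (Sum.inl (i, l))) *
      X (Sum.inl (Sum.inl (j, m))) * X (Sum.inl (Sum.inr (l, m)))) (X (Sum.inr a)),
      fun e he A y => ?_⟩
    simp [Fml.Realize, -map_sum, form_linComb]
    simp [map_sum]
  | neg φ ih =>
    intro r hr
    obtain ⟨D, hD, h⟩ := ih r hr
    exact ⟨_, hD.compl, fun e he A y => not_congr (h e he A y)⟩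
  | and φ ψ ih1 ih2 =>
    intro r hr
    obtain ⟨D1, hD1, h1⟩ := ih1 r hr
    obtain ⟨D2, hD2, h2⟩ := ih2 r hr
    exact ⟨_, hD1.inter hD2, fun e he A y => and_congr (h1 e he A y) (h2 e he A y)⟩
  | @exK ι κ φ ih =>
    intro r hr
    obtain ⟨D, hD, h⟩ := ih r hr
    refine ⟨_, (hD.preimage (β := Option (((ι × Fin r) ⊕ (Fin r × Fin r)) ⊕ κ))
      (Sum.elim (fun a => some (Sum.inl a)) (Option.map Sum.inr))).ex, fun e he A y => ?_⟩
    refine exists_congr fun c => (h e he A _).trans (iff_of_eq (congrArg (· ∈ D) ?_))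
    funext x
    rcases x with (x | x) | _ | x <;> rfl
  | @exV ι κ φ ih =>
    intro r hr
    obtain ⟨ε, hε⟩ := hB.swap
    obtain ⟨S, hS, hSr, hS1, hS2⟩ := hB.ext r hr
    obtain ⟨D, hD, h⟩ := ih r hr
    -- The witness may lie in the span of the tuple.
    let f : ((Option ι × Fin r) ⊕ (Fin r × Fin r)) ⊕ κ →
        Fin r ⊕ (((ι × Fin r) ⊕ (Fin r × Fin r)) ⊕ κ) :=
      Sum.elim (Sum.elim (fun ol => Option.elim ol.1 (Sum.inl ol.2)
        fun i => Sum.inr (Sum.inl (Sum.inl (i, ol.2))))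
        fun ij => Sum.inr (Sum.inl (Sum.inr ij))) fun k => Sum.inr (Sum.inr k)
    have hD0 := (hD.preimage f).exFinite
    have h0 : ∀ e : Fin r → V, LinearIndependent K e → ∀ (A : ι × Fin r → K) (y : κ → K),
        (∃ w ∈ Submodule.span K (Set.range e), φ.Realize B
          (fun o => Option.elim o w fun i => ∑ l, A (i, l) • e l) y) ↔
          Sum.elim (Sum.elim A fun ij => B (e ij.1) (e ij.2)) y ∈
            {v | ∃ c : Fin r → K, Sum.elim c v ∈ {w | w ∘ f ∈ D}} := fun e he A y => by
      refine Iff.trans ?_ (exists_congr fun c => (h e he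
        (fun ol => Option.elim ol.1 (c ol.2) fun i => A (i, ol.2)) y).trans
          (iff_of_eq (congrArg (· ∈ D) ?_)))
      · simp only [Submodule.mem_span_range_iff_exists_fun, exists_exists_eq_and]
        refine exists_congr fun c => ?_
        convert! Iff.rfl using 2
        funext o
        cases o <;> rfl
      · funext x
        rcases x with (⟨_ | i, l⟩ | x) | x <;> rfl
    by_cases hr1 : r + 1 ∈ R
    · obtain ⟨D', hD', h'⟩ := ih (r + 1) hr1
      -- Otherwise it is added to the tuple.
      let q : ((Option ι × Fin (r + 1)) ⊕ (Fin (r + 1) × Fin (r + 1))) ⊕ κ →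
          MvPolynomial (Option (Fin r) ⊕ (((ι × Fin r) ⊕ (Fin r × Fin r)) ⊕ κ)) K :=
        Sum.elim (Sum.elim
          (fun ol => Fin.cases (motive := fun _ => MvPolynomial _ K)
            (Option.elim ol.1 1 fun _ => 0)
            (fun l => Option.elim ol.1 0 fun i => X (Sum.inr (Sum.inl (Sum.inl (i, l))))) ol.2)
          (fun ij => Fin.cases (motive := fun _ => MvPolynomial _ K)
            (Fin.cases (motive := fun _ => MvPolynomial _ K)
              (X (Sum.inl none)) (fun j => C ε * X (Sum.inl (some j))) ij.2)
            (fun i => Fin.cases (motive := fun _ => MvPolynomial _ K)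
              (X (Sum.inl (some i))) (fun j => X (Sum.inr (Sum.inl (Sum.inr (i, j))))) ij.2) ij.1))
          (fun k => X (Sum.inr (Sum.inr k)))
      have hD1 := ((hS.preimage (β := Option (Fin r) ⊕ (((ι × Fin r) ⊕ (Fin r × Fin r)) ⊕ κ))
        (Sum.elim (fun ij => Sum.inr (Sum.inl (Sum.inr ij))) Sum.inl)).inter
          (hD'.subst q)).exFinite
      have key : ∀ e : Fin r → V, LinearIndependent K e →
          ∀ w ∉ Submodule.span K (Set.range e), ∀ (A : ι × Fin r → K) (y : κ → K),
          φ.Realize B (fun o => Option.elim o w fun i => ∑ l, A (i, l) • e l) y ↔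
          (fun a => eval (Sum.elim (gramExt B e w ∘ Sum.inr)
            (Sum.elim (Sum.elim A fun ij => B (e ij.1) (e ij.2)) y)) (q a)) ∈ D' := by
        intro e he w hw A y
        have he' : LinearIndependent K (Fin.cons w e : Fin (r + 1) → V) :=
          linearIndependent_finCons.2 ⟨he, hw⟩
        have := h' _ he' (fun ol => Fin.cases (motive := fun _ => K)
            (Option.elim ol.1 1 fun _ => 0)
            (fun l => Option.elim ol.1 0 fun i => A (i, l)) ol.2) y
        convert! this using 2
        · funext o
          cases o <;> simp [Fin.sum_univ_succ]
        · funext x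
          rcases x with (⟨_ | i, l⟩ | ⟨i, j⟩) | k
          · refine Fin.cases ?_ (fun l => ?_) l <;> simp [q]
          · refine Fin.cases ?_ (fun l => ?_) l <;> simp [q]
          · refine Fin.cases ?_ (fun i => ?_) i <;> refine Fin.cases ?_ (fun j => ?_) j <;>
              simp [q, gramExt, hε (e _) w]
          · simp [q]
      refine ⟨_, hD0.union hD1, fun e he A y => ?_⟩
      rw [Set.mem_union, ← h0 e he A y]
      constructor
      · rintro ⟨w, hw⟩
        by_cases hwe : w ∈ Submodule.span K (Set.range e)
        · exact Or.inl ⟨w, hwe, hw⟩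
        · refine Or.inr ⟨gramExt B e w ∘ Sum.inr, ?_, (key e he w hwe A y).1 hw⟩
          rw [Set.mem_ofPred_eq]
          convert! hS1 e he w hwe using 1
          funext x
          rcases x with x | x <;> rfl
      · rintro (⟨w, -, hw⟩ | ⟨c, hc1, hc2⟩)
        · exact ⟨w, hw⟩
        · obtain ⟨w, hw, hG⟩ := hS2 e he _ hc1 (fun i j => rfl) (Submodule.span K (Set.range e))
            (span_range_finiteDimensional e)
          refine ⟨w, (key e he w hw A y).2 ?_⟩
          have : gramExt B e w ∘ Sum.inr = c := by
            rw [hG]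
            rfl
          rw [this]
          exact hc2
    · refine ⟨_, hD0, fun e he A y => ?_⟩
      rw [← h0 e he A y]
      refine exists_congr fun w => ⟨fun hw => ⟨?_, hw⟩, fun hw => hw.2⟩
      by_contra hwe
      exact hr1 (hSr ⟨_, hS1 e he w hwe⟩)

open MvPolynomial in
/-- In coordinates with respect to a tuple of vectors, a definable set becomes a set definable in
the field. -/
theorem polyDef_coord (hB : IsHomogeneous B R) {ι κ : Type} {S : Set (Tup K V ι κ)}
    (hS : Definable B S) {r : ℕ} (e : Fin r → V) :
    PolyDef K {z : (ι × Fin r) ⊕ κ → K |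
      ((fun i => ∑ l, z (Sum.inl (i, l)) • e l, z ∘ Sum.inr) : Tup K V ι κ) ∈ S} := by
  obtain ⟨a, b, φ, p, q, -, rfl⟩ := hS
  obtain ⟨T, hle, hT, hR⟩ := hB.cofinal (Submodule.span K (Set.range p ∪ Set.range e))
    (FiniteDimensional.span_of_finite K ((Set.finite_range p).union (Set.finite_range e)))
  obtain ⟨D, hD, h⟩ := exists_polyDef_realize hB φ _ hR
  let β := Module.finBasis K T
  have hβ : LinearIndependent K (fun t => (β t : V)) :=
    β.linearIndependent.map' T.subtype (Submodule.ker_subtype T)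
  have hmem : ∀ v ∈ T, ∃ c : Fin (Module.finrank K T) → K, v = ∑ t, c t • (β t : V) := by
    intro v hv
    refine ⟨fun t => β.repr ⟨v, hv⟩ t, ?_⟩
    have := congrArg T.subtype (β.sum_repr ⟨v, hv⟩)
    rw [map_sum] at this
    exact this.symm
  have hp : ∀ i, p i ∈ T := fun i => hle (Submodule.subset_span (Or.inl ⟨i, rfl⟩))
  have he : ∀ i, e i ∈ T := fun i => hle (Submodule.subset_span (Or.inr ⟨i, rfl⟩))
  choose c hc using fun i => hmem _ (hp i)
  choose d hd using fun i => hmem _ (he i)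
  convert! hD.subst (β := (ι × Fin r) ⊕ κ) (Sum.elim (Sum.elim
    (fun x => Sum.elim (fun i => C (c i x.2))
      (fun i => ∑ l, X (Sum.inl (i, l)) * C (d l x.2)) x.1)
    (fun ij => C (B (β ij.1) (β ij.2))))
    (Sum.elim (fun i => C (q i)) (fun k => X (Sum.inr k)))) using 1
  ext z
  have := h _ hβ (fun x => Sum.elim (fun i => c i x.2)
      (fun i => ∑ l, z (Sum.inl (i, l)) * d l x.2) x.1) (Sum.elim q (z ∘ Sum.inr))
  simp only [Set.mem_ofPred_eq]
  convert! this using 2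
  · funext i
    rcases i with i | i
    · exact hc i
    · simp only [Sum.elim_inr, Finset.sum_smul]
      rw [Finset.sum_comm]
      refine Finset.sum_congr rfl fun l _ => ?_
      rw [hd l, Finset.smul_sum]
      refine Finset.sum_congr rfl fun t _ => ?_
      rw [smul_smul]
  · funext x
    rcases x with (⟨i | i, t⟩ | x) | x | x <;> simp

/-- `g` restricts to an injective linear isometry on `T`. -/
structure IsPartialIso (B : LinearMap.BilinForm K V) (T : Submodule K V) (g : V →ₗ[K] V) :
    Prop where
  form_map : ∀ x ∈ T, ∀ y ∈ T, B (g x) (g y) = B x y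
  eq_zero : ∀ x ∈ T, g x = 0 → x = 0

theorem isPartialIso_id (T : Submodule K V) : IsPartialIso B T LinearMap.id :=
  ⟨fun _ _ _ _ => rfl, fun _ _ h => h⟩

theorem exists_basis_tuple (T : Submodule K V) [FiniteDimensional K T] :
    ∃ (r : ℕ) (e : Fin r → V), LinearIndependent K e ∧ Submodule.span K (Set.range e) = T := by
  let β := Module.finBasis K T
  refine ⟨_, fun t => (β t : V),
    β.linearIndependent.map' T.subtype (Submodule.ker_subtype T), ?_⟩
  have := congrArg (Submodule.map T.subtype) β.span_eq
  rw [Submodule.map_span, ← Set.range_comp] at this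
  simpa using! this

theorem IsPartialIso.linearIndependent {T : Submodule K V} {g : V →ₗ[K] V}
    (hg : IsPartialIso B T g) {r : ℕ} {e : Fin r → V} (he : LinearIndependent K e)
    (hT : Submodule.span K (Set.range e) = T) : LinearIndependent K (g ∘ e) := by
  rw [LinearMap.linearIndependent_iff_of_disjoint]
  · exact he
  · rw [hT, Submodule.disjoint_def]
    exact fun x hx h => hg.eq_zero x hx h

/-- Partial isometries between finite-dimensional subspaces are elementary. -/
theorem IsPartialIso.realize_iff (hB : IsHomogeneous B Set.univ) {T : Submodule K V}
    [FiniteDimensional K T] {g : V →ₗ[K] V} (hg : IsPartialIso B T g) {ι κ : Type} (φ : Fml ι κ)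
    (x : ι → V) (hx : ∀ i, x i ∈ T) (y : κ → K) :
    φ.Realize B (g ∘ x) y ↔ φ.Realize B x y := by
  obtain ⟨r, e, he, hT⟩ := exists_basis_tuple T
  obtain ⟨D, -, h⟩ := exists_polyDef_realize hB φ r trivial
  have heT : ∀ i, e i ∈ T := fun i => hT ▸ Submodule.subset_span ⟨i, rfl⟩
  have hx' : ∀ i, ∃ c : Fin r → K, ∑ l, c l • e l = x i := fun i =>
    (Submodule.mem_span_range_iff_exists_fun K).1 (hT ▸ hx i)
  choose c hc using hx'
  have h1 := h e he (fun il => c il.1 il.2) y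
  have h2 := h (g ∘ e) (hg.linearIndependent he hT) (fun il => c il.1 il.2) y
  have hG : (fun ij : Fin r × Fin r => B ((g ∘ e) ij.1) ((g ∘ e) ij.2)) =
      fun ij => B (e ij.1) (e ij.2) :=
    funext fun ij => hg.form_map _ (heT _) _ (heT _)
  rw [hG, ← h1] at h2
  convert! h2 using 2
  · funext i
    simp [← hc]
  · funext i
    exact (hc i).symm

theorem IsPartialIso.extend (hB : IsHomogeneous B Set.univ) {T : Submodule K V}
    [FiniteDimensional K T] {g : V →ₗ[K] V} (hg : IsPartialIso B T g) {u : V} (hu : u ∉ T)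
    (T' : Submodule K V) [FiniteDimensional K T'] :
    ∃ g' : V →ₗ[K] V, IsPartialIso B (T ⊔ Submodule.span K {u}) g' ∧ (∀ x ∈ T, g' x = g x) ∧
      ∀ x ∈ T ⊔ Submodule.span K {u}, g' x ∈ T' → x ∈ T := by
  obtain ⟨r, e, he, hT⟩ := exists_basis_tuple T
  obtain ⟨ε, hε⟩ := hB.swap
  obtain ⟨S, -, -, hS1, hS2⟩ := hB.ext r trivial
  have heT : ∀ i, e i ∈ T := fun i => hT ▸ Submodule.subset_span ⟨i, rfl⟩
  obtain ⟨w, hw, hG⟩ := hS2 (g ∘ e) (hg.linearIndependent he hT) _ (hS1 e he u (hT ▸ hu))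
    (fun i j => (hg.form_map _ (heT i) _ (heT j)).symm) (T' ⊔ T.map g) inferInstance
  obtain ⟨φ, hφu, hφT⟩ := Submodule.exists_dual_map_eq_bot_of_notMem hu inferInstance
  have hφT' : ∀ x ∈ T, φ x = 0 := fun x hx => by
    have : φ x ∈ T.map φ := Submodule.mem_map_of_mem hx
    rwa [hφT, Submodule.mem_bot] at this
  have hww : B w w = B u u := congrFun hG (Sum.inr none)
  have hgw : ∀ x ∈ T, B (g x) w = B x u := fun x hx => by
    obtain ⟨c, rfl⟩ := (Submodule.mem_span_range_iff_exists_fun K).1 (hT ▸ hx)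
    have : ∀ i, B (g (e i)) w = B (e i) u := fun i => congrFun hG (Sum.inr (some i))
    simp [this]
  have hwg : ∀ x ∈ T, B w (g x) = B u x := fun x hx => by rw [hε (g x), hgw x hx, ← hε]
  let g' : V →ₗ[K] V := g + ((φ u)⁻¹ • φ).smulRight (w - g u)
  have h1 : ∀ x ∈ T, g' x = g x := fun x hx => by simp [g', hφT' x hx]
  have h2 : g' u = w := by simp [g', hφu]
  have hmem : ∀ x ∈ T ⊔ Submodule.span K {u}, ∃ t ∈ T, ∃ c : K, x = t + c • u := fun x hx => by
    obtain ⟨t, ht, y, hy, rfl⟩ := Submodule.mem_sup.1 hx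
    obtain ⟨c, rfl⟩ := Submodule.mem_span_singleton.1 hy
    exact ⟨t, ht, c, rfl⟩
  -- `w` is independent of `T'` and of the image of `T`.
  have hc0 : ∀ t ∈ T, ∀ c : K, g' (t + c • u) ∈ T' → c = 0 := fun t ht c h => by
    by_contra hc
    rw [map_add, map_smul, h1 t ht, h2] at h
    refine hw ((Submodule.smul_mem_iff _ hc).1 ?_)
    have := Submodule.sub_mem _ (Submodule.mem_sup_left (T := T.map g) h)
      (Submodule.mem_sup_right (Submodule.mem_map_of_mem ht))
    rwa [add_sub_cancel_left] at this
  refine ⟨g', ⟨fun x hx y hy => ?_, fun x hx h0 => ?_⟩, h1, fun x hx h => ?_⟩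
  · obtain ⟨t, ht, c, rfl⟩ := hmem x hx
    obtain ⟨s, hs, d, rfl⟩ := hmem y hy
    simp only [map_add, map_smul, h1 t ht, h1 s hs, h2, LinearMap.add_apply, LinearMap.smul_apply,
      hg.form_map t ht s hs, hgw t ht, hwg s hs, hww]
  · obtain ⟨t, ht, c, rfl⟩ := hmem x hx
    obtain rfl := hc0 t ht c (h0 ▸ T'.zero_mem)
    rw [zero_smul, add_zero] at h0 ⊢
    exact hg.eq_zero t ht (h1 t ht ▸ h0)
  · obtain ⟨t, ht, c, rfl⟩ := hmem x hx
    obtain rfl := hc0 t ht c h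
    simpa using ht

/-- Over a subspace `S`, any finite-dimensional `T` can be moved to a position independent of any
given finite-dimensional subspace. -/
theorem exists_isPartialIso_independent (hB : IsHomogeneous B Set.univ) {S T : Submodule K V}
    [FiniteDimensional K T] (hST : S ≤ T) (T' : Submodule K V) [FiniteDimensional K T'] :
    ∃ g : V →ₗ[K] V, IsPartialIso B T g ∧ (∀ x ∈ S, g x = x) ∧ ∀ x ∈ T, g x ∈ T' → x ∈ S := by
  classical
  have : FiniteDimensional K S := Submodule.finiteDimensional_of_le hST
  suffices h : ∀ s : Finset V, ∃ g : V →ₗ[K] V, IsPartialIso B (S ⊔ Submodule.span K s) g ∧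
      (∀ x ∈ S, g x = x) ∧ ∀ x ∈ S ⊔ Submodule.span K s, g x ∈ T' → x ∈ S by
    obtain ⟨s, hs⟩ := (Submodule.fg_iff_finiteDimensional T).2 inferInstance
    have := h s
    rwa [hs, sup_eq_right.2 hST] at this
  intro s
  induction s using Finset.induction with
  | empty => exact ⟨LinearMap.id, isPartialIso_id _, fun _ _ => rfl, fun x hx _ => by simpa using hx⟩
  | insert u s _ ih =>
    obtain ⟨g, hg, hgS, hgT'⟩ := ih
    have heq : S ⊔ Submodule.span K (insert u s : Finset V) =
        S ⊔ Submodule.span K s ⊔ Submodule.span K {u} := by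
      rw [Finset.coe_insert, Submodule.span_insert, sup_assoc, sup_comm (Submodule.span K {u})]
    rw [heq]
    by_cases hu : u ∈ S ⊔ Submodule.span K s
    · rw [sup_eq_left.2 ((Submodule.span_singleton_le_iff_mem _ _).2 hu)]
      exact ⟨g, hg, hgS, hgT'⟩
    · obtain ⟨g', h1, h2, h3⟩ := hg.extend hB hu T'
      refine ⟨g', h1, fun x hx => (h2 x (Submodule.mem_sup_left hx)).trans (hgS x hx),
        fun x hx h => ?_⟩
      have hx' := h3 x hx h
      exact hgT' x hx' (h2 x hx' ▸ h)

end

/-! ### Fields acted upon by partial isometries -/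

theorem Tup.append_injective {K : Type u} {V : Type v} {ι κ ι' κ' : Type} {x x' : Tup K V ι κ}
    {y y' : Tup K V ι' κ'} (h : x.append y = x'.append y') : x = x' ∧ y = y' :=
  ⟨congrArg (fun z : Tup K V _ _ => ((z.1 ∘ Sum.inl, z.2 ∘ Sum.inl) : Tup K V _ _)) h,
    congrArg (fun z : Tup K V _ _ => ((z.1 ∘ Sum.inr, z.2 ∘ Sum.inr) : Tup K V _ _)) h⟩

section

variable {K : Type u} {V : Type v} [Field K] [AddCommGroup V] [Module K V]
  {B : LinearMap.BilinForm K V}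

/-- A field `F` whose elements `a` have finite-dimensional supports `s a ≤ V` containing `W`, such
that partial isometries over `W` induce partial automorphisms of `F`. -/
structure IsSupport (B : LinearMap.BilinForm K V) {F : Type w} [Field F] (W : Submodule K V)
    (s : F → Submodule K V) : Prop where
  le : ∀ a, W ≤ s a
  finite : ∀ a, FiniteDimensional K (s a)
  act : ∀ T : Submodule K V, FiniteDimensional K T → W ≤ T → ∀ g, IsPartialIso B T g →
    (∀ x ∈ W, g x = x) → ∃ f : F → F,
      (∀ a, s a ≤ T → s (f a) = (s a).map g) ∧
      (∀ a, s a ≤ T → (∀ x ∈ s a, g x = x) → f a = a) ∧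
      (∀ a b, s a ≤ T → s b ≤ T → s (a + b) ≤ T → f (a + b) = f a + f b) ∧
      (∀ a b, s a ≤ T → s b ≤ T → s (a * b) ≤ T → f (a * b) = f a * f b)

theorem IsPartialIso.finrank_map {T S : Submodule K V} {g : V →ₗ[K] V} (hg : IsPartialIso B T g)
    (hS : S ≤ T) : Module.finrank K (S.map g) = Module.finrank K S := by
  have hinj : Function.Injective (g.comp S.subtype) := by
    rw [injective_iff_map_eq_zero]
    exact fun x hx => Subtype.ext (hg.eq_zero x (hS x.2) hx)
  rw [← LinearMap.finrank_range_of_inj hinj, LinearMap.range_comp, Submodule.range_subtype]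

namespace IsSupport

variable {F : Type w} [Field F] {W : Submodule K V} {s : F → Submodule K V}

/-- An element that every partial isometry over `S` fixes has its support in `S`. -/
theorem le_of_fixed (hB : IsHomogeneous B Set.univ) (hs : IsSupport B W s) {S : Submodule K V}
    [FiniteDimensional K S] (hS : W ≤ S) (c : F)
    (h : ∀ (T : Submodule K V) (g : V →ₗ[K] V), S ≤ T → s c ≤ T → (∀ x ∈ S, g x = x) →
      ∀ f : F → F,
      (∀ a, s a ≤ T → (∀ x ∈ s a, g x = x) → f a = a) →
      (∀ a b, s a ≤ T → s b ≤ T → s (a + b) ≤ T → f (a + b) = f a + f b) →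
      (∀ a b, s a ≤ T → s b ≤ T → s (a * b) ≤ T → f (a * b) = f a * f b) → f c = c) :
    s c ≤ S := by
  have := hs.finite c
  obtain ⟨g, hg, hgS, hgT⟩ := exists_isPartialIso_independent hB
    (le_sup_left : S ≤ S ⊔ s c) (S ⊔ s c)
  obtain ⟨f, hf1, hf2, hf3, hf4⟩ := hs.act (S ⊔ s c) inferInstance (hS.trans le_sup_left) g hg
    fun x hx => hgS x (hS hx)
  have hc := h _ g le_sup_left le_sup_right hgS f hf2 hf3 hf4
  have hmap := hf1 c le_sup_right
  rw [hc] at hmap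
  intro x hx
  refine hgT x (Submodule.mem_sup_right hx) (Submodule.mem_sup_right ?_)
  rw [hmap]
  exact Submodule.mem_map_of_mem hx

variable (hB : IsHomogeneous B Set.univ) (hs : IsSupport B W s)

include hB hs

theorem support_add (u v : F) : s (u + v) ≤ s u ⊔ s v := by
  have := hs.finite u
  have := hs.finite v
  refine hs.le_of_fixed hB ((hs.le u).trans le_sup_left) _ fun T g hT hc hg f hf2 hf3 hf4 => ?_
  rw [hf3 u v (le_sup_left.trans hT) (le_sup_right.trans hT) hc,
    hf2 u (le_sup_left.trans hT) fun x hx => hg x (Submodule.mem_sup_left hx),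
    hf2 v (le_sup_right.trans hT) fun x hx => hg x (Submodule.mem_sup_right hx)]

theorem support_mul (u v : F) : s (u * v) ≤ s u ⊔ s v := by
  have := hs.finite u
  have := hs.finite v
  refine hs.le_of_fixed hB ((hs.le u).trans le_sup_left) _ fun T g hT hc hg f hf2 hf3 hf4 => ?_
  rw [hf4 u v (le_sup_left.trans hT) (le_sup_right.trans hT) hc,
    hf2 u (le_sup_left.trans hT) fun x hx => hg x (Submodule.mem_sup_left hx),
    hf2 v (le_sup_right.trans hT) fun x hx => hg x (Submodule.mem_sup_right hx)]

theorem support_sub {u v z : F} (h : u + v = z) : s v ≤ s u ⊔ s z := by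
  have := hs.finite u
  have := hs.finite z
  refine hs.le_of_fixed hB ((hs.le u).trans le_sup_left) _ fun T g hT hc hg f hf2 hf3 hf4 => ?_
  have h1 := hf3 u v (le_sup_left.trans hT) hc (h ▸ le_sup_right.trans hT)
  rw [h, hf2 u (le_sup_left.trans hT) fun x hx => hg x (Submodule.mem_sup_left hx),
    hf2 z (le_sup_right.trans hT) fun x hx => hg x (Submodule.mem_sup_right hx), ← h] at h1
  exact (add_left_cancel h1).symm

theorem support_div {u v z : F} (h : u * v = z) (hu : u ≠ 0) : s v ≤ s u ⊔ s z := by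
  have := hs.finite u
  have := hs.finite z
  refine hs.le_of_fixed hB ((hs.le u).trans le_sup_left) _ fun T g hT hc hg f hf2 hf3 hf4 => ?_
  have h1 := hf4 u v (le_sup_left.trans hT) hc (h ▸ le_sup_right.trans hT)
  rw [h, hf2 u (le_sup_left.trans hT) fun x hx => hg x (Submodule.mem_sup_left hx),
    hf2 z (le_sup_right.trans hT) fun x hx => hg x (Submodule.mem_sup_right hx), ← h] at h1
  exact (mul_left_cancel₀ hu h1).symm

/-- If the dimensions of the supports are bounded, all supports are trivial. Otherwise take `a` with
support of the greatest dimension, independent conjugates `b` and `x` of `a`, and the point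
`(x, y)` with `y = a * x + b` of the line given by `(a, b)`. By modularity of the dimension, the
supports of the line and of the point have a large intersection. The supports of a conjugate
`(x', y')` of the point over the line contain it as well, so the two points together have a support
of too small a dimension, given that they determine the line and are independent over it. -/
theorem support_eq (N : ℕ) (hN : ∀ a, Module.finrank K (s a) ≤ N) (c : F) : s c ≤ W := by
  have hfin := hs.finite
  have hWfin : FiniteDimensional K W := Submodule.finiteDimensional_of_le (hs.le c)
  obtain ⟨a, ha⟩ : ∃ a, ∀ b, Module.finrank K (s b) ≤ Module.finrank K (s a) := by
    have hbdd : BddAbove (Set.range fun a => Module.finrank K (s a)) :=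
      ⟨N, by rintro _ ⟨a, rfl⟩; exact hN a⟩
    obtain ⟨a, ha⟩ := Nat.sSup_mem ⟨_, Set.mem_range_self c⟩ hbdd
    exact ⟨a, fun b => (le_csSup hbdd ⟨b, rfl⟩).trans_eq ha.symm⟩
  by_contra hc
  have hlt : Module.finrank K W < Module.finrank K (s a) :=
    (Submodule.finrank_lt_finrank_of_lt (lt_of_le_not_ge (hs.le c) hc)).trans_le (ha c)
  have himg : ∀ T' : Submodule K V, FiniteDimensional K T' → W ≤ T' → ∃ b,
      Module.finrank K (s b) = Module.finrank K (s a) ∧ T' ⊓ s b = W := by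
    intro T' _ hWT'
    obtain ⟨g, hg, hgW, hgT⟩ := exists_isPartialIso_independent hB (hs.le a) T'
    obtain ⟨f, hf, -⟩ := hs.act (s a) (hfin a) (hs.le a) g hg hgW
    refine ⟨f a, ?_, le_antisymm ?_ (le_inf hWT' (hs.le _))⟩
    · rw [hf a le_rfl, hg.finrank_map le_rfl]
    · rw [hf a le_rfl]
      rintro _ ⟨hz, z, hza, rfl⟩
      have hzW := hgT z hza hz
      rwa [hgW z hzW]
  obtain ⟨b, hb, hab⟩ := himg (s a) (hfin a) (hs.le a)
  obtain ⟨x, hx, habx⟩ := himg (s a ⊔ s b) inferInstance ((hs.le a).trans le_sup_left)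
  set L := s a ⊔ s b with hL
  set T := L ⊔ s x with hT
  obtain ⟨g, hg, hgL, hgT⟩ := exists_isPartialIso_independent hB (le_sup_left : L ≤ T) T
  have hWL : W ≤ L := (hs.le a).trans le_sup_left
  obtain ⟨f, hf1, hf2, hf3, hf4⟩ := hs.act T inferInstance (hWL.trans le_sup_left) g hg
    fun x hx => hgL x (hWL hx)
  have haT : s a ≤ T := le_sup_left.trans le_sup_left
  have hbT : s b ≤ T := le_sup_right.trans le_sup_left
  have hxT : s x ≤ T := le_sup_right
  have haxT : s (a * x) ≤ T := (hs.support_mul hB a x).trans (sup_le haT hxT)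
  have hyT : s (a * x + b) ≤ T := (hs.support_add hB _ b).trans (sup_le haxT hbT)
  have hy' : f (a * x + b) = a * f x + b := by
    rw [hf3 _ _ haxT hbT hyT, hf4 _ _ haT hxT haxT,
      hf2 a haT fun x hx => hgL x (Submodule.mem_sup_left hx),
      hf2 b hbT fun x hx => hgL x (Submodule.mem_sup_right hx)]
  have hinf : T ⊓ T.map g = L := by
    refine le_antisymm ?_ (le_inf le_sup_left fun z hz => ⟨z, le_sup_left (a := L) hz, hgL z hz⟩)
    rintro _ ⟨hz, z, hzT, rfl⟩
    have hzL := hgT z hzT hz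
    rwa [hgL z hzL]
  have hxx' : x ≠ f x := by
    intro h
    have h1 := hf1 x hxT
    rw [← h] at h1
    have h2 : s x ≤ L := by
      rw [← hinf]
      refine le_inf hxT ?_
      rw [h1]
      exact Submodule.map_mono hxT
    rw [inf_eq_right.2 h2] at habx
    rw [← hx, habx] at hlt
    exact lt_irrefl _ hlt
  set y := a * x + b with hy
  set P := s x ⊔ s y with hP
  have hPT : P ≤ T := sup_le hxT hyT
  have hP' : P.map g = s (f x) ⊔ s (f y) := by
    rw [hP, Submodule.map_sup, hf1 x hxT, hf1 y hyT]
  -- The two points determine the line.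
  have hline : L ≤ P ⊔ P.map g := by
    have hxP : s x ≤ P ⊔ P.map g := le_sup_left.trans le_sup_left
    have hyP : s y ≤ P ⊔ P.map g := le_sup_right.trans le_sup_left
    have hxP' : s (f x) ≤ P ⊔ P.map g := hP' ▸ le_sup_left.trans le_sup_right
    have hyP' : s (f y) ≤ P ⊔ P.map g := hP' ▸ le_sup_right.trans le_sup_right
    have h1 := (hs.support_sub hB (add_sub_cancel (f x) x)).trans (sup_le hxP' hxP)
    have h2 := (hs.support_sub hB (add_sub_cancel (f y) y)).trans (sup_le hyP' hyP)
    have h3 : (x - f x) * a = y - f y := by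
      rw [hy', hy]
      ring
    have haP := (hs.support_div hB h3 (sub_ne_zero.2 hxx')).trans (sup_le h1 h2)
    refine sup_le haP ((hs.support_sub hB hy.symm).trans (sup_le ?_ hyP))
    exact (hs.support_mul hB a x).trans (sup_le haP hxP)
  have hTP : T ⊔ T.map g ≤ P ⊔ P.map g := by
    refine sup_le (sup_le hline (le_sup_left.trans le_sup_left)) ?_
    rw [hT, Submodule.map_sup]
    refine sup_le ?_ ((Submodule.map_mono le_sup_left).trans le_sup_right)
    rintro _ ⟨z, hz, rfl⟩
    rw [hgL z hz]
    exact hline hz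
  have hPL : P ⊔ L = T := le_antisymm (sup_le hPT le_sup_left)
    (sup_le le_sup_right (le_sup_left.trans le_sup_left))
  have hPLg : P ⊓ L ≤ P ⊓ P.map g := fun z hz => ⟨hz.1, z, hz.1, hgL z hz.2⟩
  have e1 := Submodule.finrank_sup_add_finrank_inf_eq (s a) (s b)
  have e2 := Submodule.finrank_sup_add_finrank_inf_eq L (s x)
  have e3 := Submodule.finrank_sup_add_finrank_inf_eq T (T.map g)
  have e4 := Submodule.finrank_sup_add_finrank_inf_eq P L
  have e5 := Submodule.finrank_sup_add_finrank_inf_eq P (P.map g)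
  have e6 := Submodule.finrank_sup_add_finrank_inf_eq (s x) (s y)
  have e7 := Submodule.finrank_mono hPLg
  have e8 := Submodule.finrank_mono hTP
  have e9 := Submodule.finrank_mono (le_inf (hs.le x) (hs.le y))
  have e10 := hg.finrank_map hPT
  have e11 := hg.finrank_map (le_refl T)
  have e12 := ha y
  rw [hab, ← hL] at e1
  rw [habx, ← hT] at e2
  rw [← hP] at e6
  rw [hinf] at e3
  rw [hPL] at e4
  omega

end IsSupport

/-! ### Definable sets and partial isometries -/

/-- `X` is invariant under partial isometries over `W`. -/
def InvariantOver (B : LinearMap.BilinForm K V) (W : Submodule K V) {ι κ : Type}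
    (X : Set (Tup K V ι κ)) : Prop :=
  ∀ T : Submodule K V, FiniteDimensional K T → W ≤ T → ∀ g : V →ₗ[K] V, IsPartialIso B T g →
    (∀ x ∈ W, g x = x) → ∀ x : Tup K V ι κ, (∀ i, x.1 i ∈ T) →
      (((g ∘ x.1, x.2) : Tup K V ι κ) ∈ X ↔ x ∈ X)

theorem InvariantOver.mono {W W' : Submodule K V} (h : W ≤ W') {ι κ : Type}
    {X : Set (Tup K V ι κ)} (hX : InvariantOver B W X) : InvariantOver B W' X :=
  fun T hT hW g hg hgW => hX T hT (h.trans hW) g hg fun x hx => hgW x (h hx)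

theorem DefinableOver.exists_invariantOver (hB : IsHomogeneous B Set.univ) {A : Set V}
    {ι κ : Type} {X : Set (Tup K V ι κ)} (hX : DefinableOver B A X) :
    ∃ W : Submodule K V, FiniteDimensional K W ∧ W ≤ Submodule.span K A ∧ InvariantOver B W X := by
  obtain ⟨a, b, φ, p, q, hp, rfl⟩ := hX
  refine ⟨Submodule.span K (Set.range p), span_range_finiteDimensional p,
    Submodule.span_mono (Set.range_subset_iff.2 hp), fun T hT hW g hg hgW x hx => ?_⟩
  have hpW : ∀ i, p i ∈ Submodule.span K (Set.range p) := fun i => Submodule.subset_span ⟨i, rfl⟩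
  have := hg.realize_iff hB φ (Sum.elim p x.1)
    (by rintro (i | i); exacts [hW (hpW i), hx i]) (Sum.elim q x.2)
  simp only [Set.mem_ofPred_eq]
  convert! this using 2
  funext i
  rcases i with i | i
  · exact (hgW _ (hpW i)).symm
  · rfl

/-- If the vectors of the elements of an invariant set span a finite-dimensional subspace, they lie
in the subspace over which the set is invariant. -/
theorem InvariantOver.mem_of_finiteDimensional (hB : IsHomogeneous B Set.univ)
    {W W₀ : Submodule K V} [FiniteDimensional K W] [FiniteDimensional K W₀] {ι κ : Type} [Finite ι]
    {X : Set (Tup K V ι κ)} (hX : InvariantOver B W X) (hX₀ : ∀ x ∈ X, ∀ i, x.1 i ∈ W₀)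
    {x : Tup K V ι κ} (hx : x ∈ X) (i : ι) : x.1 i ∈ W := by
  have hfin : FiniteDimensional K (Submodule.span K (Set.range x.1)) :=
    FiniteDimensional.span_of_finite K (Set.finite_range _)
  obtain ⟨g, hg, hgW, hgT⟩ := exists_isPartialIso_independent hB
    (le_sup_left : W ≤ W ⊔ Submodule.span K (Set.range x.1)) W₀
  have hxT : ∀ i, x.1 i ∈ W ⊔ Submodule.span K (Set.range x.1) := fun i =>
    Submodule.mem_sup_right (Submodule.subset_span ⟨i, rfl⟩)
  exact hgT _ (hxT i) (hX₀ _ ((hX _ inferInstance le_sup_left g hg hgW x hxT).2 hx) i)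

namespace DefinableField

variable {k m : ℕ} (F : DefinableField B k m)

/-- The action of a partial isometry over `W` with domain `T` on the elements of `F` with vectors in
`T`; the other elements are left unchanged. -/
noncomputable def act {W : Submodule K V} (hF : InvariantOver B W F.carrier) {T : Submodule K V}
    (hT : FiniteDimensional K T) (hWT : W ≤ T) {g : V →ₗ[K] V} (hg : IsPartialIso B T g)
    (hgW : ∀ x ∈ W, g x = x) (a : F.carrier) : F.carrier := by
  classical
  exact if h : ∀ i, a.1.1 i ∈ T then ⟨(g ∘ a.1.1, a.1.2), (hF T hT hWT g hg hgW a.1 h).2 a.2⟩ else a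

variable {F} {W : Submodule K V} {hF : InvariantOver B W F.carrier} {T : Submodule K V}
    {hT : FiniteDimensional K T} {hWT : W ≤ T} {g : V →ₗ[K] V} {hg : IsPartialIso B T g}
    {hgW : ∀ x ∈ W, g x = x}

theorem act_val {a : F.carrier} (ha : ∀ i, a.1.1 i ∈ T) :
    (F.act hF hT hWT hg hgW a).1 = (g ∘ a.1.1, a.1.2) := by
  rw [act, dif_pos ha]

theorem act_op {op : F.carrier → F.carrier → F.carrier}
    (hop : InvariantOver B W
      {z | ∃ x y : F.carrier, z = (x.1.append y.1).append (op x y : F.carrier).1})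
    {a b : F.carrier} (ha : ∀ i, a.1.1 i ∈ T) (hb : ∀ i, b.1.1 i ∈ T)
    (hab : ∀ i, (op a b).1.1 i ∈ T) :
    F.act hF hT hWT hg hgW (op a b) = op (F.act hF hT hWT hg hgW a) (F.act hF hT hWT hg hgW b) := by
  have h := (hop T hT hWT g hg hgW ((a.1.append b.1).append (op a b).1) (by
    rintro ((i | i) | i); exacts [ha i, hb i, hab i])).2 ⟨a, b, rfl⟩
  obtain ⟨x, y, hxy⟩ := h
  have hg' : ((g ∘ ((a.1.append b.1).append (op a b).1).1, ((a.1.append b.1).append (op a b).1).2) :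
      Tup K V _ _) = ((F.act hF hT hWT hg hgW a).1.append (F.act hF hT hWT hg hgW b).1).append
        (F.act hF hT hWT hg hgW (op a b)).1 := by
    rw [act_val ha, act_val hb, act_val hab]
    simp only [Tup.append, Sum.comp_elim]
  rw [hg'] at hxy
  obtain ⟨h1, h2⟩ := Tup.append_injective hxy
  obtain ⟨h3, h4⟩ := Tup.append_injective h1
  rw [Subtype.ext h3, Subtype.ext h4]
  exact Subtype.ext h2

theorem isSupport [FiniteDimensional K W] (hF : InvariantOver B W F.carrier)
    (hadd : InvariantOver B W
      {z | ∃ x y : F.carrier, z = (x.1.append y.1).append (x + y : F.carrier).1})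
    (hmul : InvariantOver B W
      {z | ∃ x y : F.carrier, z = (x.1.append y.1).append (x * y : F.carrier).1}) :
    IsSupport B W fun a : F.carrier => W ⊔ Submodule.span K (Set.range a.1.1) where
  le a := le_sup_left
  finite a := by
    have := span_range_finiteDimensional (K := K) a.1.1
    infer_instance
  act T hT hWT g hg hgW := by
    have hmem : ∀ a : F.carrier, W ⊔ Submodule.span K (Set.range a.1.1) ≤ T →
        ∀ i, a.1.1 i ∈ T := fun a ha i =>
      ha (Submodule.mem_sup_right (Submodule.subset_span ⟨i, rfl⟩))
    refine ⟨F.act hF hT hWT hg hgW, fun a ha => ?_, fun a ha hfix => ?_, fun a b ha hb hab => ?_,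
      fun a b ha hb hab => ?_⟩
    · rw [act_val (hmem a ha), Submodule.map_sup, Submodule.map_span, ← Set.range_comp]
      congr 1
      ext x
      simp only [Submodule.mem_map]
      exact ⟨fun hx => ⟨x, hx, hgW x hx⟩, by rintro ⟨y, hy, rfl⟩; rwa [hgW y hy]⟩
    · refine Subtype.ext ?_
      rw [act_val (hmem a ha)]
      refine Prod.ext (funext fun i => ?_) rfl
      exact hfix _ (Submodule.mem_sup_right (Submodule.subset_span ⟨i, rfl⟩))
    · exact act_op (op := fun x y => x + y) hadd (hmem a ha) (hmem b hb) (hmem _ hab)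
    · exact act_op (op := fun x y => x * y) hmul (hmem a ha) (hmem b hb) (hmem _ hab)

/-- The vectors of the elements of a definable field lie in a finite-dimensional subspace. -/
theorem exists_finiteDimensional (hB : IsHomogeneous B Set.univ) (F : DefinableField B k m) :
    ∃ W : Submodule K V, FiniteDimensional K W ∧ ∀ x ∈ F.carrier, ∀ i, x.1 i ∈ W := by
  obtain ⟨W₁, h₁, -, hX₁⟩ := F.definable_carrier.exists_invariantOver hB
  obtain ⟨W₂, h₂, -, hX₂⟩ := F.definable_add.exists_invariantOver hB
  obtain ⟨W₃, h₃, -, hX₃⟩ := F.definable_mul.exists_invariantOver hB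
  have hs := isSupport (W := W₁ ⊔ W₂ ⊔ W₃) (hX₁.mono (le_sup_left.trans le_sup_left))
    (hX₂.mono (le_sup_right.trans le_sup_left)) (hX₃.mono le_sup_right)
  refine ⟨W₁ ⊔ W₂ ⊔ W₃, inferInstance, fun x hx i => ?_⟩
  have := hs.support_eq hB (Module.finrank K (W₁ ⊔ W₂ ⊔ W₃ : Submodule K V) + k) (fun a => ?_) ⟨x, hx⟩
  · exact this (Submodule.mem_sup_right (Submodule.subset_span ⟨i, rfl⟩))
  · have := span_range_finiteDimensional (K := K) a.1.1
    refine (Submodule.finrank_add_le_finrank_add_finrank _ _).trans (Nat.add_le_add_left ?_ _)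
    exact (finrank_range_le_card (R := K) a.1.1).trans_eq (Fintype.card_fin k)

end DefinableField

end

/-! ### Coordinates -/

section

variable {K : Type u} {V : Type v} [Field K] [AddCommGroup V] [Module K V]
  {B : LinearMap.BilinForm K V}

/-- The tuple whose vectors have the given coordinates with respect to `e`. -/
def coordMap {r : ℕ} (e : Fin r → V) {ι κ : Type} (z : (ι × Fin r) ⊕ κ → K) : Tup K V ι κ :=
  (fun i => ∑ l, z (Sum.inl (i, l)) • e l, z ∘ Sum.inr)

theorem coordMap_injective {r : ℕ} {e : Fin r → V} (he : LinearIndependent K e) {ι κ : Type} :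
    Function.Injective (coordMap e : ((ι × Fin r) ⊕ κ → K) → Tup K V ι κ) := by
  intro z z' h
  obtain ⟨h1, h2⟩ := Prod.ext_iff.1 h
  funext x
  rcases x with ⟨i, l⟩ | a
  · exact (linComb_eq_iff he (fun l => z (Sum.inl (i, l))) fun l => z' (Sum.inl (i, l))).1
      (congrFun h1 i) l
  · exact congrFun h2 a

theorem exists_coordMap_eq {r : ℕ} (e : Fin r → V) {ι κ : Type} (x : Tup K V ι κ)
    (hx : ∀ i, x.1 i ∈ Submodule.span K (Set.range e)) : ∃ z, coordMap e z = x := by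
  choose c hc using fun i => (Submodule.mem_span_range_iff_exists_fun K).1 (hx i)
  exact ⟨Sum.elim (fun il => c il.1 il.2) x.2, Prod.ext (funext hc) rfl⟩

/-- The set `coordMap e '' Y` is definably in bijection with a copy of `Y` in a power of `K`. -/
theorem exists_scalar_copy {r : ℕ} {e : Fin r → V} (he : LinearIndependent K e) {ι κ : Type}
    [Finite ι] [Finite κ] {Y : Set ((ι × Fin r) ⊕ κ → K)} (hY : PolyDef K Y) {X : Set (Tup K V ι κ)}
    (hX : X = coordMap e '' Y) {n : ℕ} (ε : Fin n ≃ (ι × Fin r) ⊕ κ) :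
    ∃ f : X ≃ {v : Fin n → K | v ∘ ε.symm ∈ Y},
      (∀ x, coordMap e ((f x).1 ∘ ε.symm) = x.1) ∧ Definable B (scalarGraph f) := by
  subst hX
  have hex : ∀ x : (coordMap e '' Y : Set (Tup K V ι κ)),
      ∃ v : {v : Fin n → K | v ∘ ε.symm ∈ Y}, coordMap e (v.1 ∘ ε.symm) = x.1 := by
    rintro ⟨_, z, hz, rfl⟩
    refine ⟨⟨z ∘ ε, ?_⟩, ?_⟩
    · simpa [Function.comp_assoc] using! hz
    · simp [Function.comp_assoc]
  choose f hf using hex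
  have hcomp : Function.Injective fun v : Fin n → K => v ∘ ε.symm :=
    ε.symm.surjective.injective_comp_right
  refine ⟨Equiv.ofBijective f ⟨fun x y h => Subtype.ext ?_, fun v => ?_⟩, hf, ?_⟩
  · rw [← hf x, ← hf y, h]
  · refine ⟨⟨_, v.1 ∘ ε.symm, v.2, rfl⟩, Subtype.ext (hcomp (coordMap_injective he ?_))⟩
    exact hf _
  · have h1 : PolyDef K {z : (ι × Fin r) ⊕ (κ ⊕ Fin n) → K |
        z ∘ (fun a => Sum.inr (Sum.inr (ε.symm a))) ∈ Y} := hY.preimage _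
    have h2 : PolyDef K (⋂ a : (ι × Fin r) ⊕ κ, {z : (ι × Fin r) ⊕ (κ ⊕ Fin n) → K |
        MvPolynomial.eval z (MvPolynomial.X (Sum.map id Sum.inl a)) =
          MvPolynomial.eval z (MvPolynomial.X (Sum.inr (Sum.inr (ε.symm a))))}) :=
      PolyDef.iInter fun a => PolyDef.eqPoly _ _
    convert! Definable.coordImage (B := B) e (h1.inter h2) using 1
    ext x
    simp only [scalarGraph, Set.mem_ofPred_eq, Set.mem_inter_iff, Set.mem_iInter,
      MvPolynomial.eval_X]
    constructor
    · rintro ⟨y, rfl⟩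
      have hy := hf y
      refine ⟨Sum.elim (fun il => (f y).1 (ε.symm (Sum.inl il))) (Sum.elim y.1.2 (f y).1),
        ⟨(f y).2, ?_⟩, ?_⟩
      · rintro (a | a)
        · rfl
        · exact (congrFun (congrArg Prod.snd hy) a).symm
      · exact Prod.ext (congrArg Prod.fst hy).symm rfl
    · rintro ⟨z, ⟨hz1, hz2⟩, rfl⟩
      have hy := hf ⟨_, z ∘ (fun a => Sum.inr (Sum.inr (ε.symm a))), hz1, rfl⟩
      have hy' := hcomp (a₁ := (f _).1) (a₂ := z ∘ Sum.inr ∘ Sum.inr) (coordMap_injective he hy)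
      refine ⟨⟨_, _, hz1, rfl⟩, Prod.ext (funext fun i => ?_) (funext fun a => ?_)⟩
      · change ∑ l, z (Sum.inl (i, l)) • e l = ∑ l, z (Sum.inr (Sum.inr (ε.symm (Sum.inl (i, l))))) • e l
        exact Finset.sum_congr rfl fun l _ => congrArg (· • e l) (hz2 (Sum.inl (i, l)))
      · rcases a with a | a
        · exact hz2 (Sum.inr a)
        · exact (congrFun hy' a).symm

/-! ### Definability of definable fields in the field of scalars -/

theorem polyDef_coordMap_op (hB : IsHomogeneous B Set.univ) {k m : ℕ} {F : DefinableField B k m}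
    {op : F.carrier → F.carrier → F.carrier}
    (hop : Definable B
      {z | ∃ x y : F.carrier, z = (x.1.append y.1).append (op x y : F.carrier).1})
    {r : ℕ} (e : Fin r → V) {n : ℕ} (ε : Fin n ≃ (Fin k × Fin r) ⊕ Fin m) {E : Set (Fin n → K)}
    (f : F.carrier ≃ E) (hf : ∀ x, coordMap e ((f x).1 ∘ ε.symm) = x.1)
    (he : LinearIndependent K e) :
    PolyDef K {z : (Fin n ⊕ Fin n) ⊕ Fin n → K |
      ∃ x y : E, z = Sum.elim (Sum.elim x.1 y.1) (f (op (f.symm x) (f.symm y))).1} := by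
  have hinj : Function.Injective fun v : Fin n → K => coordMap (ι := Fin k) (κ := Fin m) e (v ∘ ε.symm) :=
    (coordMap_injective he).comp ε.symm.surjective.injective_comp_right
  convert! (polyDef_coord hB hop e).preimage (β := (Fin n ⊕ Fin n) ⊕ Fin n) (Sum.elim
    (fun il => Sum.map (Sum.map (fun i => ε.symm (Sum.inl (i, il.2)))
      (fun i => ε.symm (Sum.inl (i, il.2)))) (fun i => ε.symm (Sum.inl (i, il.2))) il.1)
    (Sum.map (Sum.map (fun a => ε.symm (Sum.inr a)) (fun a => ε.symm (Sum.inr a)))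
      (fun a => ε.symm (Sum.inr a)))) using 1
  ext z
  simp only [Set.mem_ofPred_eq]
  have hz : ∀ w : Tup K V ((Fin k ⊕ Fin k) ⊕ Fin k) ((Fin m ⊕ Fin m) ⊕ Fin m),
      w = ((coordMap e ((z ∘ Sum.inl ∘ Sum.inl) ∘ ε.symm)).append
        (coordMap e ((z ∘ Sum.inl ∘ Sum.inr) ∘ ε.symm))).append
        (coordMap e ((z ∘ Sum.inr) ∘ ε.symm)) →
      ((∃ x y : E, z = Sum.elim (Sum.elim x.1 y.1) (f (op (f.symm x) (f.symm y))).1) ↔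
        ∃ x y : F.carrier, w = (x.1.append y.1).append (op x y : F.carrier).1) := by
    rintro _ rfl
    constructor
    · rintro ⟨x, y, rfl⟩
      refine ⟨f.symm x, f.symm y, ?_⟩
      rw [← hf (op _ _), ← hf (f.symm x), ← hf (f.symm y), f.apply_symm_apply, f.apply_symm_apply]
      rfl
    · rintro ⟨x, y, h⟩
      obtain ⟨h1, h3⟩ := Tup.append_injective h
      obtain ⟨h1, h2⟩ := Tup.append_injective h1
      refine ⟨f x, f y, ?_⟩
      rw [f.symm_apply_apply, f.symm_apply_apply]
      rw [← hf] at h1 h2 h3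
      rw [← hinj h1, ← hinj h2, ← hinj h3]
      funext a
      rcases a with (a | a) | a <;> rfl
  refine hz _ (Prod.ext (funext fun i => ?_) (funext fun a => ?_))
  · rcases i with (i | i) | i <;> rfl
  · rcases a with (a | a) | a <;> rfl

theorem exists_coord_image {R : Set ℕ} (hB : IsHomogeneous B R) {ι κ : Type}
    {X : Set (Tup K V ι κ)} (hX : Definable B X) {r : ℕ} (e : Fin r → V)
    (hXe : ∀ x ∈ X, ∀ i, x.1 i ∈ Submodule.span K (Set.range e)) :
    ∃ Y : Set ((ι × Fin r) ⊕ κ → K), PolyDef K Y ∧ X = coordMap e '' Y := by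
  refine ⟨_, polyDef_coord hB hX e, Set.ext fun x => ⟨fun hx => ?_, ?_⟩⟩
  · obtain ⟨z, rfl⟩ := exists_coordMap_eq e x (hXe x hx)
    exact ⟨z, hx, rfl⟩
  · rintro ⟨z, hz, rfl⟩
    exact hz

theorem DefinableField.isDefinableInScalars (hB : IsHomogeneous B Set.univ) {k m : ℕ}
    (F : DefinableField B k m) : F.IsDefinableInScalars := by
  obtain ⟨W, hW, hFW⟩ := F.exists_finiteDimensional hB
  obtain ⟨r, e, he, rfl⟩ := exists_basis_tuple W
  obtain ⟨Y, hY, hX⟩ := exists_coord_image hB F.definable_carrier e hFW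
  obtain ⟨n, ⟨ε⟩⟩ := Finite.exists_equiv_fin ((Fin k × Fin r) ⊕ Fin m)
  obtain ⟨f, hf, hdef⟩ := exists_scalar_copy (B := B) he hY hX ε.symm
  let hE : Field {v : Fin n → K | v ∘ ε.symm.symm ∈ Y} := f.symm.field
  refine ⟨n, ⟨_, (hY.preimage ε.symm.symm).fieldDefinable, ?_, ?_⟩, f.symm.ringEquiv.symm, hdef⟩
  · exact (polyDef_coordMap_op (op := fun x y => x + y) hB F.definable_add e ε.symm f hf he).fieldDefinable
  · exact (polyDef_coordMap_op (op := fun x y => x * y) hB F.definable_mul e ε.symm f hf he).fieldDefinable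

/-! ### Traces on finite-dimensional subspaces -/

theorem trace_coordMap {N : Submodule K V} {r : ℕ} (e : Fin r → N) {ι κ : Type}
    (Y : Set ((ι × Fin r) ⊕ κ → K)) :
    trace N (coordMap (fun i => (e i : V)) '' Y) = coordMap e '' Y := by
  have h : ∀ z : (ι × Fin r) ⊕ κ → K, ((fun i => ((coordMap e z).1 i : V), (coordMap e z).2) :
      Tup K V ι κ) = coordMap (fun i => (e i : V)) z := fun z => by
    refine Prod.ext (funext fun i => ?_) rfl
    simp [coordMap]
  ext x
  constructor
  · rintro ⟨z, hz, hzx⟩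
    refine ⟨z, hz, ?_⟩
    rw [← h] at hzx
    obtain ⟨h1, h2⟩ := Prod.ext_iff.1 hzx
    exact Prod.ext (funext fun i => Subtype.ext (congrFun h1 i)) h2
  · rintro ⟨z, hz, rfl⟩
    exact ⟨z, hz, (h z).symm⟩

theorem IsApproximatingSequence.exists_le {N : ℕ → Submodule K V} (hN : IsApproximatingSequence B N)
    {S : Submodule K V} [FiniteDimensional K S]
    (hS : S ≤ Submodule.span K (⋃ j, (N j : Set V))) : ∃ j₀, ∀ j, j₀ ≤ j → S ≤ N j := by
  obtain ⟨s, hs⟩ := (Submodule.fg_iff_finiteDimensional S).2 inferInstance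
  have h1 : ∀ x ∈ S, ∃ j, x ∈ N j := fun x hx => by
    have := hS hx
    rwa [Submodule.span_iUnion, iSup_congr fun j => Submodule.span_eq (N j),
      Submodule.mem_iSup_of_directed _ hN.mono.directed_le] at this
  choose f hf using fun x : s => h1 x (hs ▸ Submodule.subset_span x.2)
  refine ⟨Finset.univ.sup f, fun j hj => ?_⟩
  rw [← hs, Submodule.span_le]
  exact fun x hx => hN.mono ((Finset.le_sup (Finset.mem_univ (⟨x, hx⟩ : s))).trans hj) (hf ⟨x, hx⟩)

/-- A definable set whose vectors lie in a finite-dimensional subspace has a coordinate copy `Y`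
such that its dimension is the rank, in large enough finite-dimensional subspaces, of the image of
`Y` under the coordinate map. -/
theorem exists_hasFiniteDim (hB : IsHomogeneous B Set.univ) {ι κ : Type} [Finite ι]
    {X : Set (Tup K V ι κ)} (hX : Definable B X) {W : Submodule K V} [FiniteDimensional K W]
    (hXW : ∀ x ∈ X, ∀ i, x.1 i ∈ W)
    (hN : ∃ N, IsApproximatingSequence B N ∧ DefinableOver B (⋃ j, (N j : Set V)) X) :
    ∃ (r : ℕ) (Y : Set ((ι × Fin r) ⊕ κ → K)), PolyDef K Y ∧ (X.Nonempty → Y.Nonempty) ∧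
      ∀ (rk : (W : Submodule K V) → Set (Tup K W ι κ) → ℕ → Prop) (d : ℕ),
        (∀ N : Submodule K V, FiniteDimensional K N → ∀ e : Fin r → N, LinearIndependent K e →
          rk N (coordMap e '' Y) d) → HasFiniteDim B rk X d := by
  let S : Submodule K V := Submodule.span K {v | ∃ x ∈ X, ∃ i, x.1 i = v}
  have hSW : ∀ W' : Submodule K V, (∀ x ∈ X, ∀ i, x.1 i ∈ W') → S ≤ W' := fun W' h => by
    rw [Submodule.span_le]
    rintro _ ⟨x, hx, i, rfl⟩
    exact h x hx i
  have hS : FiniteDimensional K S := Submodule.finiteDimensional_of_le (hSW W hXW)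
  obtain ⟨r, e, he, heS⟩ := exists_basis_tuple S
  obtain ⟨Y, hY, hXY⟩ := exists_coord_image hB hX e fun x hx i =>
    heS ▸ Submodule.subset_span ⟨x, hx, i, rfl⟩
  refine ⟨r, Y, hY, ?_, fun rk d h => ⟨hN, fun N hN hdef => ?_⟩⟩
  · rintro ⟨x, hx⟩
    rw [hXY] at hx
    obtain ⟨z, hz, -⟩ := hx
    exact ⟨z, hz⟩
  · obtain ⟨W', hW', hle, hinv⟩ := hdef.exists_invariantOver hB
    obtain ⟨j₀, hj₀⟩ := hN.exists_le
      ((hSW W' fun x hx i => hinv.mem_of_finiteDimensional hB hXW hx i).trans hle)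
    filter_upwards [Filter.eventually_ge_atTop j₀] with j hj
    have hej : ∀ i, e i ∈ N j := fun i => hj₀ j hj (heS ▸ Submodule.subset_span ⟨i, rfl⟩)
    have := h (N j) (hN.finiteDimensional j) (fun i => ⟨e i, hej i⟩)
      (LinearIndependent.of_comp (N j).subtype he)
    rwa [← trace_coordMap, ← hXY] at this

/-! ### Morley rank in coordinates -/

/-- The Morley rank of `S`, with respect to a class `D` of sets in place of the definable ones, is at
least `d`. -/
def RankGE {X : Type*} (D : Set X → Prop) : ℕ → Set X → Prop
  | 0, S => S.Nonempty
  | d + 1, S => ∀ n : ℕ, ∃ X : Fin n → Set X,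
      Pairwise (fun i j => Disjoint (X i) (X j)) ∧ ∀ i, D (X i) ∧ X i ⊆ S ∧ RankGE D d (X i)

theorem morleyRankGE_iff {R : Set ℕ} (hB : IsHomogeneous B R) {r : ℕ} {e : Fin r → V}
    (he : LinearIndependent K e) {ι κ : Type} [Finite ι] [Finite κ] (d : ℕ) :
    ∀ Y : Set ((ι × Fin r) ⊕ κ → K), MorleyRankGE B d (coordMap e '' Y) ↔ RankGE (PolyDef K) d Y := by
  induction d with
  | zero => exact fun Y => Set.image_nonempty
  | succ d ih =>
    refine fun Y => forall_congr' fun n => ⟨?_, ?_⟩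
    · rintro ⟨Z, hZ, h⟩
      have hZ' : ∀ i, Z i = coordMap e '' (coordMap e ⁻¹' Z i) := fun i =>
        (Set.image_preimage_eq_of_subset ((h i).2.1.trans (Set.image_subset_range _ _))).symm
      refine ⟨fun i => coordMap e ⁻¹' Z i, fun i j hij => (hZ hij).preimage _, fun i =>
        ⟨polyDef_coord hB (h i).1 e, ?_, (ih _).1 (hZ' i ▸ (h i).2.2)⟩⟩
      exact (Set.preimage_mono (h i).2.1).trans_eq (Set.preimage_image_eq _ (coordMap_injective he))
    · rintro ⟨Z, hZ, h⟩
      refine ⟨fun i => coordMap e '' Z i, fun i j hij =>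
        (Set.disjoint_image_iff (coordMap_injective he)).2 (hZ hij), fun i =>
        ⟨?_, Set.image_mono (h i).2.1, (ih _).2 (h i).2.2⟩⟩
      convert! Definable.coordImage (B := B) e (h i).1 using 1
      ext x
      simp only [Set.mem_image, Set.mem_ofPred_eq]
      exact exists_congr fun z => and_congr_right fun _ => eq_comm

end

/-! ### Existence of approximating sequences -/

section

variable {K : Type u} {V : Type v} [Field K] [AddCommGroup V] [Module K V]
  {B : LinearMap.BilinForm K V}

/-- The form is nondegenerate on `N`, and `N` is finite-dimensional. -/
structure IsRegular (B : LinearMap.BilinForm K V) (N : Submodule K V) : Prop where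
  finite : FiniteDimensional K N
  eq_zero : ∀ x ∈ N, (∀ y ∈ N, B x y = 0) → x = 0

theorem IsRegular.nondegenerate (hB : B.IsRefl) {N : Submodule K V} (hN : IsRegular B N) :
    (B.restrict N).Nondegenerate :=
  ⟨fun x hx => Subtype.ext (hN.eq_zero x x.2 fun y hy => hx ⟨y, hy⟩),
    fun x hx => Subtype.ext (hN.eq_zero x x.2 fun y hy => hB _ _ (hx ⟨y, hy⟩))⟩

theorem IsRegular.exists_decomp {N : Submodule K V} (hN : IsRegular B N) (v : V) :
    ∃ n ∈ N, ∀ t ∈ N, B t (v - n) = 0 := by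
  have := hN.finite
  obtain ⟨r, e, he, rfl⟩ := exists_basis_tuple N
  let e' : Fin r → Submodule.span K (Set.range e) := fun i => ⟨e i, Submodule.subset_span ⟨i, rfl⟩⟩
  have he' : LinearIndependent K e' := LinearIndependent.of_comp (Submodule.subtype _) he
  obtain ⟨n, hn⟩ := exists_form_eq (B := B.restrict _)
    (fun x hx => Subtype.ext (hN.eq_zero x x.2 fun y hy => hx ⟨y, hy⟩)) he' fun i => B (e i) v
  have hn' : ∀ i, B (e i) n = B (e i) v := hn
  refine ⟨n, n.2, fun t ht => ?_⟩
  obtain ⟨c, rfl⟩ := (Submodule.mem_span_range_iff_exists_fun K).1 ht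
  simp [hn']

theorem isRegular_bot : IsRegular B ⊥ := ⟨inferInstance, fun x hx _ => by simpa using hx⟩

theorem IsRegular.sup (hB : B.IsRefl) {N P : Submodule K V} (hN : IsRegular B N)
    (hP : IsRegular B P) (h : P ≤ B.orthogonal N) : IsRegular B (N ⊔ P) ∧
      Module.finrank K (N ⊔ P : Submodule K V) = Module.finrank K N + Module.finrank K P := by
  have := hN.finite
  have := hP.finite
  have hNP : ∀ n ∈ N, ∀ p ∈ P, B n p = 0 := fun n hn p hp => h hp n hn
  have hPN : ∀ n ∈ N, ∀ p ∈ P, B p n = 0 := fun n hn p hp => hB _ _ (hNP n hn p hp)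
  refine ⟨⟨inferInstance, fun x hx hx0 => ?_⟩, ?_⟩
  · obtain ⟨n, hn, p, hp, rfl⟩ := Submodule.mem_sup.1 hx
    have h1 : n = 0 := hN.eq_zero n hn fun y hy => by
      have := hx0 y (Submodule.mem_sup_left hy)
      rwa [map_add, LinearMap.add_apply, hPN y hy p hp, add_zero] at this
    have h2 : p = 0 := hP.eq_zero p hp fun y hy => by
      have := hx0 y (Submodule.mem_sup_right hy)
      rwa [map_add, LinearMap.add_apply, hNP n hn y hy, zero_add] at this
    rw [h1, h2, add_zero]
  · have := Submodule.finrank_sup_add_finrank_inf_eq N P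
    have hinf : N ⊓ P = ⊥ := by
      rw [Submodule.eq_bot_iff]
      exact fun x hx => hN.eq_zero x hx.1 fun y hy => hPN y hy x hx.2
    rw [hinf, finrank_bot] at this
    omega

/-- Every subspace on which the form does not vanish has a regular subspace of dimension `s`. -/
def HasBlocks (B : LinearMap.BilinForm K V) (s : ℕ) : Prop :=
  ∀ Q : Submodule K V, (∃ x ∈ Q, ∃ y ∈ Q, B x y ≠ 0) →
    ∃ P ≤ Q, IsRegular B P ∧ Module.finrank K P = s

theorem isRegular_pair (hB : B.IsRefl) {x y : V} (hx : B x x = 0) (hxy : B x y ≠ 0) :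
    IsRegular B (Submodule.span K {x, y}) ∧ Module.finrank K (Submodule.span K {x, y}) = 2 := by
  have hyx : B y x ≠ 0 := fun h => hxy (hB _ _ h)
  have hcoef : ∀ a b : K, (∀ z ∈ Submodule.span K {x, y}, B (a • x + b • y) z = 0) →
      a = 0 ∧ b = 0 := by
    intro a b h
    have h1 := h x (Submodule.subset_span (by simp))
    have h2 := h y (Submodule.subset_span (by simp))
    simp only [map_add, map_smul, LinearMap.add_apply, LinearMap.smul_apply, smul_eq_mul, hx,
      mul_zero, zero_add] at h1 h2
    obtain rfl := (mul_eq_zero.1 h1).resolve_right hyx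
    rw [zero_mul, add_zero] at h2
    exact ⟨(mul_eq_zero.1 h2).resolve_right hxy, rfl⟩
  refine ⟨⟨FiniteDimensional.span_of_finite K (by simp), fun z hz h => ?_⟩, ?_⟩
  · obtain ⟨a, b, rfl⟩ := Submodule.mem_span_pair.1 hz
    obtain ⟨rfl, rfl⟩ := hcoef a b h
    simp
  · have hli : LinearIndependent K ![x, y] := by
      rw [LinearIndependent.pair_iff]
      exact fun a b h => hcoef a b fun z _ => by rw [h, map_zero, LinearMap.zero_apply]
    have := finrank_span_eq_card hli
    rwa [Matrix.range_cons, Matrix.range_cons, Matrix.range_empty, Set.union_empty,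
      Set.singleton_union] at this

theorem isRegular_singleton {x : V} (hx : B x x ≠ 0) :
    IsRegular B (Submodule.span K {x}) ∧ Module.finrank K (Submodule.span K {x}) = 1 := by
  refine ⟨⟨inferInstance, fun z hz h => ?_⟩, ?_⟩
  · obtain ⟨a, rfl⟩ := Submodule.mem_span_singleton.1 hz
    have := h x (Submodule.mem_span_singleton_self x)
    rw [map_smul, LinearMap.smul_apply, smul_eq_mul] at this
    rw [(mul_eq_zero.1 this).resolve_right hx, zero_smul]
  · exact finrank_span_singleton fun h => hx (by rw [h, map_zero])

theorem hasBlocks_of_isAlt (ha : B.IsAlt) : HasBlocks B 2 := by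
  rintro Q ⟨x, hx, y, hy, hxy⟩
  refine ⟨_, ?_, isRegular_pair ha.isRefl (ha.self_eq_zero x) hxy⟩
  rw [Submodule.span_le]
  rintro z (rfl | rfl)
  exacts [hx, hy]

theorem hasBlocks_of_isSymm (hs : B.IsSymm) (h2 : (2 : K) ≠ 0) : HasBlocks B 1 := by
  rintro Q ⟨x, hx, y, hy, hxy⟩
  obtain ⟨z, hz, hzz⟩ : ∃ z ∈ Q, B z z ≠ 0 := by
    by_contra! h
    have := h (x + y) (Q.add_mem hx hy)
    simp only [map_add, LinearMap.add_apply, h x hx, h y hy, hs.eq y x, zero_add, add_zero,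
      ← two_mul] at this
    exact hxy ((mul_eq_zero.1 this).resolve_left h2)
  refine ⟨_, ?_, isRegular_singleton hzz⟩
  rwa [Submodule.span_singleton_le_iff_mem]

variable {s : ℕ} (hB : B.IsRefl)

include hB

theorem IsRegular.exists_succ (hV : ¬ FiniteDimensional K V) (hsep : B.SeparatingLeft)
    (hs : HasBlocks B s) {N : Submodule K V} (hN : IsRegular B N) :
    ∃ N', N ≤ N' ∧ IsRegular B N' ∧ Module.finrank K N' = Module.finrank K N + s := by
  have := hN.finite
  obtain ⟨x, hx, hxN⟩ := exists_orthogonal_notMem (B := B) hV N N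
  obtain ⟨y, hy, hxy⟩ := exists_orthogonal_form_ne_zero hsep N hxN
  obtain ⟨P, hP, hPr, hPs⟩ := hs (B.orthogonal N) ⟨x, hx, y, hy, hxy⟩
  obtain ⟨h1, h2⟩ := hN.sup hB hPr hP
  exact ⟨_, le_sup_left, h1, by rw [h2, hPs]⟩

theorem IsRegular.exists_pred (hs : HasBlocks B s) {N : Submodule K V} (hN : IsRegular B N)
    (hne : N ≠ ⊥) : ∃ N' ≤ N, IsRegular B N' ∧ Module.finrank K N = Module.finrank K N' + s := by
  have := hN.finite
  obtain ⟨x, hx, hx0⟩ := (Submodule.ne_bot_iff _).1 hne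
  obtain ⟨y, hy, hxy⟩ : ∃ y ∈ N, B x y ≠ 0 := by
    by_contra! h
    exact hx0 (hN.eq_zero x hx h)
  obtain ⟨P, hP, hPr, hPs⟩ := hs N ⟨x, hx, y, hy, hxy⟩
  have hsup : P ⊔ (N ⊓ B.orthogonal P) = N := by
    refine le_antisymm (sup_le hP inf_le_left) fun v hv => ?_
    obtain ⟨p, hp, h⟩ := hPr.exists_decomp v
    rw [← add_sub_cancel p v]
    exact Submodule.add_mem_sup hp ⟨N.sub_mem hv (hP hp), h⟩
  have hreg : IsRegular B (N ⊓ B.orthogonal P) := by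
    refine ⟨Submodule.finiteDimensional_of_le inf_le_left, fun z hz h => ?_⟩
    refine hN.eq_zero z hz.1 fun w hw => ?_
    rw [← hsup] at hw
    obtain ⟨p, hp, q, hq, rfl⟩ := Submodule.mem_sup.1 hw
    rw [map_add, h q hq, hB _ _ (hz.2 p hp), add_zero]
  refine ⟨_, inf_le_left, hreg, ?_⟩
  have := (hPr.sup hB hreg inf_le_right).2
  rw [hsup] at this
  omega

/-- A finite-dimensional subspace is contained in a regular one, of dimension divisible by `s` if
the form is alternating or `s = 1`. -/
theorem exists_isRegular_ge (hsep : B.SeparatingLeft)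
    (hs : B.IsAlt ∧ s = 2 ∨ s = 1) (T : Finset V) :
    ∃ N, (∀ v ∈ T, v ∈ N) ∧ IsRegular B N ∧ s ∣ Module.finrank K N := by
  classical
  induction T using Finset.induction with
  | empty => exact ⟨⊥, by simp, isRegular_bot, by simp⟩
  | insert v T _ ih =>
    obtain ⟨N, hTN, hN, hsN⟩ := ih
    have := hN.finite
    suffices h : ∃ N', N ≤ N' ∧ v ∈ N' ∧ IsRegular B N' ∧ s ∣ Module.finrank K N' by
      obtain ⟨N', hle, hv, h1, h2⟩ := h
      refine ⟨N', fun w hw => ?_, h1, h2⟩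
      rcases Finset.mem_insert.1 hw with rfl | hw
      exacts [hv, hle (hTN w hw)]
    by_cases hv : v ∈ N
    · exact ⟨N, le_rfl, hv, hN, hsN⟩
    obtain ⟨n, hn, hq⟩ := hN.exists_decomp v
    set q := v - n with hqdef
    have hvq : v = n + q := by rw [hqdef, add_sub_cancel]
    by_cases hqq : B q q = 0
    · have hqN : q ∉ N := fun h => hv (by rw [hvq]; exact N.add_mem hn h)
      obtain ⟨u, hu, hqu⟩ := exists_orthogonal_form_ne_zero hsep N hqN
      obtain ⟨hP, hP2⟩ := isRegular_pair hB hqq hqu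
      obtain ⟨h1, h2⟩ := hN.sup hB hP (by
        rw [Submodule.span_le]
        rintro z (rfl | rfl)
        exacts [hq, hu])
      refine ⟨_, le_sup_left, ?_, h1, ?_⟩
      · rw [hvq]
        exact Submodule.add_mem_sup hn (Submodule.subset_span (by simp))
      · rw [h2, hP2]
        rcases hs with ⟨-, rfl⟩ | rfl
        · exact (Nat.dvd_add_self_right).2 hsN
        · exact one_dvd _
    · obtain ⟨hP, hP1⟩ := isRegular_singleton hqq
      obtain ⟨h1, h2⟩ := hN.sup hB hP (by
        rw [Submodule.span_singleton_le_iff_mem]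
        exact hq)
      refine ⟨_, le_sup_left, ?_, h1, ?_⟩
      · rw [hvq]
        exact Submodule.add_mem_sup hn (Submodule.mem_span_singleton_self q)
      · rcases hs with ⟨ha, -⟩ | rfl
        · exact absurd (ha.self_eq_zero q) hqq
        · exact one_dvd _

theorem exists_regular_sequence (hV : ¬ FiniteDimensional K V) (hsep : B.SeparatingLeft)
    (hs : HasBlocks B s) (hs0 : 0 < s) (n : ℕ) : ∀ W : Submodule K V, IsRegular B W →
      Module.finrank K W = s * n → ∃ N : ℕ → Submodule K V, Monotone N ∧
        (∀ j, IsRegular B (N j) ∧ Module.finrank K (N j) = s * j) ∧ N n = W := by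
  have hup : ∀ (n : ℕ) (W : Submodule K V), IsRegular B W → Module.finrank K W = s * n →
      ∃ U : ℕ → Submodule K V, Monotone U ∧
        (∀ j, IsRegular B (U j) ∧ Module.finrank K (U j) = s * (n + j)) ∧ U 0 = W := by
    intro n W hW hWn
    choose f hf using fun N : {N : Submodule K V // IsRegular B N} =>
      N.2.exists_succ hB hV hsep hs
    let U : ℕ → {N : Submodule K V // IsRegular B N} :=
      Nat.rec ⟨W, hW⟩ fun _ N => ⟨f N, (hf N).2.1⟩
    refine ⟨fun j => (U j).1, monotone_nat_of_le_succ fun j => (hf (U j)).1,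
      fun j => ⟨(U j).2, ?_⟩, rfl⟩
    induction j with
    | zero => exact hWn
    | succ j ih =>
      refine ((hf (U j)).2.2).trans ?_
      rw [ih]
      ring
  induction n with
  | zero =>
    intro W hW hWn
    obtain ⟨U, h1, h2, h3⟩ := hup 0 W hW hWn
    exact ⟨U, h1, fun j => by simpa using h2 j, h3⟩
  | succ n ih =>
    intro W hW hWn
    have := hW.finite
    obtain ⟨M, hM, hMr, hMn⟩ := hW.exists_pred hB hs fun h => by
      rw [h, finrank_bot] at hWn
      exact (Nat.mul_pos hs0 n.succ_pos).ne hWn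
    obtain ⟨N, h1, h2, h3⟩ := ih M hMr (by rw [Nat.mul_succ] at hWn; omega)
    obtain ⟨U, h4, h5, h6⟩ := hup (n + 1) W hW hWn
    refine ⟨fun j => if j ≤ n then N j else U (j - (n + 1)), monotone_nat_of_le_succ fun j => ?_,
      fun j => ?_, by simp [h6]⟩
    · by_cases hj : j + 1 ≤ n
      · simp only [hj, (Nat.le_succ j).trans hj, if_true]
        exact h1 (Nat.le_succ j)
      · by_cases hj' : j ≤ n
        · obtain rfl : j = n := by omega
          simp [h3, h6, hM]
        · simp only [hj, hj', if_false]
          exact h4 (by omega)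
    · beta_reduce
      by_cases hj : j ≤ n
      · rw [if_pos hj]
        exact h2 j
      · rw [if_neg hj]
        have := h5 (j - (n + 1))
        rwa [show n + 1 + (j - (n + 1)) = j by omega] at this

end

section

variable {K : Type u} {V : Type v} [Field K] [AddCommGroup V] [Module K V]
  {B : LinearMap.BilinForm K V}

theorem exists_isApproximatingSequence (hV : ¬ FiniteDimensional K V) (hB : B.Nondegenerate)
    (h2 : (2 : K) ≠ 0) (hsa : B.IsSymm ∨ B.IsAlt) {ι κ : Type} {X : Set (Tup K V ι κ)}
    (hX : Definable B X) :
    ∃ N, IsApproximatingSequence B N ∧ DefinableOver B (⋃ j, (N j : Set V)) X := by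
  classical
  have hnot : B.IsSymm → B.IsAlt → False := fun hs ha => by
    refine hV (Module.finite_def.2 ?_)
    have : (⊤ : Submodule K V) = ⊥ := by
      refine (Submodule.eq_bot_iff _).2 fun x _ => hB.1 x fun y => ?_
      have h := ha.neg_eq x y
      rw [hs.eq y x, neg_eq_iff_add_eq_zero, ← two_mul] at h
      exact (mul_eq_zero.1 h).resolve_left h2
    rw [this]
    exact Submodule.fg_bot
  obtain ⟨a, b, φ, p, q, -, rfl⟩ := hX
  suffices h : ∀ s, 0 < s → B.IsRefl → HasBlocks B s → (B.IsAlt ∧ s = 2 ∨ s = 1) →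
      (B.IsSymm → s = 1) → (B.IsAlt → s = 2) → ∃ N, IsApproximatingSequence B N ∧
        ∀ i, p i ∈ ⋃ j, (N j : Set V) by
    obtain ⟨N, hN, hp⟩ : ∃ N, IsApproximatingSequence B N ∧ ∀ i, p i ∈ ⋃ j, (N j : Set V) := by
      rcases hsa with hs | ha
      · exact h 1 one_pos (fun x y h => by rwa [hs.eq]) (hasBlocks_of_isSymm hs h2) (Or.inr rfl)
          (fun _ => rfl) fun ha => (hnot hs ha).elim
      · exact h 2 two_pos ha.isRefl (hasBlocks_of_isAlt ha) (Or.inl ⟨ha, rfl⟩)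
          (fun hs => (hnot hs ha).elim) fun _ => rfl
    exact ⟨N, hN, a, b, φ, p, q, hp, rfl⟩
  intro s hs0 hrefl hs hs' h1 h2
  obtain ⟨W, hW, hWr, n, hn⟩ := exists_isRegular_ge hrefl hB.1 hs' (Finset.univ.image p)
  obtain ⟨N, hmono, hN, rfl⟩ := exists_regular_sequence hrefl hV hB.1 hs hs0 n W hWr hn
  refine ⟨N, ⟨hmono, fun j => (hN j).1.finite, fun j => (hN j).1.nondegenerate hrefl,
    fun h j => ?_, fun h j => ?_⟩, fun i => ?_⟩
  · rw [(hN j).2, h1 h, one_mul]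
  · rw [(hN j).2, h2 h]
  · exact Set.mem_iUnion.2 ⟨n, hW _ (Finset.mem_image_of_mem p (Finset.mem_univ i))⟩

end

/-! ### Definable sets over algebraically closed fields are constructible -/

section

open MvPolynomial Topology

variable {K : Type u} [Field K] {α : Type}

theorem pointToPoint_injective :
    Function.Injective (pointToPoint : (α → K) → PrimeSpectrum (MvPolynomial α K)) := by
  intro v w h
  funext a
  have h1 : (X a - C (v a) : MvPolynomial α K) ∈ vanishingIdeal K {v} := by
    rw [mem_vanishingIdeal_singleton_iff]; simp
  have h2 : vanishingIdeal K {v} = vanishingIdeal K {w} := congrArg PrimeSpectrum.asIdeal h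
  rw [h2, mem_vanishingIdeal_singleton_iff] at h1
  simpa [sub_eq_zero, eq_comm] using h1

theorem comap_rename_pointToPoint (w : Option α → K) :
    PrimeSpectrum.comap (rename (R := K) (some : α → Option α)).toRingHom (pointToPoint w) =
      pointToPoint (w ∘ some) := by
  ext p
  change rename some p ∈ vanishingIdeal K {w} ↔ p ∈ vanishingIdeal K {w ∘ some}
  rw [mem_vanishingIdeal_singleton_iff, mem_vanishingIdeal_singleton_iff, aeval_rename]

/-- Over an algebraically closed field, definable sets are the sets of closed points of
constructible sets. The projections are dealt with by Chevalley's theorem. -/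
theorem PolyDef.exists_isConstructible [IsAlgClosed K] {S : Set (α → K)} (hS : PolyDef K S) :
    Finite α → ∃ C : Set (PrimeSpectrum (MvPolynomial α K)), IsConstructible C ∧
      S = pointToPoint (k := K) ⁻¹' C := by
  induction hS with
  | zero p =>
    refine fun _ => ⟨_, (PrimeSpectrum.isConstructible_basicOpen (f := p)).compl, ?_⟩
    ext v
    change _ ↔ ¬ ¬ p ∈ vanishingIdeal K {v}
    rw [not_not, mem_vanishingIdeal_singleton_iff]
    rfl
  | compl _ ih =>
    intro h
    obtain ⟨C, hC, rfl⟩ := ih h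
    exact ⟨Cᶜ, hC.compl, rfl⟩
  | inter _ _ ih1 ih2 =>
    intro h
    obtain ⟨C, hC, rfl⟩ := ih1 h
    obtain ⟨D, hD, rfl⟩ := ih2 h
    exact ⟨C ∩ D, hC.inter hD, rfl⟩
  | @ex α S _ ih =>
    intro h
    obtain ⟨C, hC, rfl⟩ := ih inferInstance
    let f : MvPolynomial α K →+* MvPolynomial (Option α) K := (rename some).toRingHom
    have hf : f.FinitePresentation := by
      refine RingHom.FinitePresentation.of_finiteType.1 ?_
      refine RingHom.FiniteType.of_comp_finiteType (f := (MvPolynomial.C : K →+* MvPolynomial α K)) ?_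
      have : f.comp (MvPolynomial.C : K →+* MvPolynomial α K) = algebraMap K _ := by
        ext x; simp [f, algebraMap_eq]
      rw [this, RingHom.finiteType_algebraMap]
      infer_instance
    refine ⟨_, PrimeSpectrum.isConstructible_comap_image hf hC, ?_⟩
    ext v
    constructor
    · rintro ⟨c, hc⟩
      exact ⟨_, hc, comap_rename_pointToPoint _⟩
    · rintro ⟨q, hq, hqv⟩
      obtain ⟨D, rfl⟩ := PrimeSpectrum.exists_constructibleSetData_iff.2 hC
      obtain ⟨b, hb, hqb⟩ := Set.mem_iUnion₂.1 hq
      have hcl : IsClosed {pointToPoint (k := K) v} := by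
        rw [PrimeSpectrum.isClosed_singleton_iff_isMaximal]
        exact isMaximal_iff_eq_vanishingIdeal_singleton.2 ⟨v, rfl⟩
      -- the part of the fibre over `v` lying in a basic piece of the constructible set
      -- is locally closed, so that it contains a closed point
      obtain ⟨z, ⟨hz1, hz2⟩, hz⟩ := nonempty_inter_closedPoints
        (Z := b.toSet ∩ PrimeSpectrum.comap f ⁻¹' {pointToPoint (k := K) v}) ⟨q, hqb, hqv⟩
        (((PrimeSpectrum.isClosed_zeroLocus _).isLocallyClosed.inter
          (PrimeSpectrum.isClosed_zeroLocus _).isOpen_compl.isLocallyClosed).inter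
          (hcl.preimage (PrimeSpectrum.continuous_comap f)).isLocallyClosed)
      rw [mem_closedPoints_iff, PrimeSpectrum.isClosed_singleton_iff_isMaximal] at hz
      obtain ⟨w, hw⟩ := isMaximal_iff_eq_vanishingIdeal_singleton.1 hz
      obtain rfl : z = pointToPoint (k := K) w := PrimeSpectrum.ext hw
      have hwv : w ∘ some = v := pointToPoint_injective ((comap_rename_pointToPoint w).symm.trans hz2)
      refine ⟨w none, ?_⟩
      have : (fun o : Option α => o.elim (w none) v) = w := by
        funext o
        cases o with
        | none => rfl
        | some a => exact (congrFun hwv a).symm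
      change pointToPoint (k := K) (fun o : Option α => o.elim (w none) v) ∈ D.toSet
      rw [this]
      exact Set.mem_iUnion₂.2 ⟨b, hb, hz1⟩

end

/-! ### Ranks in Noetherian spaces -/

section

open TopologicalSpace Topology

variable {T : Type*} [TopologicalSpace T]

/-- `S` is, on each irreducible closed set, either generically absent or generically present. -/
def IsGenericallyDecided (S : Set T) : Prop :=
  ∀ Z, IsClosed Z → IsIrreducible Z → ∃ Z', IsClosed Z' ∧ Z' ⊂ Z ∧ (S ∩ Z ⊆ Z' ∨ Z \ Z' ⊆ S)

theorem IsGenericallyDecided.of_isConstructible {T' : Type*} [TopologicalSpace T'] {f : T → T'}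
    (hf : Continuous f) {C : Set T'} (hC : IsConstructible C) :
    IsGenericallyDecided (f ⁻¹' C) := by
  induction hC using IsConstructible.empty_union_induction with
  | open_retrocompact U hU _ =>
    intro Z hZ hZi
    by_cases h : (Z ∩ f ⁻¹' U).Nonempty
    · obtain ⟨x, hx, hxU⟩ := h
      exact ⟨Z \ f ⁻¹' U, hZ.sdiff (hU.preimage hf),
        ⟨Set.sdiff_subset, fun h => (h hx).2 hxU⟩, Or.inr fun y hy => by_contra fun h => hy.2 ⟨hy.1, h⟩⟩
    · exact ⟨∅, isClosed_empty, hZi.nonempty.empty_ssubset,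
        Or.inl fun y hy => h ⟨y, hy.2, hy.1⟩⟩
  | union s _ t _ hs ht =>
    intro Z hZ hZi
    obtain ⟨Z1, h1, h1', h1''⟩ := hs Z hZ hZi
    obtain ⟨Z2, h2, h2', h2''⟩ := ht Z hZ hZi
    rcases h1'' with h1'' | h1''
    · rcases h2'' with h2'' | h2''
      · refine ⟨Z1 ∪ Z2, h1.union h2, ⟨Set.union_subset h1'.1 h2'.1, fun h => ?_⟩, Or.inl ?_⟩
        · rcases isPreirreducible_iff_isClosed_union_isClosed.1 hZi.2 Z1 Z2 h1 h2 h with h | h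
          · exact h1'.2 h
          · exact h2'.2 h
        · rintro x ⟨hx | hx, hxZ⟩
          · exact Or.inl (h1'' ⟨hx, hxZ⟩)
          · exact Or.inr (h2'' ⟨hx, hxZ⟩)
      · exact ⟨Z2, h2, h2', Or.inr fun x hx => Or.inr (h2'' hx)⟩
    · exact ⟨Z1, h1, h1', Or.inr fun x hx => Or.inl (h1'' hx)⟩
  | compl s _ hs =>
    intro Z hZ hZi
    obtain ⟨Z1, h1, h1', h1''⟩ := hs Z hZ hZi
    refine ⟨Z1, h1, h1', ?_⟩
    rcases h1'' with h | h
    · exact Or.inr fun x hx hxs => hx.2 (h ⟨hxs, hx.1⟩)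
    · exact Or.inl fun x hx => by_contra fun h' => hx.1 (h ⟨hx.2, h'⟩)

/-- `S` is covered by finitely many irreducible closed sets of height (in the partially ordered set
of irreducible closed sets) less than `d`. -/
def HeightLT (d : ℕ) (S : Set T) : Prop :=
  ∃ s : Set (IrreducibleCloseds T), s.Finite ∧ (∀ Z ∈ s, Order.height Z < d) ∧ S ⊆ ⋃ Z ∈ s, Z

theorem HeightLT.of_ssubset [NoetherianSpace T] {d : ℕ} {Z : IrreducibleCloseds T}
    (hZ : Order.height Z < (d + 1 : ℕ)) {Z' : Set T} (hZ' : IsClosed Z') (h : Z' ⊂ Z) :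
    HeightLT d Z' := by
  obtain ⟨s, hs, hsc, hsi, rfl⟩ := NoetherianSpace.exists_finite_set_isClosed_irreducible hZ'
  refine ⟨(↑) ⁻¹' s, hs.preimage SetLike.coe_injective.injOn, fun Y hY => ?_, ?_⟩
  · have hYZ : Y < Z := by
      have : (Y : Set T) ⊆ ⋃₀ s := Set.subset_sUnion_of_mem hY
      exact SetLike.coe_ssubset_coe.1 (this.trans_ssubset h)
    have h1 : Order.height Z < ⊤ := hZ.trans (ENat.natCast_lt_top _)
    have h2 := Order.height_strictMono hYZ (h1.trans_le' (Order.height_mono hYZ.le))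
    have h3 : Order.height Z ≤ d := by
      rw [Nat.cast_add, Nat.cast_one] at hZ
      exact Order.le_of_lt_add_one hZ
    exact h2.trans_le h3
  · rintro x ⟨t, ht, hx⟩
    exact Set.mem_iUnion₂.2 ⟨⟨t, hsi t ht, hsc t ht⟩, ht, hx⟩

/-- In a Noetherian space, the rank of a set is at most the maximal height of the irreducible
closed sets needed to cover it: of more disjoint sets than there are irreducible closed sets
in the cover, at least one is not generically present in any of them. -/
theorem not_rankGE_of_heightLT [NoetherianSpace T] {D : Set T → Prop}
    (hD : ∀ S, D S → IsGenericallyDecided S) (d : ℕ) :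
    ∀ S : Set T, HeightLT d S → ¬ RankGE D d S := by
  induction d with
  | zero =>
    rintro S ⟨s, -, hs, hS⟩ ⟨x, hx⟩
    obtain ⟨Z, hZ, -⟩ := Set.mem_iUnion₂.1 (hS hx)
    exact absurd (hs Z hZ) (by simp)
  | succ d ih =>
    rintro S ⟨s, hs, hs', hS⟩ h
    obtain ⟨X, hX, hX'⟩ := h (hs.toFinset.card + 1)
    have key : ∀ i, ∃ Z ∈ hs.toFinset, ∃ Z', IsClosed Z' ∧ Z' ⊂ (Z : Set T) ∧ (Z : Set T) \ Z' ⊆ X i := by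
      intro i
      by_contra! hcon
      refine ih (X i) ?_ (hX' i).2.2
      have h1 : ∀ Z : s, ∃ Z', IsClosed Z' ∧ Z' ⊂ (Z.1 : Set T) ∧ X i ∩ Z.1 ⊆ Z' := fun Z => by
        obtain ⟨Z', h1, h2, h3 | h3⟩ := hD _ (hX' i).1 Z.1 Z.1.isClosed Z.1.isIrreducible
        · exact ⟨Z', h1, h2, h3⟩
        · exact absurd h3 (hcon Z.1 (hs.mem_toFinset.2 Z.2) Z' h1 h2)
      choose Z' h1 h2 h3 using h1
      choose t ht1 ht2 ht3 using fun Z : s => HeightLT.of_ssubset (hs' Z.1 Z.2) (h1 Z) (h2 Z)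
      have := hs.to_subtype
      refine ⟨⋃ Z, t Z, Set.finite_iUnion ht1, fun Y hY => ?_, fun x hx => ?_⟩
      · obtain ⟨Z, hY⟩ := Set.mem_iUnion.1 hY
        exact ht2 Z Y hY
      · obtain ⟨Z, hZ, hxZ⟩ := Set.mem_iUnion₂.1 (hS ((hX' i).2.1 hx))
        obtain ⟨Y, hY, hxY⟩ := Set.mem_iUnion₂.1 (ht3 ⟨Z, hZ⟩ (h3 ⟨Z, hZ⟩ ⟨hx, hxZ⟩))
        exact Set.mem_iUnion₂.2 ⟨Y, Set.mem_iUnion.2 ⟨_, hY⟩, hxY⟩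
    choose Z hZ Z' h1 h2 h3 using key
    obtain ⟨i, -, j, -, hij, hZij⟩ := Finset.exists_ne_map_eq_of_card_lt_of_maps_to
      (s := Finset.univ) (t := hs.toFinset) (f := Z) (by simp) (fun i _ => hZ i)
    -- two nonempty open subsets of an irreducible space meet
    have h4 : ¬ (Z i : Set T) ⊆ Z' i ∪ Z' j := fun h => by
      rcases isPreirreducible_iff_isClosed_union_isClosed.1 (Z i).isIrreducible.2 _ _ (h1 i) (h1 j) h
        with h | h
      · exact (h2 i).2 h
      · exact (h2 j).2 (hZij ▸ h)
    obtain ⟨x, hx, hx'⟩ := Set.not_subset.1 h4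
    rw [Set.mem_union, not_or] at hx'
    exact Set.disjoint_left.1 (hX hij) (h3 i ⟨hx, hx'.1⟩) (h3 j ⟨hZij ▸ hx, hx'.2⟩)

theorem exists_heightLT [NoetherianSpace T] {n : ℕ} (hn : topologicalKrullDim T ≤ n) (S : Set T) :
    HeightLT (n + 1) S := by
  obtain ⟨s, hs, hsc, hsi, hs'⟩ := NoetherianSpace.exists_finite_set_isClosed_irreducible
    (isClosed_univ (X := T))
  refine ⟨(↑) ⁻¹' s, hs.preimage SetLike.coe_injective.injOn, fun Y hY => ?_, fun x _ => ?_⟩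
  · have h1 : ((Order.height Y : ℕ∞) : WithBot ℕ∞) ≤ (n : ℕ∞) := (Order.height_le_krullDim Y).trans hn
    rw [Nat.cast_add, Nat.cast_one]
    exact Order.lt_add_one_iff_of_not_isMax (by simp) |>.2 (WithBot.coe_le_coe.1 h1)
  · obtain ⟨t, ht, hx⟩ : x ∈ ⋃₀ s := hs' ▸ Set.mem_univ x
    exact Set.mem_iUnion₂.2 ⟨⟨t, hsi t ht, hsc t ht⟩, ht, hx⟩

end

/-- The rank of a definable set over an algebraically closed field is finite. -/
theorem exists_not_rankGE_polyDef {K : Type u} [Field K] [IsAlgClosed K] {α : Type} [Finite α]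
    (Y : Set (α → K)) : ∃ b, ¬ RankGE (PolyDef K) b Y := by
  let _ : TopologicalSpace (α → K) := .induced (MvPolynomial.pointToPoint (k := K)) inferInstance
  have hind : Topology.IsInducing
    (MvPolynomial.pointToPoint : (α → K) → PrimeSpectrum (MvPolynomial α K)) := ⟨rfl⟩
  have := hind.noetherianSpace
  have hdim : topologicalKrullDim (α → K) ≤ Nat.card α := by
    refine hind.topologicalKrullDim_le.trans ?_
    rw [PrimeSpectrum.topologicalKrullDim_eq_ringKrullDim,
      MvPolynomial.ringKrullDim_of_isNoetherianRing, ringKrullDim_eq_zero_of_field, zero_add]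
  refine ⟨_, not_rankGE_of_heightLT (fun S hS => ?_) _ Y (exists_heightLT hdim Y)⟩
  obtain ⟨C, hC, rfl⟩ := hS.exists_isConstructible inferInstance
  exact .of_isConstructible hind.continuous hC

theorem exists_rankGE_and_not_rankGE {K : Type u} [Field K] [IsAlgClosed K] {α : Type} [Finite α]
    {Y : Set (α → K)} (hY : Y.Nonempty) :
    ∃ d, RankGE (PolyDef K) d Y ∧ ¬ RankGE (PolyDef K) (d + 1) Y := by
  classical
  have hex := exists_not_rankGE_polyDef Y
  obtain ⟨b, hb⟩ : ∃ b, Nat.find hex = b + 1 := Nat.exists_eq_succ_of_ne_zero fun h =>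
    Nat.find_spec hex (h ▸ hY)
  exact ⟨b, not_not.1 (Nat.find_min hex (hb ▸ b.lt_succ_self)), hb ▸ Nat.find_spec hex⟩

/-! ### Irreducible polynomials over real closed fields -/

section

open Polynomial Module IntermediateField

/-- An extension of odd degree of a real closed field is trivial. -/
theorem finrank_eq_one_of_odd {K L : Type*} [Field K] [IsRealClosed K] [Field L] [Algebra K L]
    [FiniteDimensional K L] (h : Odd (finrank K L)) : finrank K L = 1 := by
  refine finrank_eq_one_iff_of_nonzero' (1 : L) one_ne_zero |>.2 fun x => ?_
  have hx : IsIntegral K x := .of_finite K x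
  obtain ⟨c, hc⟩ := IsRealClosed.exists_isRoot_of_odd_natDegree
    (Odd.of_dvd_nat h (minpoly.degree_dvd hx))
  obtain ⟨y, hy⟩ := minpoly.natDegree_eq_one_iff.1
    (natDegree_eq_of_degree_eq_some (degree_eq_one_of_irreducible_of_root (minpoly.irreducible hx) hc))
  exact ⟨y, by rw [← hy, Algebra.algebraMap_eq_smul_one]⟩

/-- A field of characteristic not two in which all elements are squares has no quadratic
extensions. -/
theorem finrank_ne_two_of_isSquare {C M : Type*} [Field C] (h2 : (2 : C) ≠ 0)
    (hC : ∀ x : C, IsSquare x) [Field M] [Algebra C M] : finrank C M ≠ 2 := by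
  intro h
  have : FiniteDimensional C M := FiniteDimensional.of_finrank_pos (by omega)
  have hsurj : ∀ y : M, (minpoly C y).natDegree = 1 := by
    intro y
    have hy : IsIntegral C y := .of_finite C y
    have hdvd := minpoly.degree_dvd hy
    rw [h, Nat.dvd_prime Nat.prime_two] at hdvd
    refine hdvd.resolve_right fun hdeg => ?_
    have hp := eq_quadratic_of_degree_le_two (natDegree_le_iff_degree_le.1 hdeg.le)
    have ha : (minpoly C y).coeff 2 ≠ 0 := by
      rw [← hdeg]
      exact leadingCoeff_ne_zero.2 (minpoly.ne_zero hy)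
    generalize (minpoly C y).coeff 0 = c, (minpoly C y).coeff 1 = b,
      (minpoly C y).coeff 2 = a at hp ha
    obtain ⟨s, hs⟩ := hC (discrim a b c)
    have : NeZero (2 : C) := ⟨h2⟩
    have hroot := (quadratic_eq_zero_iff ha hs ((-b + s) / (2 * a))).2 (Or.inl rfl)
    have hroot' : (minpoly C y).IsRoot ((-b + s) / (2 * a)) := by
      rw [hp]
      simpa [pow_two] using! hroot
    have h1 : (minpoly C y).natDegree = 1 := natDegree_eq_of_degree_eq_some
      (degree_eq_one_of_irreducible_of_root (minpoly.irreducible hy) hroot')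
    omega
  have h1 : finrank C M = 1 := finrank_eq_one_iff_of_nonzero' (1 : M) one_ne_zero |>.2 fun x => by
    obtain ⟨y, hy⟩ := minpoly.natDegree_eq_one_iff.1 (hsurj x)
    exact ⟨y, by rw [← hy, Algebra.algebraMap_eq_smul_one]⟩
  omega

theorem isSquare_adjoin {K L : Type*} [Field K] [LinearOrder K] [IsStrictOrderedRing K]
    [IsRealClosed K] [Field L] [Algebra K L] {i : L} (hi : i ^ 2 = -1) (x : K⟮i⟯) : IsSquare x := by
  have hint : IsIntegral K i := ⟨X ^ 2 + 1, by monicity!, by simp [hi]⟩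
  have hform : ∀ x ∈ Algebra.adjoin K {i}, ∃ a b : K, x = algebraMap K L a + algebraMap K L b * i := by
    intro x hx
    induction hx using Algebra.adjoin_induction with
    | mem x hx => exact ⟨0, 1, by simp [Set.mem_singleton_iff.1 hx]⟩
    | algebraMap r => exact ⟨r, 0, by simp⟩
    | add x y _ _ hx hy =>
      obtain ⟨a, b, rfl⟩ := hx
      obtain ⟨c, d, rfl⟩ := hy
      exact ⟨a + c, b + d, by simp only [map_add]; ring⟩
    | mul x y _ _ hx hy =>
      obtain ⟨a, b, rfl⟩ := hx
      obtain ⟨c, d, rfl⟩ := hy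
      refine ⟨a * c - b * d, a * d + b * c, ?_⟩
      simp only [map_add, map_mul, map_sub]
      linear_combination algebraMap K L b * algebraMap K L d * hi
  obtain ⟨a, b, hab⟩ := hform x.1 (by
    rw [← adjoin_simple_toSubalgebra_of_isAlgebraic hint.isAlgebraic]
    exact x.2)
  -- the explicit formula for the square root of `a + b * i`
  obtain ⟨r', hr'⟩ := IsRealClosed.nonneg_iff_isSquare.1 (add_nonneg (sq_nonneg a) (sq_nonneg b))
  have hr : |r'| ^ 2 = a ^ 2 + b ^ 2 := by rw [sq_abs, hr', pow_two]
  set r := |r'|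
  have hra : |a| ≤ r := abs_le.2 (abs_le_of_sq_le_sq'
    (hr.symm ▸ le_add_of_nonneg_right (sq_nonneg b)) (abs_nonneg _))
  obtain ⟨p, hp⟩ := IsRealClosed.nonneg_iff_isSquare.1
    (show 0 ≤ (r + a) / 2 by linarith [(abs_le.1 hra).1])
  obtain ⟨q, hq⟩ := IsRealClosed.nonneg_iff_isSquare.1
    (show 0 ≤ (r - a) / 2 by linarith [(abs_le.1 hra).2])
  have hpq : (2 * p * q) ^ 2 = b ^ 2 := by
    have : (2 * p * q) ^ 2 = 4 * (p * p) * (q * q) := by ring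
    rw [this, ← hp, ← hq]
    linear_combination hr
  obtain ⟨q', hq', hb⟩ : ∃ q', q' * q' = q * q ∧ 2 * p * q' = b := by
    rcases sq_eq_sq_iff_eq_or_eq_neg.1 hpq with h | h
    · exact ⟨q, rfl, h⟩
    · exact ⟨-q, by ring, by linear_combination -h⟩
  refine ⟨algebraMap K _ p + algebraMap K _ q' * AdjoinSimple.gen K i, Subtype.ext ?_⟩
  change x.1 = (algebraMap K L p + algebraMap K L q' * i) * (algebraMap K L p + algebraMap K L q' * i)
  have ha : p * p - q' * q' = a := by rw [hq', ← hp, ← hq]; ring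
  rw [hab, ← ha, ← hb]
  simp only [map_sub, map_mul, map_ofNat]
  linear_combination -(algebraMap K L q' * algebraMap K L q') * hi

/-- The fundamental theorem of algebra for real closed fields: the Galois group is a two-group
because there are no extensions of odd degree, and it is trivial over `K⟮i⟯` because there are no
quadratic extensions of `K⟮i⟯`. -/
theorem finrank_le_two_of_isGalois {K L : Type*} [Field K] [LinearOrder K] [IsStrictOrderedRing K]
    [IsRealClosed K] [Field L] [Algebra K L] [FiniteDimensional K L] [IsGalois K L] {i : L}
    (hi : i ^ 2 = -1) : finrank K L ≤ 2 := by
  obtain ⟨P⟩ : Nonempty (Sylow 2 Gal(L/K)) := inferInstance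
  have hcard : finrank K (fixedField P.1) * Nat.card P = P.1.index * Nat.card P := by
    rw [← finrank_fixedField_eq_card, finrank_mul_finrank, finrank_fixedField_eq_card,
      Subgroup.index_mul_card, IsGalois.card_aut_eq_finrank]
  have hodd : Odd (finrank K (fixedField P.1)) := by
    rw [Nat.eq_of_mul_eq_mul_right Nat.card_pos hcard, ← Nat.not_even_iff_odd, even_iff_two_dvd]
    exact P.not_dvd_index
  have h1 := finrank_eq_one_of_odd hodd
  obtain ⟨n, hn⟩ := P.2.exists_card_eq
  have hL : finrank K L = 2 ^ n := by
    rw [← finrank_mul_finrank K (fixedField P.1) L, h1, one_mul, finrank_fixedField_eq_card]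
    exact hn
  have hint : IsIntegral K i := .of_finite K i
  have hCdeg : finrank K K⟮i⟯ ≤ 2 := by
    rw [adjoin.finrank hint]
    have h := natDegree_le_of_dvd (minpoly.dvd K i (p := X ^ 2 + 1) (by simp [hi]))
      (show (X ^ 2 + 1 : K[X]).Monic by monicity!).ne_zero
    exact h.trans (by compute_degree!)
  suffices h : finrank K⟮i⟯ L = 1 by
    rw [← finrank_mul_finrank K K⟮i⟯ L, h, mul_one]
    exact hCdeg
  obtain ⟨m, -, hm⟩ := (Nat.dvd_prime_pow Nat.prime_two).1
    (hL ▸ Dvd.intro_left _ (finrank_mul_finrank K K⟮i⟯ L))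
  rcases m with - | m
  · exact hm
  · have hGal : Nat.card Gal(L/K⟮i⟯) = 2 ^ (m + 1) := by rw [IsGalois.card_aut_eq_finrank, hm]
    obtain ⟨H, hH⟩ := Sylow.exists_subgroup_card_pow_prime 2 (G := Gal(L/K⟮i⟯)) (n := m)
      (hGal ▸ pow_dvd_pow 2 m.le_succ)
    have h3 := finrank_mul_finrank K⟮i⟯ (fixedField H) L
    rw [finrank_fixedField_eq_card, hH, hm, pow_succ'] at h3
    exact absurd (Nat.eq_of_mul_eq_mul_right (pow_pos two_pos m) h3)
      (finrank_ne_two_of_isSquare two_ne_zero (isSquare_adjoin hi))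

theorem natDegree_le_two_of_irreducible {K : Type*} [Field K] [LinearOrder K]
    [IsStrictOrderedRing K] [IsRealClosed K] {p : K[X]} (hp : Irreducible p) :
    p.natDegree ≤ 2 := by
  let f : K[X] := p * (X ^ 2 + 1)
  have hX : (X ^ 2 + 1 : K[X]) ≠ 0 := (show (X ^ 2 + 1 : K[X]).Monic by monicity!).ne_zero
  have hf : f ≠ 0 := mul_ne_zero hp.ne_zero hX
  let L := f.SplittingField
  have : IsGalois K L := IsGalois.mk
  have hs := SplittingField.splits f
  have hf' : f.map (algebraMap K L) ≠ 0 := (Polynomial.map_ne_zero_iff (algebraMap K L).injective).2 hf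
  obtain ⟨i, hi⟩ := (hs.of_dvd hf' (Polynomial.map_dvd _ (dvd_mul_left _ p))).exists_eval_eq_zero (by
    rw [degree_map]
    have : (X ^ 2 + 1 : K[X]).degree = 2 := by compute_degree!
    rw [this]
    exact two_ne_zero)
  obtain ⟨y, hy⟩ := (hs.of_dvd hf' (Polynomial.map_dvd _ (dvd_mul_right p _))).exists_eval_eq_zero (by
    rw [degree_map]
    exact (degree_pos_of_irreducible hp).ne')
  have hi' : i ^ 2 = -1 := by
    simpa [← eq_neg_iff_add_eq_zero] using hi
  have hdvd : minpoly K y ∣ p := minpoly.dvd K y (by rwa [← eval_map_algebraMap])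
  have hassoc := (minpoly.irreducible (IsIntegral.of_finite K y)).associated_of_dvd hp hdvd
  rw [← natDegree_eq_of_degree_eq (degree_eq_degree_of_associated hassoc)]
  exact (minpoly.natDegree_le y).trans (finrank_le_two_of_isGalois hi')

end

/-! ### Polynomials over real closed fields: signs, intermediate values, mean values -/

section

open Polynomial SignType

variable {K : Type u} [Field K] [LinearOrder K] [IsStrictOrderedRing K]

theorem sign_eq_of_mul_pos {a b : K} (h : 0 < a * b) : sign a = sign b := by
  rcases pos_and_pos_or_neg_and_neg_of_mul_pos h with ⟨h1, h2⟩ | ⟨h1, h2⟩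
  · rw [sign_pos h1, sign_pos h2]
  · rw [sign_neg h1, sign_neg h2]

theorem eval_mul_eval_pos_of_irreducible [IsRealClosed K] {p : K[X]} (hp : Irreducible p) {a b : K}
    (hab : a ≤ b) (h : ∀ x, a ≤ x → x ≤ b → p.eval x ≠ 0) : 0 < p.eval a * p.eval b := by
  have hdeg := natDegree_le_two_of_irreducible hp
  have hpos := hp.natDegree_pos
  have hq := eq_quadratic_of_degree_le_two (natDegree_le_iff_degree_le.1 hdeg)
  generalize p.coeff 0 = γ, p.coeff 1 = β, p.coeff 2 = α at hq
  have hev : ∀ x, p.eval x = α * x ^ 2 + β * x + γ := fun x => by rw [hq]; simp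
  rcases eq_or_ne α 0 with rfl | hα
  · have hβ : β ≠ 0 := by
      rintro rfl
      rw [hq] at hpos
      simp at hpos
    -- the root of a linear factor lies outside the interval
    have hr : p.eval (-γ / β) = 0 := by
      rw [hev]
      field_simp
      ring
    have h1 : p.eval a * p.eval b = β ^ 2 * ((a - -γ / β) * (b - -γ / β)) := by
      rw [hev, hev]
      field_simp
      ring
    rw [h1]
    refine mul_pos (by positivity) ?_
    rcases lt_or_ge (-γ / β) a with h2 | h2
    · exact mul_pos (by linarith) (by linarith)
    · rcases lt_or_ge b (-γ / β) with h3 | h3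
      · exact mul_pos_of_neg_of_neg (by linarith) (by linarith)
      · exact absurd hr (h _ h2 h3)
  · have hirr : ∀ x, p.eval x ≠ 0 := fun x hx => by
      have h1 : p.natDegree = 1 :=
        natDegree_eq_of_degree_eq_some (degree_eq_one_of_irreducible_of_root hp hx)
      rw [hq, natDegree_quadratic hα] at h1
      omega
    have hD : β ^ 2 - 4 * α * γ < 0 := by
      by_contra! hD
      obtain ⟨s, hs⟩ := IsRealClosed.nonneg_iff_isSquare.1 hD
      refine hirr ((-β + s) / (2 * α)) ?_
      rw [hev]
      field_simp
      linear_combination -hs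
    have hpos : ∀ x, 0 < α * p.eval x := fun x => by
      rw [hev]
      nlinarith [sq_nonneg (2 * α * x + β)]
    have h1 := mul_pos (hpos a) (hpos b)
    have h2 : 0 < α ^ 2 := by positivity
    exact pos_of_mul_pos_right (a := α ^ 2) (by linarith) h2.le

/-- The intermediate value theorem for polynomials over real closed fields. -/
theorem eval_mul_eval_pos [IsRealClosed K] (p : K[X]) {a b : K} (hab : a ≤ b) :
    (∀ x, a ≤ x → x ≤ b → p.eval x ≠ 0) → 0 < p.eval a * p.eval b := by
  induction p using WfDvdMonoid.induction_on_irreducible with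
  | zero => exact fun h => absurd eval_zero (h a le_rfl hab)
  | unit p hp =>
    obtain ⟨c, hc, rfl⟩ := Polynomial.isUnit_iff.1 hp
    intro _
    rw [eval_C, eval_C]
    exact mul_self_pos.2 hc.ne_zero
  | mul p i hp hi ih =>
    intro h
    have h1 := eval_mul_eval_pos_of_irreducible hi hab fun x hx hx' h0 => h x hx hx' (by simp [h0])
    have h2 := ih fun x hx hx' h0 => h x hx hx' (by simp [h0])
    rw [eval_mul, eval_mul]
    nlinarith [mul_pos h1 h2]

theorem sign_eval_eq [IsRealClosed K] (p : K[X]) {a b : K} (hab : a ≤ b)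
    (h : ∀ x, a ≤ x → x ≤ b → p.eval x ≠ 0) : sign (p.eval a) = sign (p.eval b) :=
  sign_eq_of_mul_pos (eval_mul_eval_pos p hab h)

/-- Rolle's theorem for polynomials over real closed fields. -/
theorem exists_derivative_eval_eq_zero [IsRealClosed K] {p : K[X]} (hp : p ≠ 0) {a b : K}
    (hab : a < b) (ha : p.eval a = 0) (hb : p.eval b = 0) :
    ∃ x, a < x ∧ x < b ∧ p.derivative.eval x = 0 := by
  classical
  -- the roots may be taken to be consecutive
  obtain ⟨c, hc, hmin⟩ := (p.roots.toFinset.filter fun x => a < x ∧ x ≤ b).exists_min_image id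
    ⟨b, by simp [hp, hb, hab]⟩
  simp only [Finset.mem_filter, Multiset.mem_toFinset, mem_roots hp, IsRoot.def, id] at hc hmin
  obtain ⟨hc0, hac, hcb⟩ := hc
  obtain ⟨g, hg, hga⟩ := exists_eq_pow_rootMultiplicity_mul_and_not_dvd p hp a
  rw [dvd_iff_isRoot, IsRoot.def] at hga
  have hm : 0 < p.rootMultiplicity a := (rootMultiplicity_pos hp).2 ha
  have hgc : g.eval c = 0 := by
    rw [hg] at hc0
    simpa [sub_eq_zero, hac.ne'] using hc0
  have hg0 : g ≠ 0 := fun h => hga (by simp [h])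
  obtain ⟨q, hq, hqc⟩ := exists_eq_pow_rootMultiplicity_mul_and_not_dvd g hg0 c
  rw [dvd_iff_isRoot, IsRoot.def] at hqc
  have hn : 0 < g.rootMultiplicity c := (rootMultiplicity_pos hg0).2 hgc
  obtain ⟨m, hm'⟩ := Nat.exists_eq_succ_of_ne_zero hm.ne'
  obtain ⟨n, hn'⟩ := Nat.exists_eq_succ_of_ne_zero hn.ne'
  rw [hm'] at hg
  rw [hn'] at hq
  have hqa : q.eval a ≠ 0 := fun h => hga (by rw [hq, eval_mul, h, mul_zero])
  have hqpos : 0 < q.eval a * q.eval c := eval_mul_eval_pos q hac.le fun x hx hx' h0 => by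
    rcases hx.eq_or_lt with rfl | hx
    · exact hqa h0
    rcases hx'.eq_or_lt with rfl | hx'
    · exact hqc h0
    · refine absurd (hmin x ⟨?_, hx, hx'.le.trans hcb⟩) (not_le.2 hx')
      rw [hg, hq, eval_mul, eval_mul, h0, mul_zero, mul_zero]
  let s : K[X] := C (m + 1 : K) * (X - C c) * q + C (n + 1 : K) * (X - C a) * q +
    (X - C a) * (X - C c) * derivative q
  have hs : derivative p = (X - C a) ^ m * (X - C c) ^ n * s := by
    rw [hg, hq]
    simp only [derivative_mul, derivative_X_sub_C_pow, Nat.succ_eq_add_one, Nat.add_sub_cancel, s,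
      map_add, map_natCast, map_one, Nat.cast_add, Nat.cast_one]
    ring
  have hsa : s.eval a = -((m + 1 : K) * (c - a)) * q.eval a := by simp [s]; ring
  have hsc : s.eval c = (n + 1 : K) * (c - a) * q.eval c := by simp [s]
  have hca : 0 < c - a := sub_pos.2 hac
  have hneg : s.eval a * s.eval c < 0 := by
    rw [hsa, hsc]
    have : 0 < (m + 1 : K) * (c - a) * ((n + 1 : K) * (c - a)) * (q.eval a * q.eval c) := by positivity
    linarith
  obtain ⟨x, hx, hx', hx0⟩ : ∃ x, a ≤ x ∧ x ≤ c ∧ s.eval x = 0 := by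
    by_contra! hcon
    exact hneg.not_gt (eval_mul_eval_pos s hac.le hcon)
  refine ⟨x, hx.lt_of_ne ?_, (hx'.lt_of_ne ?_).trans_le hcb, by rw [hs, eval_mul, hx0, mul_zero]⟩
  · rintro rfl
    rw [hx0, zero_mul] at hneg
    exact hneg.ne rfl
  · rintro rfl
    rw [hx0, mul_zero] at hneg
    exact hneg.ne rfl

/-- The mean value theorem for polynomials over real closed fields. -/
theorem exists_eval_sub_eval_eq [IsRealClosed K] (p : K[X]) {a b : K} (hab : a < b) :
    ∃ x, a < x ∧ x < b ∧ p.eval b - p.eval a = p.derivative.eval x * (b - a) := by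
  let s := (p.eval b - p.eval a) / (b - a)
  have hs : p.eval b - p.eval a = s * (b - a) := (div_mul_cancel₀ _ (sub_pos.2 hab).ne').symm
  let r := p - C s * (X - C a) - C (p.eval a)
  have hr : r.derivative = p.derivative - C s := by simp [r]
  obtain ⟨x, hx, hx', hx0⟩ : ∃ x, a < x ∧ x < b ∧ r.derivative.eval x = 0 := by
    by_cases h0 : r = 0
    · obtain ⟨x, hx, hx'⟩ := exists_between hab
      exact ⟨x, hx, hx', by rw [h0, derivative_zero, eval_zero]⟩
    · exact exists_derivative_eval_eq_zero h0 hab (by simp [r]) (by simp [r, ← hs])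
  rw [hr, eval_sub, eval_C, sub_eq_zero] at hx0
  exact ⟨x, hx, hx', by rw [hx0, hs]⟩

theorem sign_eval_sub_eval [IsRealClosed K] (p : K[X]) {a b c : K} (hab : a < b)
    (h : ∀ x, a < x → x < b → sign (p.derivative.eval x) = sign c) :
    sign (p.eval b - p.eval a) = sign c := by
  obtain ⟨x, hx, hx', hx0⟩ := exists_eval_sub_eval_eq p hab
  rw [hx0, sign_mul, sign_pos (sub_pos.2 hab), mul_one, h x hx hx']

theorem exists_pos_le_eval : ∀ (n : ℕ) (p : K[X]), p.natDegree ≤ n → 0 < p.leadingCoeff →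
    ∃ ε R : K, 0 < ε ∧ ∀ x, R ≤ x → ε ≤ p.eval x := by
  intro n
  induction n with
  | zero =>
    intro p hp hlead
    rw [eq_C_of_natDegree_le_zero hp] at hlead ⊢
    rw [leadingCoeff_C] at hlead
    exact ⟨_, 0, hlead, fun x _ => by rw [eval_C]⟩
  | succ n ih =>
    intro p hp hlead
    by_cases h0 : p.natDegree = 0
    · exact ih p (by omega) hlead
    have h1 : p.divX.natDegree = p.natDegree - 1 := natDegree_divX_eq_natDegree_tsub_one
    have h2 : p.divX.leadingCoeff = p.leadingCoeff := by
      rw [leadingCoeff, h1, coeff_divX, Nat.sub_add_cancel (Nat.pos_of_ne_zero h0), leadingCoeff]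
    obtain ⟨ε, R, hε, hR⟩ := ih p.divX (by omega) (h2 ▸ hlead)
    refine ⟨ε, max R (max 0 (1 - p.coeff 0 / ε)), hε, fun x hx => ?_⟩
    obtain ⟨hx1, hx2⟩ := max_le_iff.1 hx
    obtain ⟨hx2, hx3⟩ := max_le_iff.1 hx2
    have h3 : p.eval x = p.divX.eval x * x + p.coeff 0 := by
      conv_lhs => rw [← divX_mul_X_add p]
      simp
    have h4 : ε - p.coeff 0 ≤ ε * x := by
      have := mul_le_mul_of_nonneg_left hx3 hε.le
      rwa [mul_sub, mul_one, mul_div_cancel₀ _ hε.ne'] at this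
    have h5 := mul_le_mul_of_nonneg_right (hR x hx1) hx2
    rw [h3]
    linarith

theorem exists_sign_eval_eq_atTop (p : K[X]) :
    ∃ R : K, ∀ x, R < x → sign (p.eval x) = sign p.leadingCoeff := by
  rcases lt_trichotomy 0 p.leadingCoeff with h | h | h
  · obtain ⟨ε, R, hε, hR⟩ := exists_pos_le_eval _ p le_rfl h
    exact ⟨R, fun x hx => by rw [sign_pos h, sign_pos (hε.trans_le (hR x hx.le))]⟩
  · rw [leadingCoeff_eq_zero.1 h.symm]
    exact ⟨0, fun x _ => by simp⟩
  · obtain ⟨ε, R, hε, hR⟩ := exists_pos_le_eval _ (-p) le_rfl (by simpa using h)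
    refine ⟨R, fun x hx => ?_⟩
    have := hR x hx.le
    rw [eval_neg] at this
    rw [sign_neg h, sign_neg (by linarith)]

theorem exists_sign_eval_eq_atBot (p : K[X]) :
    ∃ R : K, ∀ x, x < R → sign (p.eval x) = sign (p.leadingCoeff * (-1) ^ p.natDegree) := by
  obtain ⟨R, hR⟩ := exists_sign_eval_eq_atTop (p.comp (-X))
  have h1 : (p.comp (-X)).leadingCoeff = p.leadingCoeff * (-1) ^ p.natDegree := by
    rw [leadingCoeff_comp (by simp)]
    simp
  refine ⟨-R, fun x hx => ?_⟩
  rw [← h1, ← hR (-x) (by linarith)]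
  simp

end

/-! ### Matchings of sign tables -/

section

/-- The point `c` has the same position with respect to the first components of `M` as the point `c'`
with respect to the second ones. -/
def SamePosition {α : Type*} [LinearOrder α] (M : Finset (α × α)) (c c' : α) : Prop :=
  ∀ x ∈ M, (x.1 < c ↔ x.2 < c') ∧ (c < x.1 ↔ c' < x.2)

namespace SamePosition

variable {α : Type*} [LinearOrder α] {M : Finset (α × α)} {c c' : α}

theorem eq_iff (h : SamePosition M c c') {x : α × α} (hx : x ∈ M) : x.1 = c ↔ x.2 = c' := by
  have := h x hx
  constructor
  · rintro h1
    exact le_antisymm (not_lt.1 (mt this.2.2 h1.not_gt)) (not_lt.1 (mt this.1.2 h1.not_lt))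
  · rintro h1
    exact le_antisymm (not_lt.1 (mt this.2.1 h1.not_gt)) (not_lt.1 (mt this.1.1 h1.not_lt))

theorem mono {M' : Finset (α × α)} (h : SamePosition M c c') (hM : M' ⊆ M) :
    SamePosition M' c c' := fun x hx => h x (hM hx)

theorem swap (h : SamePosition M c c') : SamePosition (M.image Prod.swap) c' c := by
  intro x hx
  obtain ⟨y, hy, rfl⟩ := Finset.mem_image.1 hx
  exact ⟨(h y hy).1.symm, (h y hy).2.symm⟩

theorem of_lt (h1 : ∀ x ∈ M, x.1 < c → x.2 < c') (h2 : ∀ x ∈ M, c < x.1 → c' < x.2)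
    (h3 : ∀ x ∈ M, x.1 = c → x.2 = c') : SamePosition M c c' := by
  intro x hx
  rcases lt_trichotomy x.1 c with h | h | h
  · have := h1 x hx h
    exact ⟨iff_of_true h this, iff_of_false h.not_gt this.not_gt⟩
  · have := h3 x hx h
    exact ⟨iff_of_false h.not_lt this.not_lt, iff_of_false h.not_gt this.not_gt⟩
  · have := h2 x hx h
    exact ⟨iff_of_false h.not_gt this.not_gt, iff_of_true h this⟩

theorem exists_of_pairs [DenselyOrdered α] [NoMinOrder α] [NoMaxOrder α]
    (hM : ∀ x ∈ M, SamePosition M x.1 x.2) (c : α) : ∃ c', SamePosition M c c' := by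
  by_cases h : ∃ x ∈ M, x.1 = c
  · obtain ⟨x, hx, rfl⟩ := h
    exact ⟨x.2, hM x hx⟩
  push Not at h
  have : Nonempty α := ⟨c⟩
  obtain ⟨c', h1, h2⟩ := Order.exists_between_finsets ((M.filter fun x => x.1 < c).image Prod.snd)
    ((M.filter fun x => c < x.1).image Prod.snd) (by
      intro a ha b hb
      simp only [Finset.mem_image, Finset.mem_filter] at ha hb
      obtain ⟨x, ⟨hx, hxc⟩, rfl⟩ := ha
      obtain ⟨y, ⟨hy, hyc⟩, rfl⟩ := hb
      exact ((hM y hy x hx).1).1 (hxc.trans hyc))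
  exact ⟨c', of_lt (fun x hx hxc => h1 _ (Finset.mem_image_of_mem _ (Finset.mem_filter.2 ⟨hx, hxc⟩)))
    (fun x hx hxc => h2 _ (Finset.mem_image_of_mem _ (Finset.mem_filter.2 ⟨hx, hxc⟩)))
    fun x hx hxc => absurd hxc (h x hx)⟩

theorem exists_lt_of_notMem [DenselyOrdered α] [NoMinOrder α] [NoMaxOrder α]
    (h : SamePosition M c c') (hc : ∀ x ∈ M, x.1 ≠ c) :
    ∃ d, c < d ∧ ∀ e, c ≤ e → e ≤ d → SamePosition M e c' := by
  have : Nonempty α := ⟨c⟩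
  obtain ⟨d, h1, h2⟩ := Order.exists_between_finsets {c}
    ((M.filter fun x => c < x.1).image Prod.fst) (by
      intro a ha b hb
      simp only [Finset.mem_image, Finset.mem_filter, Finset.mem_singleton] at ha hb
      obtain ⟨x, ⟨hx, hxc⟩, rfl⟩ := hb
      exact ha ▸ hxc)
  refine ⟨d, h1 c (Finset.mem_singleton_self c), fun e he he' => ?_⟩
  have h3 : ∀ x ∈ M, c < x.1 → e < x.1 := fun x hx hxc => he'.trans_lt
    (h2 _ (Finset.mem_image_of_mem _ (Finset.mem_filter.2 ⟨hx, hxc⟩)))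
  refine of_lt (fun x hx hxe => (h x hx).1.1 ?_) (fun x hx hxe => (h x hx).2.1 (he.trans_lt hxe)) ?_
  · rcases lt_trichotomy x.1 c with h4 | h4 | h4
    · exact h4
    · exact absurd h4 (hc x hx)
    · exact absurd (h3 x hx h4) hxe.not_gt
  · rintro x hx rfl
    rcases he.eq_or_lt with h4 | h4
    · exact absurd h4.symm (hc x hx)
    · exact absurd (h3 x hx h4) (lt_irrefl _)

/-- There are points `l < c` and `l' < c'`, not separated from `c` and `c'` by the components of `M`,
at which two given functions agree, provided that the functions agree on `M` and near `-∞`. -/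
theorem exists_left [NoMinOrder α] {β : Type*} (h : SamePosition M c c') (F G : α → β)
    (hFG : ∀ x ∈ M, F x.1 = G x.2) (hinf : ∃ R R', ∀ x < R, ∀ y < R', F x = G y)
    (hM : ∀ x ∈ M, SamePosition M x.1 x.2) :
    ∃ l l', l < c ∧ l' < c' ∧ (∀ x ∈ M, x.1 < c → x.1 ≤ l) ∧ (∀ x ∈ M, x.2 < c' → x.2 ≤ l') ∧
      F l = G l' := by
  classical
  by_cases hne : (M.filter fun x => x.1 < c).Nonempty
  · obtain ⟨x, hx, hmax⟩ := Finset.exists_max_image _ Prod.fst hne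
    rw [Finset.mem_filter] at hx
    have h1 : ∀ y ∈ M, y.1 < c → y.1 ≤ x.1 := fun y hy hyc => hmax y (Finset.mem_filter.2 ⟨hy, hyc⟩)
    refine ⟨x.1, x.2, hx.2, (h x hx.1).1.1 hx.2, h1, fun y hy hyc => ?_, hFG x hx.1⟩
    exact not_lt.1 (mt (hM x hx.1 y hy).2.2 (h1 y hy ((h y hy).1.2 hyc)).not_gt)
  · rw [Finset.not_nonempty_iff_eq_empty, Finset.filter_eq_empty_iff] at hne
    obtain ⟨R, R', hR⟩ := hinf
    obtain ⟨l, hl⟩ := exists_lt (min R c)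
    obtain ⟨l', hl'⟩ := exists_lt (min R' c')
    rw [lt_min_iff] at hl hl'
    exact ⟨l, l', hl.2, hl'.2, fun x hx hxc => absurd hxc (hne hx),
      fun x hx hxc => absurd ((h x hx).1.2 hxc) (hne hx), hR l hl.1 l' hl'.1⟩

theorem exists_right [NoMaxOrder α] {β : Type*} (h : SamePosition M c c') (F G : α → β)
    (hFG : ∀ x ∈ M, F x.1 = G x.2) (hinf : ∃ R R', ∀ x > R, ∀ y > R', F x = G y)
    (hM : ∀ x ∈ M, SamePosition M x.1 x.2) :
    ∃ l l', c < l ∧ c' < l' ∧ (∀ x ∈ M, c < x.1 → l ≤ x.1) ∧ (∀ x ∈ M, c' < x.2 → l' ≤ x.2) ∧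
      F l = G l' :=
  exists_left (α := αᵒᵈ) (M := M) (c := c) (c' := c') (fun x hx => (h x hx).symm) F G hFG hinf
    fun x hx y hy => (hM x hx y hy).symm

end SamePosition

open Polynomial SignType

theorem map_eraseLead_of_eq_zero {R K : Type*} [CommRing R] [Field K] {φ : R →+* K} {q : R[X]}
    (h : φ q.leadingCoeff = 0) :
    q.eraseLead.map φ = q.map φ := by
  conv_rhs => rw [← eraseLead_add_C_mul_X_pow q]
  rw [Polynomial.map_add, Polynomial.map_mul, map_C, h, C_0, zero_mul, add_zero]

variable {R : Type*} [CommRing R] {K : Type u} [Field K] [LinearOrder K]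

/-- The set `M` consists of pairs of corresponding roots of the images of the polynomials in `S`
under two homomorphisms to `K`, so that these images have the same signs at points in
the same position. -/
structure IsSignMatching (φ φ' : R →+* K) (S : Set R[X]) (M : Finset (K × K)) : Prop where
  pairs : ∀ x ∈ M, SamePosition M x.1 x.2
  root : ∀ x ∈ M, ∃ q ∈ S, q.map φ ≠ 0 ∧ (q.map φ).eval x.1 = 0
  sign : ∀ c c', SamePosition M c c' → ∀ q ∈ S,
    sign ((q.map φ).eval c) = sign ((q.map φ').eval c')

/-- The coefficients of the polynomials in `S` have the same signs under `φ` and `φ'`. -/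
def SameSigns (φ φ' : R →+* K) (S : Set R[X]) : Prop :=
  ∀ q ∈ S, ∀ n, sign (φ (q.coeff n)) = sign (φ' (q.coeff n))

namespace SameSigns

variable {φ φ' : R →+* K} {S : Set R[X]}

theorem symm (h : SameSigns φ φ' S) : SameSigns φ' φ S := fun q hq n => (h q hq n).symm

theorem eq_zero_iff (h : SameSigns φ φ' S) {q : R[X]} (hq : q ∈ S) (n : ℕ) :
    φ (q.coeff n) = 0 ↔ φ' (q.coeff n) = 0 := by
  rw [← sign_eq_zero_iff, h q hq n, sign_eq_zero_iff]

theorem map_ne_zero_iff (h : SameSigns φ φ' S) {q : R[X]} (hq : q ∈ S) :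
    q.map φ ≠ 0 ↔ q.map φ' ≠ 0 := by
  refine not_congr ?_
  simp only [Polynomial.ext_iff, coeff_map, coeff_zero]
  exact forall_congr' fun n => h.eq_zero_iff hq n

end SameSigns

/-- If `S` is closed under omission of leading terms, then each polynomial in `S` has the same images
as one whose leading coefficient does not vanish. -/
theorem exists_leadingCoeff_ne_zero {φ φ' : R →+* K} {S : Set R[X]} (hS : SameSigns φ φ' S)
    (herase : ∀ q ∈ S, 0 < q.natDegree → q.eraseLead ∈ S) (n : ℕ) :
    ∀ q ∈ S, q.natDegree ≤ n → q.map φ ≠ 0 → ∃ q₀ ∈ S, q₀.natDegree ≤ n ∧ φ q₀.leadingCoeff ≠ 0 ∧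
      q₀.map φ = q.map φ ∧ q₀.map φ' = q.map φ' := by
  induction n with
  | zero =>
    intro q hq hn h0
    refine ⟨q, hq, hn, fun h => h0 ?_, rfl, rfl⟩
    rw [eq_C_of_natDegree_le_zero hn] at h ⊢
    rw [leadingCoeff_C] at h
    rw [map_C, h, C_0]
  | succ n ih =>
    intro q hq hn h0
    by_cases hlead : φ q.leadingCoeff = 0
    · have h1 := map_eraseLead_of_eq_zero hlead
      have h2 := map_eraseLead_of_eq_zero ((hS.eq_zero_iff hq _).1 hlead)
      by_cases hdeg : q.natDegree = 0
      · refine absurd ?_ h0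
        rw [eq_C_of_natDegree_le_zero hdeg.le] at hlead ⊢
        rw [leadingCoeff_C] at hlead
        rw [map_C, hlead, C_0]
      · obtain ⟨q₀, h3, h4, h5, h6, h7⟩ := ih q.eraseLead (herase q hq (Nat.pos_of_ne_zero hdeg))
          (q.eraseLead_natDegree_le.trans (by omega)) (h1 ▸ h0)
        exact ⟨q₀, h3, by omega, h5, h6.trans h1, h7.trans h2⟩
    · exact ⟨q, hq, hn, hlead, rfl, rfl⟩

namespace IsSignMatching

variable {φ φ' : R →+* K} {S : Set R[X]} {M : Finset (K × K)}

theorem swap (hM : IsSignMatching φ φ' S M) (hS : SameSigns φ φ' S) :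
    IsSignMatching φ' φ S (M.image Prod.swap) where
  pairs x hx := by
    obtain ⟨y, hy, rfl⟩ := Finset.mem_image.1 hx
    exact (hM.pairs y hy).swap
  root x hx := by
    obtain ⟨y, hy, rfl⟩ := Finset.mem_image.1 hx
    obtain ⟨q, hq, hq0, hqy⟩ := hM.root y hy
    refine ⟨q, hq, (hS.map_ne_zero_iff hq).1 hq0, ?_⟩
    rw [← sign_eq_zero_iff]
    exact (hM.sign _ _ (hM.pairs y hy) q hq).symm.trans (sign_eq_zero_iff.2 hqy)
  sign c c' hc q hq := by
    refine (hM.sign c' c ?_ q hq).symm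
    have := hc.swap
    rwa [Finset.image_image, Prod.swap_swap_eq, Finset.image_id] at this

/-- A point which is not a first component of `M` is not a root, because all the points in an
interval around it have the same position. -/
theorem exists_of_root [IsStrictOrderedRing K] (hM : IsSignMatching φ φ' S M) {q : R[X]}
    (hq : q ∈ S) (hq0 : q.map φ ≠ 0)
    {t : K} (ht : (q.map φ).eval t = 0) : ∃ x ∈ M, x.1 = t := by
  by_contra! hcon
  obtain ⟨s, hs⟩ := SamePosition.exists_of_pairs hM.pairs t
  obtain ⟨d, hd, hd'⟩ := hs.exists_lt_of_notMem hcon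
  refine hq0 (eq_zero_of_infinite_isRoot _ ((Set.Icc_infinite hd).mono fun e he => ?_))
  have h1 := hM.sign e s (hd' e he.1 he.2) q hq
  rw [← hM.sign t s hs q hq, ht, sign_zero, sign_eq_zero_iff] at h1
  exact h1

end IsSignMatching

end

/-! ### Extending a matching of sign tables by one polynomial -/

section

open Polynomial SignType

/-- Pseudo-division of polynomials. -/
theorem exists_pseudo_rem {R : Type*} [CommRing R] [IsDomain R] {q : R[X]} (hq : 0 < q.natDegree)
    (n : ℕ) : ∀ p : R[X], p.natDegree ≤ n → ∃ (e : ℕ) (h r : R[X]), r.natDegree < q.natDegree ∧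
      C (q.leadingCoeff ^ e) * p = h * q + r := by
  have hq0 : q ≠ 0 := fun h => by simp [h] at hq
  induction n with
  | zero => exact fun p hp => ⟨0, 0, p, by omega, by simp⟩
  | succ n ih =>
    intro p hp
    rcases lt_or_ge p.natDegree q.natDegree with hlt | hge
    · exact ⟨0, 0, p, hlt, by simp⟩
    have hp0 : p ≠ 0 := fun h => by simp [h] at hge; omega
    have hdeg : (C q.leadingCoeff * p).degree =
        (C p.leadingCoeff * X ^ (p.natDegree - q.natDegree) * q).degree := by
      have h1 : (C q.leadingCoeff * p).degree = p.natDegree := by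
        rw [degree_C_mul (leadingCoeff_ne_zero.2 hq0), degree_eq_natDegree hp0]
      rw [h1, mul_assoc, degree_C_mul (leadingCoeff_ne_zero.2 hp0), degree_mul, degree_X_pow,
        degree_eq_natDegree hq0, ← Nat.cast_add, Nat.sub_add_cancel hge]
    have hlt := degree_sub_lt_left hdeg (mul_ne_zero (C_ne_zero.2 (leadingCoeff_ne_zero.2 hq0)) hp0)
      (by rw [leadingCoeff_mul, leadingCoeff_C, leadingCoeff_mul, leadingCoeff_mul, leadingCoeff_C,
        leadingCoeff_X_pow, mul_one, mul_comm])
    rw [degree_C_mul (leadingCoeff_ne_zero.2 hq0), degree_eq_natDegree hp0] at hlt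
    obtain ⟨e, h, r, hr, heq⟩ := ih (C q.leadingCoeff * p -
      C p.leadingCoeff * X ^ (p.natDegree - q.natDegree) * q)
      (natDegree_le_iff_degree_le.2 (Order.le_of_lt_succ (hlt.trans_le (Nat.cast_le.2 hp))))
    refine ⟨e + 1, h + C (q.leadingCoeff ^ e) * (C p.leadingCoeff * X ^ (p.natDegree - q.natDegree)),
      r, hr, ?_⟩
    rw [pow_succ, C_mul]
    linear_combination heq

variable {R : Type*} [CommRing R] {K : Type u} [Field K] [LinearOrder K]

variable {φ φ' : R →+* K} {S : Set R[X]} {M : Finset (K × K)} {p : R[X]}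

/-- The conditions under which a matching for `S` can be extended to `p`, whose leading coefficient
does not vanish. -/
structure IsExtensionStep (φ φ' : R →+* K) (S : Set R[X]) (M : Finset (K × K)) (p : R[X]) :
    Prop where
  matching : IsSignMatching φ φ' S M
  signs : SameSigns φ φ' S
  signs_p : ∀ n, sign (φ (p.coeff n)) = sign (φ' (p.coeff n))
  pos : 0 < p.natDegree
  lead : φ p.leadingCoeff ≠ 0
  derivative : derivative p ∈ S
  /-- The signs of `p` at the points of `M` are determined by its remainders. -/
  sign_p : ∀ x ∈ M, sign ((p.map φ).eval x.1) = sign ((p.map φ').eval x.2)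

namespace IsExtensionStep

theorem lead' (h : IsExtensionStep φ φ' S M p) : φ' p.leadingCoeff ≠ 0 := by
  rw [← sign_ne_zero, leadingCoeff, ← h.signs_p, sign_ne_zero]
  exact h.lead

theorem swap (h : IsExtensionStep φ φ' S M p) :
    IsExtensionStep φ' φ S (M.image Prod.swap) p where
  matching := h.matching.swap h.signs
  signs := h.signs.symm
  signs_p n := (h.signs_p n).symm
  pos := h.pos
  lead := h.lead'
  derivative := h.derivative
  sign_p x hx := by
    obtain ⟨y, hy, rfl⟩ := Finset.mem_image.1 hx
    exact (h.sign_p y hy).symm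

theorem map_ne_zero (h : IsExtensionStep φ φ' S M p) : p.map φ ≠ 0 := fun h0 => h.lead (by
  rw [leadingCoeff, ← coeff_map, h0, coeff_zero])

variable [IsStrictOrderedRing K]

theorem derivative_map_ne_zero (h : IsExtensionStep φ φ' S M p) :
    (Polynomial.derivative p).map φ ≠ 0 := by
  rw [← derivative_map]
  intro h0
  have := Polynomial.derivative_eq_zero.1 h0
  rw [natDegree_map_of_leadingCoeff_ne_zero _ h.lead] at this
  exact h.pos.ne' this

theorem sign_atTop (h : IsExtensionStep φ φ' S M p) : ∃ R R' : K, ∀ x > R, ∀ y > R',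
    sign ((p.map φ).eval x) = sign ((p.map φ').eval y) := by
  obtain ⟨R, hR⟩ := exists_sign_eval_eq_atTop (p.map φ)
  obtain ⟨R', hR'⟩ := exists_sign_eval_eq_atTop (p.map φ')
  refine ⟨R, R', fun x hx y hy => ?_⟩
  rw [hR x hx, hR' y hy, leadingCoeff_map_of_leadingCoeff_ne_zero _ h.lead,
    leadingCoeff_map_of_leadingCoeff_ne_zero _ h.lead']
  exact h.signs_p _

theorem sign_atBot (h : IsExtensionStep φ φ' S M p) : ∃ R R' : K, ∀ x < R, ∀ y < R',
    sign ((p.map φ).eval x) = sign ((p.map φ').eval y) := by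
  obtain ⟨R, hR⟩ := exists_sign_eval_eq_atBot (p.map φ)
  obtain ⟨R', hR'⟩ := exists_sign_eval_eq_atBot (p.map φ')
  refine ⟨R, R', fun x hx y hy => ?_⟩
  rw [hR x hx, hR' y hy, leadingCoeff_map_of_leadingCoeff_ne_zero _ h.lead,
    leadingCoeff_map_of_leadingCoeff_ne_zero _ h.lead',
    natDegree_map_of_leadingCoeff_ne_zero _ h.lead,
    natDegree_map_of_leadingCoeff_ne_zero _ h.lead', sign_mul, sign_mul]
  exact congrArg (· * _) (h.signs_p _)

variable [IsRealClosed K]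

/-- Between two roots of `p` there is a point of `M`. -/
theorem exists_between (h : IsExtensionStep φ φ' S M p) {s t : K} (hs : (p.map φ).eval s = 0)
    (ht : (p.map φ).eval t = 0) (hst : s < t) : ∃ x ∈ M, s < x.1 ∧ x.1 < t := by
  obtain ⟨y, hy, hy', hy0⟩ := exists_derivative_eval_eq_zero h.map_ne_zero hst hs ht
  rw [derivative_map] at hy0
  obtain ⟨x, hx, rfl⟩ := h.matching.exists_of_root h.derivative h.derivative_map_ne_zero hy0
  exact ⟨x, hx, hy, hy'⟩

theorem root_unique (h : IsExtensionStep φ φ' S M p) {s t c : K} (hs : (p.map φ).eval s = 0)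
    (ht : (p.map φ).eval t = 0) (hsc : SamePosition M s c) (htc : SamePosition M t c) : s = t := by
  have key : ∀ s t : K, (p.map φ).eval s = 0 → (p.map φ).eval t = 0 → SamePosition M s c →
      SamePosition M t c → ¬ s < t := fun s t hs ht hsc htc hst => by
    obtain ⟨x, hx, h1, h2⟩ := h.exists_between hs ht hst
    exact ((hsc x hx).2.1 h1).not_gt ((htc x hx).1.1 h2)
  exact le_antisymm (not_lt.1 (key t s ht hs htc hsc)) (not_lt.1 (key s t hs ht hsc htc))

theorem sign_derivative_eq_of_left (h : IsExtensionStep φ φ' S M p) {l c : K}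
    (hl : ∀ x ∈ M, x.1 < c → x.1 ≤ l) (hc : ∀ x ∈ M, x.1 ≠ c) {y : K} (hy : l < y) (hyc : y ≤ c) :
    sign ((p.map φ).derivative.eval y) = sign ((p.map φ).derivative.eval c) := by
  refine sign_eval_eq _ hyc fun z hz hzc h0 => ?_
  rw [derivative_map] at h0
  obtain ⟨x, hx, rfl⟩ := h.matching.exists_of_root h.derivative h.derivative_map_ne_zero h0
  exact (hl x hx (hzc.lt_of_ne (hc x hx))).not_gt (hy.trans_le hz)

theorem sign_derivative_eq_of_right (h : IsExtensionStep φ φ' S M p) {r c : K}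
    (hr : ∀ x ∈ M, c < x.1 → r ≤ x.1) (hc : ∀ x ∈ M, x.1 ≠ c) {y : K} (hy : y < r) (hyc : c ≤ y) :
    sign ((p.map φ).derivative.eval y) = sign ((p.map φ).derivative.eval c) := by
  refine (sign_eval_eq _ hyc fun z hz hzc h0 => ?_).symm
  rw [derivative_map] at h0
  obtain ⟨x, hx, rfl⟩ := h.matching.exists_of_root h.derivative h.derivative_map_ne_zero h0
  exact (hr x hx (hz.lt_of_ne (hc x hx).symm)).not_gt (hzc.trans_lt hy)

/-- A root of `p` under `φ` has a corresponding root under `φ'`: if it lies strictly between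
neighbouring points of `M`, then `p` is strictly monotone and changes its sign between them, and
the same is true under `φ'`. -/
theorem exists_root (h : IsExtensionStep φ φ' S M p) {t : K} (ht : (p.map φ).eval t = 0) :
    ∃ t', SamePosition M t t' ∧ (p.map φ').eval t' = 0 := by
  by_cases hM : ∃ x ∈ M, x.1 = t
  · obtain ⟨x, hx, rfl⟩ := hM
    refine ⟨x.2, h.matching.pairs x hx, ?_⟩
    rw [← sign_eq_zero_iff, ← h.sign_p x hx, ht, sign_zero]
  push Not at hM
  obtain ⟨s, hs⟩ := SamePosition.exists_of_pairs h.matching.pairs t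
  obtain ⟨l, l', hl, hl', hlM, hlM', hll'⟩ := hs.exists_left (fun x => sign ((p.map φ).eval x))
    (fun x => sign ((p.map φ').eval x)) h.sign_p h.sign_atBot h.matching.pairs
  obtain ⟨r, r', hr, hr', hrM, hrM', hrr'⟩ := hs.exists_right (fun x => sign ((p.map φ).eval x))
    (fun x => sign ((p.map φ').eval x)) h.sign_p h.sign_atTop h.matching.pairs
  have hd : (p.map φ).derivative.eval t ≠ 0 := fun h0 => by
    rw [derivative_map] at h0
    obtain ⟨x, hx, hxt⟩ := h.matching.exists_of_root h.derivative h.derivative_map_ne_zero h0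
    exact hM x hx hxt
  have h1 := sign_eval_sub_eval (p.map φ) hl fun x hx hxt =>
    h.sign_derivative_eq_of_left hlM hM hx hxt.le
  have h2 := sign_eval_sub_eval (p.map φ) hr fun x hx hxt =>
    h.sign_derivative_eq_of_right hrM hM hxt hx.le
  rw [ht, zero_sub, Left.sign_neg, hll'] at h1
  rw [ht, sub_zero, hrr'] at h2
  have hl0 : (p.map φ').eval l' ≠ 0 := fun h0 => by
    rw [h0, sign_zero, neg_zero, eq_comm, sign_eq_zero_iff] at h1
    exact hd h1
  have hr0 : (p.map φ').eval r' ≠ 0 := fun h0 => by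
    rw [h0, sign_zero, eq_comm, sign_eq_zero_iff] at h2
    exact hd h2
  obtain ⟨t', h3, h4, ht'⟩ : ∃ t', l' ≤ t' ∧ t' ≤ r' ∧ (p.map φ').eval t' = 0 := by
    by_contra! hcon
    have h5 := sign_eval_eq (p.map φ') (hl'.trans hr').le hcon
    rw [h5, h2] at h1
    revert h1
    rw [← sign_ne_zero] at hd
    generalize sign ((p.map φ).derivative.eval t) = σ at *
    revert hd
    cases σ <;> decide
  have h3' : l' < t' := h3.lt_of_ne (by rintro rfl; exact hl0 ht')
  have h4' : t' < r' := h4.lt_of_ne (by rintro rfl; exact hr0 ht')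
  exact ⟨t', .of_lt (fun x hx hxt => (hlM' x hx ((hs x hx).1.1 hxt)).trans_lt h3')
    (fun x hx hxt => h4'.trans_le (hrM' x hx ((hs x hx).2.1 hxt)))
    fun x hx hxt => absurd hxt (hM x hx), ht'⟩

/-- At points which are not roots, the sign of `p` is determined by the sign of `p`, or of its
derivative if `p` vanishes there, at the nearest root on the left. -/
theorem sign_eq_of_ne_zero (h : IsExtensionStep φ φ' S M p) {l c : K} (hlc : l < c)
    (hl : ∀ x ∈ M, x.1 < c → x.1 ≤ l) (hc : ∀ x ∈ M, x.1 ≠ c)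
    (hroot : ∀ x, l < x → x ≤ c → (p.map φ).eval x ≠ 0) :
    sign ((p.map φ).eval c) = if sign ((p.map φ).eval l) = 0 then
      sign ((p.map φ).derivative.eval c) else sign ((p.map φ).eval l) := by
  split_ifs with h0
  · rw [sign_eq_zero_iff] at h0
    rw [← sign_eval_sub_eval (p.map φ) hlc fun x hx hxc =>
      h.sign_derivative_eq_of_left hl hc hx hxc.le, h0, sub_zero]
  · refine (sign_eval_eq _ hlc.le fun x hx hxc h1 => ?_).symm
    rcases hx.eq_or_lt with rfl | hx
    · exact h0 (sign_eq_zero_iff.2 h1)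
    · exact hroot x hx hxc h1

theorem exists_matching (h : IsExtensionStep φ φ' S M p) :
    ∃ M', IsSignMatching φ φ' (insert p S) M' := by
  classical
  have hex : ∀ t, ∃ t', (p.map φ).eval t = 0 → SamePosition M t t' ∧ (p.map φ').eval t' = 0 :=
    fun t => by
      by_cases ht : (p.map φ).eval t = 0
      · obtain ⟨t', h1⟩ := h.exists_root ht
        exact ⟨t', fun _ => h1⟩
      · exact ⟨t, fun h => absurd h ht⟩
  choose f hf using hex
  let M' := M ∪ (p.map φ).roots.toFinset.image fun t => (t, f t)
  have hM' : ∀ x, x ∈ M' ↔ x ∈ M ∨ ∃ t, (p.map φ).eval t = 0 ∧ (t, f t) = x := by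
    intro x
    simp [M', h.map_ne_zero]
  have hlt : ∀ x ∈ M', ∀ y ∈ M', x.1 < y.1 → x.2 < y.2 := by
    intro x hx y hy hxy
    rcases (hM' x).1 hx with hx | ⟨s, hs, rfl⟩
    · rcases (hM' y).1 hy with hy | ⟨t, ht, rfl⟩
      · exact (h.matching.pairs y hy x hx).1.1 hxy
      · exact ((hf t ht).1 x hx).1.1 hxy
    · rcases (hM' y).1 hy with hy | ⟨t, ht, rfl⟩
      · exact ((hf s hs).1 y hy).2.1 hxy
      · obtain ⟨x, hx, h1, h2⟩ := h.exists_between hs ht hxy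
        exact (((hf s hs).1 x hx).2.1 h1).trans (((hf t ht).1 x hx).1.1 h2)
  have hfun : ∀ x ∈ M', ∀ y ∈ M', x.1 = y.1 → x.2 = y.2 := by
    intro x hx y hy hxy
    rcases (hM' x).1 hx with hx | ⟨s, hs, rfl⟩
    · rcases (hM' y).1 hy with hy | ⟨t, ht, rfl⟩
      · exact ((h.matching.pairs y hy).eq_iff hx).1 hxy
      · exact ((hf t ht).1.eq_iff hx).1 hxy
    · rcases (hM' y).1 hy with hy | ⟨t, ht, rfl⟩
      · exact (((hf s hs).1.eq_iff hy).1 hxy.symm).symm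
      · exact congrArg f hxy
  have hpairs : ∀ x ∈ M', SamePosition M' x.1 x.2 := fun x hx => .of_lt
    (fun y hy => hlt y hy x hx) (fun y hy => hlt x hx y hy) fun y hy => hfun y hy x hx
  have hsub : M ⊆ M' := Finset.subset_union_left
  have hsignM' : ∀ x ∈ M', sign ((p.map φ).eval x.1) = sign ((p.map φ').eval x.2) := by
    intro x hx
    rcases (hM' x).1 hx with hx | ⟨t, ht, rfl⟩
    · exact h.sign_p x hx
    · rw [ht, (hf t ht).2]
  refine ⟨M', hpairs, fun x hx => ?_, fun c c' hc q hq => ?_⟩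
  · rcases (hM' x).1 hx with hx | ⟨t, ht, rfl⟩
    · obtain ⟨q, hq, hq'⟩ := h.matching.root x hx
      exact ⟨q, Or.inr hq, hq'⟩
    · exact ⟨p, Or.inl rfl, h.map_ne_zero, ht⟩
  rcases hq with rfl | hq
  swap
  · exact h.matching.sign c c' (hc.mono hsub) q hq
  by_cases hcM : ∃ x ∈ M', x.1 = c
  · obtain ⟨x, hx, rfl⟩ := hcM
    rw [← (hc.eq_iff hx).1 rfl]
    exact hsignM' x hx
  push Not at hcM
  have hcM' : ∀ x ∈ M', x.2 ≠ c' := fun x hx h0 => hcM x hx ((hc.eq_iff hx).2 h0)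
  obtain ⟨l, l', hl, hl', hlM, hlM', hll'⟩ := hc.exists_left (fun x => sign ((q.map φ).eval x))
    (fun x => sign ((q.map φ').eval x)) hsignM' h.sign_atBot hpairs
  have h1 : ∀ x, l < x → x ≤ c → (q.map φ).eval x ≠ 0 := fun x hx hxc h0 => by
    have hx' := (hM' (x, f x)).2 (Or.inr ⟨x, h0, rfl⟩)
    exact (hlM _ hx' (hxc.lt_of_ne (hcM _ hx'))).not_gt hx
  have h2 : ∀ x, l' < x → x ≤ c' → (q.map φ').eval x ≠ 0 := fun x hx hxc h0 => by
    -- the root `x` corresponds to a root `t` on the left hand side, so that it belongs to `M'`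
    obtain ⟨t, ht, ht0⟩ := h.swap.exists_root h0
    have ht' : SamePosition M t x := by
      have := ht.swap
      rwa [Finset.image_image, Prod.swap_swap_eq, Finset.image_id] at this
    have hx' := (hM' (t, f t)).2 (Or.inr ⟨t, ht0, rfl⟩)
    have hfx : f t = x := h.swap.root_unique (c := t) (hf t ht0).2 h0 (hf t ht0).1.swap ht
    rw [hfx] at hx'
    exact (hlM' _ hx' (hxc.lt_of_ne (hcM' _ hx'))).not_gt hx
  have h3 := h.sign_eq_of_ne_zero hl (fun x hx => hlM x (hsub hx)) (fun x hx => hcM x (hsub hx)) h1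
  have h4 := h.swap.sign_eq_of_ne_zero (l := l') (c := c') hl' (fun x hx => by
    obtain ⟨y, hy, rfl⟩ := Finset.mem_image.1 hx
    exact hlM' y (hsub hy)) (fun x hx => by
    obtain ⟨y, hy, rfl⟩ := Finset.mem_image.1 hx
    exact hcM' y (hsub hy)) h2
  have h5 := h.matching.sign c c' (hc.mono hsub) _ h.derivative
  have hll'' : sign ((q.map φ).eval l) = sign ((q.map φ').eval l') := hll'
  rw [h3, h4, hll'', derivative_map, derivative_map, h5]

end IsExtensionStep

end

/-! ### Semialgebraic sets and quantifier elimination over real closed fields -/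

section

open Polynomial SignType

/-- A finite set `A` has a finite superset closed under a partial binary operation whose values have
smaller degree than its second argument, where the operation need only be defined if this degree is
positive and at most that of the first argument. -/
theorem exists_finset_closed {α : Type*} (deg : α → ℕ) (op : α → α → Finset α)
    (hop : ∀ x y, 0 < deg y → ∀ z ∈ op x y, deg z < deg y) (A : Finset α) :
    ∃ A' : Finset α, A ⊆ A' ∧ ∀ x ∈ A', ∀ y ∈ A', 0 < deg y → deg y ≤ deg x → op x y ⊆ A' := by
  classical
  suffices h : ∀ (k : ℕ) (A : Finset α),
      (∀ x ∈ A, ∀ y ∈ A, k ≤ deg y → 0 < deg y → deg y ≤ deg x → op x y ⊆ A) →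
      ∃ A' : Finset α, A ⊆ A' ∧ ∀ x ∈ A', ∀ y ∈ A', 0 < deg y → deg y ≤ deg x → op x y ⊆ A' from
    h (A.sup deg + 1) A fun x _ y hy hle => absurd (Finset.le_sup (f := deg) hy) (by omega)
  intro k
  induction k with
  | zero => exact fun A hA => ⟨A, subset_rfl, fun x hx y hy => hA x hx y hy (Nat.zero_le _)⟩
  | succ k ih =>
    intro A hA
    let P := (A ×ˢ A).filter fun xy => deg xy.2 = k ∧ 0 < deg xy.2
    obtain ⟨A', h1, h2⟩ := ih (A ∪ P.biUnion fun xy => op xy.1 xy.2) (by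
      have hmem : ∀ z ∈ A ∪ P.biUnion fun xy => op xy.1 xy.2, k ≤ deg z → z ∈ A := by
        intro z hz hk
        rcases Finset.mem_union.1 hz with hz | hz
        · exact hz
        · obtain ⟨xy, hxy, hz⟩ := Finset.mem_biUnion.1 hz
          have h1 := (Finset.mem_filter.1 hxy).2
          have h2 := hop _ _ h1.2 z hz
          omega
      intro x hx y hy hk h0 hle
      have hx' := hmem x hx (hk.trans hle)
      have hy' := hmem y hy hk
      rcases hk.eq_or_lt with hk | hk
      · refine Finset.Subset.trans (fun z hz => ?_) Finset.subset_union_right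
        exact Finset.mem_biUnion.2 ⟨(x, y), Finset.mem_filter.2
          ⟨Finset.mem_product.2 ⟨hx', hy'⟩, hk.symm, h0⟩, hz⟩
      · exact (hA x hx' y hy' hk h0 hle).trans Finset.subset_union_left)
    exact ⟨A', Finset.subset_union_left.trans h1, h2⟩

/-- The families of polynomials which determine their sign tables: they are closed under derivatives,
omission of leading terms and remainders. -/
def IsClosedFamily {R : Type*} [CommRing R] (S : Set R[X]) : Prop :=
  ∀ y ∈ S, 0 < y.natDegree → derivative y ∈ S ∧ y.eraseLead ∈ S ∧
    ∀ x ∈ S, y.natDegree ≤ x.natDegree → ∃ r ∈ S, r.natDegree < y.natDegree ∧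
      ∃ (e : ℕ) (h : R[X]), C (y.leadingCoeff ^ e) * x = h * y + r

theorem exists_isClosedFamily {R : Type*} [CommRing R] [IsDomain R] [CharZero R] (A : Finset R[X]) :
    ∃ A' : Finset R[X], A ⊆ A' ∧ IsClosedFamily (A' : Set R[X]) := by
  classical
  have hrem : ∀ x y : R[X], ∃ r : R[X], 0 < y.natDegree → r.natDegree < y.natDegree ∧
      ∃ (e : ℕ) (h : R[X]), C (y.leadingCoeff ^ e) * x = h * y + r := fun x y => by
    by_cases hy : 0 < y.natDegree
    · obtain ⟨e, h, r, hr, heq⟩ := exists_pseudo_rem hy _ x le_rfl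
      exact ⟨r, fun _ => ⟨hr, e, h, heq⟩⟩
    · exact ⟨0, fun h => absurd h hy⟩
  choose rem hrem using hrem
  obtain ⟨A', h1, h2⟩ := exists_finset_closed natDegree
    (fun x y => {derivative y, y.eraseLead, rem x y}) (by
      intro x y hy z hz
      simp only [Finset.mem_insert, Finset.mem_singleton] at hz
      rcases hz with rfl | rfl | rfl
      · exact natDegree_derivative_lt hy.ne'
      · exact (eraseLead_natDegree_le _).trans_lt (by omega)
      · exact (hrem x y hy).1) A
  refine ⟨A', h1, fun y hy hpos => ?_⟩
  have hy' := h2 y hy y hy hpos le_rfl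
  refine ⟨hy' (by simp), hy' (by simp), fun x hx hle => ?_⟩
  exact ⟨rem x y, h2 x hx y hy hpos hle (by simp), hrem x y hpos⟩

theorem IsClosedFamily.of_insert {R : Type*} [CommRing R] {S : Set R[X]} {a : R[X]}
    (h : IsClosedFamily (insert a S)) (hS : ∀ x ∈ S, x.natDegree ≤ a.natDegree) :
    IsClosedFamily S := by
  have hmem : ∀ z ∈ insert a S, z.natDegree < a.natDegree → z ∈ S := by
    rintro z (rfl | hz) hlt
    · exact absurd hlt (lt_irrefl _)
    · exact hz
  intro y hy hpos
  have hya := hS y hy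
  obtain ⟨h1, h2, h3⟩ := h y (Or.inr hy) hpos
  refine ⟨hmem _ h1 ((natDegree_derivative_lt hpos.ne').trans_le hya),
    hmem _ h2 ((eraseLead_natDegree_le _).trans_lt (by omega)), fun x hx hle => ?_⟩
  obtain ⟨r, hr, hry, h4⟩ := h3 x (Or.inr hx) hle
  exact ⟨r, hmem r hr (hry.trans_le hya), hry, h4⟩

theorem sign_eq_of_map_natDegree_eq_zero {R : Type*} [CommRing R] {K : Type u} [Field K]
    [LinearOrder K] {φ φ' : R →+* K} {p : R[X]} (hp : p.natDegree = 0)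
    (h : sign (φ (p.coeff 0)) = sign (φ' (p.coeff 0))) (c c' : K) :
    sign ((p.map φ).eval c) = sign ((p.map φ').eval c') := by
  rw [eq_C_of_natDegree_le_zero hp.le, map_C, map_C, eval_C, eval_C]
  exact h

/-- If the coefficients of the polynomials of a closed family have the same signs under two
homomorphisms, then so have the polynomials, up to a matching of their roots. -/
theorem exists_isSignMatching {R : Type*} [CommRing R] {K : Type u} [Field K]
    [LinearOrder K] [IsStrictOrderedRing K] [IsRealClosed K] {φ φ' : R →+* K} (A : Finset R[X]) :
    IsClosedFamily (A : Set R[X]) → SameSigns φ φ' (A : Set R[X]) →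
      ∃ M, IsSignMatching φ φ' (A : Set R[X]) M := by
  classical
  refine Finset.induction_on_max_value natDegree A ?_ ?_
  · exact fun _ _ => ⟨∅, by simp, by simp, by simp⟩
  · intro p s hp hmax ih hcl hsig
    rw [Finset.coe_insert] at hcl hsig ⊢
    have hcl' := hcl.of_insert hmax
    have hsig' : SameSigns φ φ' (s : Set R[X]) := fun q hq => hsig q (Or.inr hq)
    have hsigp := hsig p (Or.inl rfl)
    obtain ⟨M, hM⟩ := ih hcl' hsig'
    have hsame : (∀ c c', SamePosition M c c' →
        sign ((p.map φ).eval c) = sign ((p.map φ').eval c')) →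
        ∃ M, IsSignMatching φ φ' (insert p (s : Set R[X])) M := fun h => by
      refine ⟨M, hM.pairs, fun x hx => ?_, ?_⟩
      · obtain ⟨q, hq, h⟩ := hM.root x hx
        exact ⟨q, Or.inr hq, h⟩
      · rintro c c' hc q (rfl | hq)
        · exact h c c' hc
        · exact hM.sign c c' hc q hq
    by_cases hdeg : p.natDegree = 0
    · exact hsame fun c c' _ => sign_eq_of_map_natDegree_eq_zero hdeg (hsigp 0) c c'
    have hpos := Nat.pos_of_ne_zero hdeg
    obtain ⟨h1, h2, -⟩ := hcl p (Or.inl rfl) hpos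
    have hlt : ∀ z ∈ insert p (s : Set R[X]), z.natDegree < p.natDegree → z ∈ (s : Set R[X]) := by
      rintro z (rfl | hz) hlt
      · exact absurd hlt (lt_irrefl _)
      · exact hz
    by_cases hlead : φ p.leadingCoeff = 0
    · refine hsame fun c c' hc => ?_
      rw [← map_eraseLead_of_eq_zero hlead,
        ← map_eraseLead_of_eq_zero ((hsig.eq_zero_iff (Or.inl rfl) _).1 hlead)]
      exact hM.sign c c' hc _ (hlt _ h2 ((eraseLead_natDegree_le _).trans_lt (by omega)))
    refine IsExtensionStep.exists_matching ⟨hM, hsig', hsigp, hpos, hlead,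
      hlt _ h1 (natDegree_derivative_lt hdeg), fun x hx => ?_⟩
    obtain ⟨q, hq, hq0, hqx⟩ := hM.root x hx
    obtain ⟨q₀, h3, h4, h5, h6, h7⟩ := exists_leadingCoeff_ne_zero hsig'
      (fun q hq hpos => (hcl' q hq hpos).2.1) _ q hq le_rfl hq0
    have hq₀x : (q₀.map φ).eval x.1 = 0 := h6 ▸ hqx
    have hq₀x' : (q₀.map φ').eval x.2 = 0 := by
      rw [← sign_eq_zero_iff, ← hM.sign _ _ (hM.pairs x hx) _ h3, hq₀x, sign_zero]
    have hq₀pos : 0 < q₀.natDegree := by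
      refine Nat.pos_of_ne_zero fun h => h5 ?_
      rw [eq_C_of_natDegree_le_zero h.le, map_C, eval_C] at hq₀x
      rw [leadingCoeff, h, hq₀x]
    obtain ⟨r, hr, hrq, e, g, heq⟩ := (hcl q₀ (Or.inr h3) hq₀pos).2.2 p (Or.inl rfl)
      (hmax q₀ h3)
    have hr' := hM.sign _ _ (hM.pairs x hx) r (hlt r hr (hrq.trans_le (hmax q₀ h3)))
    have h8 := congrArg (fun f : R[X] => (f.map φ).eval x.1) heq
    have h9 := congrArg (fun f : R[X] => (f.map φ').eval x.2) heq
    simp only [Polynomial.map_mul, Polynomial.map_add, map_C, eval_mul, eval_add, eval_C, hq₀x, hq₀x',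
      mul_zero, zero_add, map_pow, Polynomial.map_pow, eval_pow] at h8 h9
    rw [← h8, ← h9, sign_mul, sign_mul, sign_pow, sign_pow, leadingCoeff, hsig' q₀ h3] at hr'
    refine mul_left_cancel₀ (pow_ne_zero e ?_) hr'
    rw [← hsig' q₀ h3, sign_ne_zero]
    exact h5

end

section

open SignType

theorem eval_map_optionEquivLeft {K : Type u} [Field K] {α : Type} (v : α → K) (c : K)
    (q : MvPolynomial (Option α) K) :
    ((MvPolynomial.optionEquivLeft K α q).map (MvPolynomial.eval v)).eval c =
      MvPolynomial.eval (fun o : Option α => o.elim c v) q := by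
  induction q using MvPolynomial.induction_on with
  | C a => simp
  | add p q hp hq => simp [hp, hq]
  | mul_X p o hp =>
    cases o <;> simp [hp]

variable {K : Type u} [Field K] [LinearOrder K] {α : Type}

/-- The points `v` and `w` satisfy the same sign conditions on the polynomials in `Q`. -/
def SameSignsOn (Q : Finset (MvPolynomial α K)) (v w : α → K) : Prop :=
  ∀ q ∈ Q, sign (MvPolynomial.eval v q) = sign (MvPolynomial.eval w q)

/-- Semialgebraic sets: those which are determined by sign conditions on finitely many
polynomials. -/
def IsSemialgebraic (S : Set (α → K)) : Prop :=
  ∃ Q : Finset (MvPolynomial α K), ∀ v w, SameSignsOn Q v w → v ∈ S → w ∈ S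

/-- The elimination of one quantifier. -/
theorem exists_sameSignsOn [IsStrictOrderedRing K] [IsRealClosed K]
    (Q : Finset (MvPolynomial (Option α) K)) :
    ∃ Q' : Finset (MvPolynomial α K), ∀ v w, SameSignsOn Q' v w → ∀ c, ∃ d,
      SameSignsOn Q (fun o : Option α => o.elim c v) (fun o : Option α => o.elim d w) := by
  classical
  obtain ⟨A, hA, hcl⟩ := exists_isClosedFamily (Q.image (MvPolynomial.optionEquivLeft K α))
  refine ⟨A.biUnion fun p => (Finset.range (p.natDegree + 1)).image p.coeff, fun v w hvw c => ?_⟩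
  obtain ⟨M, hM⟩ := exists_isSignMatching (φ := MvPolynomial.eval v) (φ' := MvPolynomial.eval w) A hcl
    fun q hq n => by
      rcases lt_or_ge q.natDegree n with h | h
      · rw [Polynomial.coeff_eq_zero_of_natDegree_lt h, map_zero (MvPolynomial.eval v),
          map_zero (MvPolynomial.eval w)]
      · exact hvw _ (Finset.mem_biUnion.2 ⟨q, hq, Finset.mem_image_of_mem _ (by simpa using by omega)⟩)
  obtain ⟨d, hd⟩ := SamePosition.exists_of_pairs hM.pairs c
  refine ⟨d, fun q hq => ?_⟩
  rw [← eval_map_optionEquivLeft, ← eval_map_optionEquivLeft]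
  exact hM.sign c d hd _ (hA (Finset.mem_image_of_mem _ hq))

/-- The Tarski–Seidenberg theorem. -/
theorem PolyDef.isSemialgebraic [IsStrictOrderedRing K] [IsRealClosed K] {S : Set (α → K)}
    (hS : PolyDef K S) : IsSemialgebraic S := by
  classical
  induction hS with
  | zero p =>
    refine ⟨{p}, fun v w h hv => ?_⟩
    have := h p (Finset.mem_singleton_self p)
    rwa [show MvPolynomial.eval v p = 0 from hv, sign_zero, eq_comm, sign_eq_zero_iff] at this
  | compl _ ih =>
    obtain ⟨Q, hQ⟩ := ih
    exact ⟨Q, fun v w h hv hw => hv (hQ w v (fun q hq => (h q hq).symm) hw)⟩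
  | inter _ _ ih1 ih2 =>
    obtain ⟨Q1, h1⟩ := ih1
    obtain ⟨Q2, h2⟩ := ih2
    exact ⟨Q1 ∪ Q2, fun v w h hv =>
      ⟨h1 v w (fun q hq => h q (Finset.mem_union_left _ hq)) hv.1,
        h2 v w (fun q hq => h q (Finset.mem_union_right _ hq)) hv.2⟩⟩
  | ex _ ih =>
    obtain ⟨Q, hQ⟩ := ih
    obtain ⟨Q', hQ'⟩ := exists_sameSignsOn Q
    refine ⟨Q', fun v w h => ?_⟩
    rintro ⟨c, hc⟩
    obtain ⟨d, hd⟩ := hQ' v w h c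
    exact ⟨d, hQ _ _ hd hc⟩

/-- An isolated point of a fibre of a semialgebraic set is a root of one of finitely many
polynomials. -/
theorem IsSemialgebraic.exists_root [IsStrictOrderedRing K] [IsRealClosed K]
    {S : Set (Option α → K)} (hS : IsSemialgebraic S) :
    ∃ Q : Finset (Polynomial (MvPolynomial α K)), ∀ (v : α → K) (c : K),
      (∀ d, (fun o : Option α => o.elim d v) ∈ S ↔ d = c) →
      ∃ q ∈ Q, q.map (MvPolynomial.eval v) ≠ 0 ∧ (q.map (MvPolynomial.eval v)).eval c = 0 := by
  classical
  obtain ⟨Q, hQ⟩ := hS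
  refine ⟨Q.image (MvPolynomial.optionEquivLeft K α), fun v c hc => ?_⟩
  by_contra! hcon
  let P : MvPolynomial (Option α) K → Polynomial K := fun q =>
    (MvPolynomial.optionEquivLeft K α q).map (MvPolynomial.eval v)
  obtain ⟨d, h1, h2⟩ := Order.exists_between_finsets {c}
    ((Q.biUnion fun q => (P q).roots.toFinset).filter fun x => c < x) (by
      intro a ha b hb
      rw [Finset.mem_singleton.1 ha]
      exact (Finset.mem_filter.1 hb).2)
  have hcd := h1 c (Finset.mem_singleton_self c)
  refine hcd.ne' ((hc d).1 (hQ _ _ (fun q hq => ?_) ((hc c).2 rfl)))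
  rw [← eval_map_optionEquivLeft, ← eval_map_optionEquivLeft]
  by_cases hq0 : P q = 0
  · change sign ((P q).eval c) = sign ((P q).eval d)
    rw [hq0, Polynomial.eval_zero, Polynomial.eval_zero]
  · refine sign_eval_eq (P q) hcd.le fun x hx hxd h0 => ?_
    rcases hx.eq_or_lt with rfl | hx
    · exact hcon _ (Finset.mem_image_of_mem _ hq) hq0 h0
    · refine hxd.not_gt (h2 x (Finset.mem_filter.2 ⟨Finset.mem_biUnion.2 ⟨q, hq, ?_⟩, hx⟩))
      rw [Multiset.mem_toFinset, Polynomial.mem_roots hq0]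
      exact h0

end

/-! ### Zero patterns of polynomials -/

section

open MvPolynomial

variable {K : Type u} [Field K]

theorem card_le_of_linearIndependent_of_degreeOf_le {n m : ℕ} {ι : Type*} [Fintype ι]
    {g : ι → MvPolynomial (Fin n) K} (hg : LinearIndependent K g)
    (hm : ∀ i j, degreeOf j (g i) ≤ m) : Fintype.card ι ≤ (m + 1) ^ n := by
  let L : MvPolynomial (Fin n) K →ₗ[K] ((Fin n → Fin (m + 1)) → K) := LinearMap.pi fun e =>
    lcoeff K (Finsupp.equivFunOnFinite.symm fun i => (e i : ℕ))
  have hL : ∀ p : MvPolynomial (Fin n) K, (∀ j, degreeOf j p ≤ m) → L p = 0 → p = 0 := by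
    intro p hp h0
    ext s
    by_contra hs
    rw [coeff_zero] at hs
    have h1 : ∀ j, s j < m + 1 := fun j => Nat.lt_succ_of_le
      ((monomial_le_degreeOf j (mem_support_iff.2 hs)).trans (hp j))
    have h2 := congrFun h0 fun j => ⟨s j, h1 j⟩
    refine hs ?_
    convert! h2 using 1
    change coeff s p = coeff (Finsupp.equivFunOnFinite.symm fun i => s i) p
    congr 1
    ext; simp
  have hLg : LinearIndependent K (L ∘ g) := by
    rw [Fintype.linearIndependent_iff] at hg ⊢
    intro c hc
    refine hg c (hL _ (fun j => ?_) (by simpa [map_sum] using! hc))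
    refine (degreeOf_sum_le j _ _).trans (Finset.sup_le fun i _ => ?_)
    rw [smul_eq_C_mul]
    exact (degreeOf_C_mul_le _ _ _).trans (hm i j)
  have := hLg.fintype_card_le_finrank
  simpa using this

/-- The number of zero patterns of finitely many polynomials in `n` variables: for each pattern, the
product of the polynomials which do not vanish is a polynomial, and these products are linearly
independent. -/
theorem card_image_filter_eval_ne_zero_le {n D : ℕ} {ι β : Type*} [DecidableEq ι] [DecidableEq K]
    (s : Finset ι) (F : ι → MvPolynomial (Fin n) K) (hF : ∀ i ∈ s, (F i).totalDegree ≤ D)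
    (G : Finset β) (y : β → Fin n → K) :
    (G.image fun b => s.filter fun i => eval (y b) (F i) ≠ 0).card ≤ (s.card * D + 1) ^ n := by
  classical
  let Z : β → Finset ι := fun b => s.filter fun i => eval (y b) (F i) ≠ 0
  have hrep : ∀ z : G.image Z, ∃ b, Z b = z.1 := fun z => by
    obtain ⟨b, -, hb⟩ := Finset.mem_image.1 z.2
    exact ⟨b, hb⟩
  choose b hb using hrep
  let g : G.image Z → MvPolynomial (Fin n) K := fun z => ∏ i ∈ z.1, F i
  have hg : ∀ z z' : G.image Z, eval (y (b z')) (g z) ≠ 0 → z.1 ⊆ z'.1 := fun z z' h i hi => by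
    rw [map_prod, Finset.prod_ne_zero_iff] at h
    rw [← hb z', Finset.mem_filter]
    refine ⟨?_, h i hi⟩
    rw [← hb z] at hi
    exact Finset.mem_of_mem_filter i hi
  have hgz : ∀ z : G.image Z, eval (y (b z)) (g z) ≠ 0 := fun z => by
    rw [map_prod, Finset.prod_ne_zero_iff]
    intro i hi
    rw [← hb z] at hi
    exact (Finset.mem_filter.1 hi).2
  have hind : LinearIndependent K g := by
    rw [Fintype.linearIndependent_iff]
    intro c hc
    by_contra! hcon
    -- a relation is refuted by evaluation at a point of a minimal pattern occurring in it
    obtain ⟨z, hz, hmin⟩ := Finset.exists_min_image (Finset.univ.filter fun z => c z ≠ 0)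
      (fun z => z.1.card) (by
        obtain ⟨z, hz⟩ := hcon
        exact ⟨z, Finset.mem_filter.2 ⟨Finset.mem_univ _, hz⟩⟩)
    have h1 := congrArg (eval (y (b z))) hc
    rw [map_sum, map_zero, Finset.sum_eq_single z] at h1
    · rw [smul_eval] at h1
      exact mul_ne_zero (Finset.mem_filter.1 hz).2 (hgz z) h1
    · intro z' _ hzz'
      rw [smul_eval]
      by_contra h
      have h2 := hg z' z (right_ne_zero_of_mul h)
      exact hzz' (Subtype.ext (Finset.eq_of_subset_of_card_le h2
        (hmin z' (Finset.mem_filter.2 ⟨Finset.mem_univ _, left_ne_zero_of_mul h⟩))))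
    · exact fun h => absurd (Finset.mem_univ z) h
  have hdeg : ∀ z j, degreeOf j (g z) ≤ s.card * D := fun z j => by
    have hzs : z.1 ⊆ s := by
      rw [← hb z]
      exact Finset.filter_subset _ _
    calc degreeOf j (g z) ≤ ∑ i ∈ z.1, degreeOf j (F i) := degreeOf_prod_le j _ _
      _ ≤ ∑ i ∈ z.1, D := Finset.sum_le_sum fun i hi =>
        (degreeOf_le_totalDegree _ _).trans (hF i (hzs hi))
      _ = z.1.card * D := by rw [Finset.sum_const, smul_eq_mul]
      _ ≤ s.card * D := Nat.mul_le_mul_right _ (Finset.card_le_card hzs)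
  have := card_le_of_linearIndependent_of_degreeOf_le hind hdeg
  rwa [Fintype.card_coe] at this

theorem eval_eval_C {n : ℕ} (q : Polynomial (MvPolynomial (Fin n) K)) (a : K) (y : Fin n → K) :
    eval y (q.eval (C a)) = (q.map (eval y)).eval a := by
  rw [Polynomial.eval_map, ← Polynomial.eval₂_hom, eval_C]

theorem totalDegree_eval_C_le {n : ℕ} (q : Polynomial (MvPolynomial (Fin n) K)) (a : K) :
    (q.eval (C a)).totalDegree ≤ q.support.sup fun j => (q.coeff j).totalDegree := by
  rw [Polynomial.eval_eq_sum, Polynomial.sum_def]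
  refine (totalDegree_finsetSum _ _).trans (Finset.sup_mono_fun fun j _ => ?_)
  refine (totalDegree_mul _ _).trans ?_
  rw [← C_pow, totalDegree_C, add_zero]

/-- If the coordinates of `u` are roots of polynomials, from a finite set, whose coefficients are
evaluated at `f u`, then `f` maps large cubes of dimension `d` to a space of dimension at least
`d`. Indeed, a point `u` of a cube is determined, up to boundedly many possibilities, by the zero
pattern at `f u` of the polynomials with the coordinates substituted. -/
theorem le_of_forall_exists_root {d n : ℕ} (Q : Finset (Polynomial (MvPolynomial (Fin n) K)))
    (U : Set (Fin d → K)) (hU : ∀ N : ℕ, ∃ A : Fin d → Finset K, (∀ i, (A i).card = N) ∧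
      ∀ u : Fin d → K, (∀ i, u i ∈ A i) → u ∈ U) (f : (Fin d → K) → Fin n → K)
    (hf : ∀ u ∈ U, ∀ i, ∃ q ∈ Q, q.map (eval (f u)) ≠ 0 ∧ (q.map (eval (f u))).eval (u i) = 0) :
    d ≤ n := by
  classical
  by_contra! hdn
  let D := Q.sup fun q => q.support.sup fun j => (q.coeff j).totalDegree
  let E := Q.sup Polynomial.natDegree
  let c := (Q.card * E) ^ d
  let c' := (d * Q.card * D + 1) ^ n
  let N := c * c' + E + 1
  obtain ⟨A, hA, hAU⟩ := hU N
  let T := Finset.univ.biUnion A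
  have hTcard : T.card ≤ d * N := by
    refine Finset.card_biUnion_le.trans ?_
    simp [hA]
  let G := Fintype.piFinset A
  have hGU : ∀ u ∈ G, u ∈ U := fun u hu => hAU u (Fintype.mem_piFinset.1 hu)
  have hGcard : G.card = N ^ d := by simp [G, Fintype.card_piFinset, hA]
  let F : K × Polynomial (MvPolynomial (Fin n) K) → MvPolynomial (Fin n) K := fun x => x.2.eval (C x.1)
  let Z : (Fin d → K) → Finset (K × Polynomial (MvPolynomial (Fin n) K)) := fun u =>
    (T ×ˢ Q).filter fun x => eval (f u) (F x) ≠ 0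
  have hpat : (G.image Z).card ≤ ((T ×ˢ Q).card * D + 1) ^ n := by
    refine card_image_filter_eval_ne_zero_le (T ×ˢ Q) F (fun x hx => ?_) G f
    exact (totalDegree_eval_C_le _ _).trans (Finset.le_sup
      (f := fun q : Polynomial (MvPolynomial (Fin n) K) => q.support.sup fun j => (q.coeff j).totalDegree)
      (Finset.mem_product.1 hx).2)
  have hE : ∀ q ∈ Q, ∀ y : Fin n → K, (q.map (eval y)).natDegree ≤ E := fun q hq y =>
    Polynomial.natDegree_map_le.trans (Finset.le_sup (f := Polynomial.natDegree) hq)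
  have hfib : ∀ z ∈ G.image Z, (G.filter fun u => Z u = z).card ≤ c := by
    intro z hz
    obtain ⟨u₀, hu₀, rfl⟩ := Finset.mem_image.1 hz
    let W := Q.biUnion fun q => (q.map (eval (f u₀))).roots.toFinset
    have hW : W.card ≤ Q.card * E := by
      refine Finset.card_biUnion_le_card_mul _ _ _ fun q hq => ?_
      exact (Multiset.toFinset_card_le _).trans ((Polynomial.card_roots' _).trans (hE q hq _))
    have hsub : (G.filter fun u => Z u = Z u₀) ⊆ Fintype.piFinset fun _ => W := by
      intro u hu
      obtain ⟨huG, hu⟩ := Finset.mem_filter.1 hu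
      refine Fintype.mem_piFinset.2 fun i => ?_
      obtain ⟨q, hq, hq0, hqu⟩ := hf u (hGU u huG) i
      have hmem : ∀ a ∈ T, (q.map (eval (f u))).eval a = 0 ↔ (q.map (eval (f u₀))).eval a = 0 := by
        intro a ha
        have h1 : (a, q) ∈ Z u ↔ (a, q) ∈ Z u₀ := by rw [hu]
        simp only [Z, F, Finset.mem_filter, Finset.mem_product, ha, hq, true_and, eval_eval_C] at h1
        exact not_iff_not.1 h1
      have hAT : A i ⊆ T := Finset.subset_biUnion_of_mem A (Finset.mem_univ i)
      have huT : u i ∈ T := hAT (Fintype.mem_piFinset.1 huG i)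
      -- the cube is so large that the patterns detect which of the polynomials vanish identically
      have hq0' : q.map (eval (f u₀)) ≠ 0 := by
        intro h0
        refine hq0 (Polynomial.eq_zero_of_natDegree_lt_card_of_eval_eq_zero' _ (A i)
          (fun a ha => (hmem a (hAT ha)).2 (by rw [h0, Polynomial.eval_zero])) ?_)
        rw [hA]
        have := hE q hq (f u)
        omega
      refine Finset.mem_biUnion.2 ⟨q, hq, ?_⟩
      rw [Multiset.mem_toFinset, Polynomial.mem_roots hq0']
      exact (hmem _ huT).1 hqu
    refine (Finset.card_le_card hsub).trans ?_
    rw [Fintype.card_piFinset, Finset.prod_const, Finset.card_univ, Fintype.card_fin]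
    exact Nat.pow_le_pow_left hW d
  have hN : 0 < N := Nat.succ_pos _
  have hcount : N ^ (n + 1) ≤ c * c' * N ^ n :=
    calc N ^ (n + 1) ≤ N ^ d := Nat.pow_le_pow_right hN hdn
      _ ≤ c * (G.image Z).card := hGcard ▸ Finset.card_le_mul_card_image G c hfib
      _ ≤ c * ((T ×ˢ Q).card * D + 1) ^ n := Nat.mul_le_mul_left _ hpat
      _ ≤ c * ((d * Q.card * D + 1) * N) ^ n := by
        refine Nat.mul_le_mul_left _ (Nat.pow_le_pow_left ?_ n)
        rw [Finset.card_product]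
        have := Nat.mul_le_mul_right (Q.card * D) hTcard
        nlinarith
      _ = c * c' * N ^ n := by rw [mul_pow, ← mul_assoc]
  rw [pow_succ', Nat.mul_le_mul_right_iff (pow_pos hN n)] at hcount
  omega

end

/-! ### The dimension of sets definable in a real closed field -/

section

variable {K : Type u} [Field K] [LinearOrder K]

theorem topDimGE_zero {n : ℕ} {Y : Set (Fin n → K)} (hY : Y.Nonempty) : TopDimGE Y 0 := by
  let _ : TopologicalSpace K := Preorder.topology K
  obtain ⟨y, hy⟩ := hY
  refine ⟨Set.univ, ⟨0, trivial⟩, isOpen_univ, PolyDef.univ.fieldDefinable, fun _ => ⟨y, hy⟩,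
    fun u u' _ => Subsingleton.elim _ _, ?_⟩
  rw [fieldDefinable_iff_polyDef]
  convert! PolyDef.iInter (K := K) fun i : Fin n => PolyDef.eqPoly
    (MvPolynomial.X (Sum.inr i : Fin 0 ⊕ Fin n)) (MvPolynomial.C (y i)) using 1
  ext z
  simp only [Set.mem_ofPred_eq, Set.mem_iInter, MvPolynomial.eval_X, MvPolynomial.eval_C]
  constructor
  · rintro ⟨u, rfl⟩ i
    rfl
  · intro h
    refine ⟨⟨z ∘ Sum.inl, trivial⟩, funext fun x => ?_⟩
    rcases x with x | x
    · rfl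
    · exact h x

variable [IsStrictOrderedRing K]

theorem exists_finset_subset_of_isOpen {d : ℕ} [TopologicalSpace K] [OrderTopology K]
    {U : Set (Fin d → K)} (hU : IsOpen U) (hne : U.Nonempty) (N : ℕ) :
    ∃ A : Fin d → Finset K, (∀ i, (A i).card = N) ∧ ∀ u : Fin d → K, (∀ i, u i ∈ A i) → u ∈ U := by
  obtain ⟨u, hu⟩ := hne
  obtain ⟨I, V, hV, hVU⟩ := isOpen_pi_iff.1 hU u hu
  have h1 : ∀ i, ∃ A : Finset K, A.card = N ∧ ∀ x ∈ A, i ∈ I → x ∈ V i := fun i => by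
    by_cases hi : i ∈ I
    · obtain ⟨a, b, hab, hsub⟩ := mem_nhds_iff_exists_Ioo_subset.1 ((hV i hi).1.mem_nhds (hV i hi).2)
      obtain ⟨A, hA, hAN⟩ := (Set.Ioo_infinite (hab.1.trans hab.2)).exists_subset_card_eq N
      exact ⟨A, hAN, fun x hx _ => hsub (hA hx)⟩
    · obtain ⟨A, -, hAN⟩ := (Set.infinite_univ (α := K)).exists_subset_card_eq N
      exact ⟨A, hAN, fun x _ h => absurd h hi⟩
  choose A hA hAV using h1
  exact ⟨A, hA, fun w hw => hVU fun i hi => hAV i _ (hw i) hi⟩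

/-- Definable open sets of dimension `d` do not embed definably into spaces of smaller dimension. -/
theorem TopDimGE.le [IsRealClosed K] {n : ℕ} {Y : Set (Fin n → K)} {d : ℕ} (h : TopDimGE Y d) :
    d ≤ n := by
  classical
  let _ : TopologicalSpace K := Preorder.topology K
  have : OrderTopology K := ⟨rfl⟩
  obtain ⟨U, hne, hU, -, f, hf, hdef⟩ := h
  rw [fieldDefinable_iff_polyDef] at hdef
  let g : (Fin d → K) → Fin n → K := fun u => if hu : u ∈ U then (f ⟨u, hu⟩).1 else 0
  have hg : ∀ u (hu : u ∈ U), g u = (f ⟨u, hu⟩).1 := fun u hu => dif_pos hu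
  -- the `i`-th coordinate is a definable function of the image under the embedding
  have hcoord : ∀ i : Fin d, PolyDef K {w : Option (Fin n) → K |
      ∃ u ∈ U, w = fun o => o.elim (u i) (g u)} := fun i => by
    have h1 := hdef.preimage (β := Fin d ⊕ Option (Fin n)) (Sum.map id some)
    have h2 := PolyDef.eqPoly (K := K) (MvPolynomial.X (Sum.inr none : Fin d ⊕ Option (Fin n)))
      (MvPolynomial.X (Sum.inl i))
    convert! (h1.inter h2).exFinite using 1
    ext w
    simp only [Set.mem_ofPred_eq, Set.mem_inter_iff, MvPolynomial.eval_X]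
    constructor
    · rintro ⟨u, hu, rfl⟩
      refine ⟨u, ⟨⟨u, hu⟩, ?_⟩, rfl⟩
      funext x
      rcases x with x | x
      · rfl
      · exact congrFun (hg u hu) x
    · rintro ⟨u, ⟨u', hu'⟩, hwi⟩
      have h3 : u = u'.1 := funext fun x => congrFun hu' (Sum.inl x)
      subst h3
      refine ⟨u'.1, u'.2, funext fun o => ?_⟩
      cases o with
      | none => exact hwi
      | some a => exact (congrFun hu' (Sum.inr a)).trans (congrFun (hg _ u'.2) a).symm
  choose Q hQ using fun i => (hcoord i).isSemialgebraic.exists_root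
  refine le_of_forall_exists_root (Finset.univ.biUnion Q) U
    (exists_finset_subset_of_isOpen hU hne) g fun u hu i => ?_
  obtain ⟨q, hq, h1⟩ := hQ i (g u) (u i) fun c => by
    constructor
    · rintro ⟨u', hu', h⟩
      have h1 : g u = g u' := funext fun a => congrFun h (some a)
      rw [hg u hu, hg u' hu'] at h1
      have h2 : u = u' := congrArg Subtype.val (hf (Subtype.ext h1))
      exact (congrFun h none).trans (by rw [h2]; rfl)
    · rintro rfl
      exact ⟨u, hu, rfl⟩
  exact ⟨q, Finset.mem_biUnion.2 ⟨i, Finset.mem_univ i, hq⟩, h1⟩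

theorem exists_isGreatest_topDimGE [IsRealClosed K] {n : ℕ} {Y : Set (Fin n → K)}
    (hY : Y.Nonempty) : ∃ d, IsGreatest {d | TopDimGE Y d} d :=
  ⟨_, Nat.sSup_mem ⟨0, topDimGE_zero hY⟩ ⟨n, fun _ hd => TopDimGE.le hd⟩,
    fun _ hd => le_csSup ⟨n, fun _ hd => TopDimGE.le hd⟩ hd⟩

end

/-! ### Definable fields in models -/

section

variable {K : Type u} {V : Type v} [Field K] [AddCommGroup V] [Module K V]
  {B : LinearMap.BilinForm K V}

theorem IsHomogeneous.restrict {R : Set ℕ} (hB : IsHomogeneous B R) (N : Submodule K V)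
    [FiniteDimensional K N] : IsHomogeneous (B.restrict N) {Module.finrank K N} :=
  isHomogeneous_of_finiteDimensional (by
    obtain ⟨ε, hε⟩ := hB.swap
    exact ⟨ε, fun x y => hε x y⟩)

theorem DefinableField.carrier_nonempty {k m : ℕ} (F : DefinableField B k m) : F.carrier.Nonempty :=
  ⟨_, (0 : F.carrier).2⟩

theorem DefinableField.carrier_ne_univ (hV : ¬ FiniteDimensional K V)
    (hB : IsHomogeneous B Set.univ) {k : ℕ} (F : DefinableField B k 0) : F.carrier ≠ Set.univ := by
  intro hF
  rcases Nat.eq_zero_or_pos k with rfl | hk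
  · exact zero_ne_one (α := F.carrier) (Subtype.ext (Subsingleton.elim _ _))
  · obtain ⟨W, hW, hFW⟩ := F.exists_finiteDimensional hB
    have htop : W = ⊤ := Submodule.eq_top_iff'.2 fun x =>
      hFW (fun _ => x, Fin.elim0) (hF ▸ Set.mem_univ _) ⟨0, hk⟩
    subst htop
    exact hV (Module.finite_def.2 (Submodule.fg_top _ |>.1 (Module.finite_def.1 hW)))

theorem DefinableField.isFiniteDimACF [IsAlgClosed K] (hV : ¬ FiniteDimensional K V)
    (hB : IsHomogeneous B Set.univ) (hnd : B.Nondegenerate) (h2 : (2 : K) ≠ 0)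
    (hsa : B.IsSymm ∨ B.IsAlt) {k m : ℕ} (F : DefinableField B k m) :
    IsFiniteDimACF B F.carrier := by
  obtain ⟨W, hW, hFW⟩ := F.exists_finiteDimensional hB
  obtain ⟨r, Y, hY, hne, h⟩ := exists_hasFiniteDim hB F.definable_carrier hFW
    (exists_isApproximatingSequence hV hnd h2 hsa F.definable_carrier)
  obtain ⟨d, hd, hd'⟩ := exists_rankGE_and_not_rankGE (K := K) (hne F.carrier_nonempty)
  refine ⟨d, h _ d fun N hN e he => ?_⟩
  exact ⟨(morleyRankGE_iff (hB.restrict N) he _ _).2 hd,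
    fun h => hd' ((morleyRankGE_iff (hB.restrict N) he _ _).1 h)⟩

theorem DefinableField.isFiniteDimRCF [LinearOrder K] [IsStrictOrderedRing K] [IsRealClosed K]
    (hV : ¬ FiniteDimensional K V) (hB : IsHomogeneous B Set.univ) (hnd : B.Nondegenerate)
    (hsa : B.IsSymm ∨ B.IsAlt) {k m : ℕ} (F : DefinableField B k m) :
    IsFiniteDimRCF B F.carrier := by
  obtain ⟨W, hW, hFW⟩ := F.exists_finiteDimensional hB
  obtain ⟨r, Y, hY, hne, h⟩ := exists_hasFiniteDim hB F.definable_carrier hFW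
    (exists_isApproximatingSequence hV hnd two_ne_zero hsa F.definable_carrier)
  obtain ⟨n, ⟨ε⟩⟩ := Finite.exists_equiv_fin ((Fin k × Fin r) ⊕ Fin m)
  have hne' : {v : Fin n → K | v ∘ ε.symm.symm ∈ Y}.Nonempty := by
    obtain ⟨y, hy⟩ := hne F.carrier_nonempty
    exact ⟨y ∘ ε.symm, by simpa [Function.comp_assoc] using! hy⟩
  obtain ⟨d, hd⟩ := exists_isGreatest_topDimGE hne'
  refine ⟨d, h _ d fun N hN e he => ?_⟩
  obtain ⟨f, -, hf⟩ := exists_scalar_copy (B := B.restrict N) he hY rfl ε.symm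
  exact ⟨n, _, f, (hY.preimage ε.symm.symm).fieldDefinable, hf, hd⟩

theorem IsModelACF.isHomogeneous (h : IsModelACF B) : IsHomogeneous B Set.univ := by
  have := h.isAlgClosed
  rcases h.symm_or_alt with hs | ha
  · exact isHomogeneous_of_isSymm h.infinite h.two_ne_zero h.nondegenerate.1 hs
  · exact isHomogeneous_of_isAlt h.infinite h.nondegenerate.1 ha

theorem IsModelRCF.isHomogeneous [LinearOrder K] [IsStrictOrderedRing K] (h : IsModelRCF B) :
    IsHomogeneous B Set.univ := by
  have := h.isRealClosed
  rcases h.posDef_or_alt with ⟨hs, hpos⟩ | ha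
  · exact isHomogeneous_of_posDef h.infinite hs hpos
  · exact isHomogeneous_of_isAlt h.infinite h.nondegenerate.1 ha

end

end BilinStr

theorem mainTheorem2 {K : Type*} {V : Type*} [Field K] [AddCommGroup V] [Module K V]
    (B : LinearMap.BilinForm K V) :
    (BilinStr.IsModelACF B →
      (∀ (k m : ℕ) (F : BilinStr.DefinableField B k m),
        BilinStr.IsFiniteDimACF B F.carrier ∧ F.IsDefinableInScalars) ∧
      (∀ k : ℕ, ¬ ∃ F : BilinStr.DefinableField B k 0, F.carrier = Set.univ)) ∧
    (∀ [LinearOrder K] [IsStrictOrderedRing K], BilinStr.IsModelRCF B →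
      (∀ (k m : ℕ) (F : BilinStr.DefinableField B k m),
        BilinStr.IsFiniteDimRCF B F.carrier ∧ F.IsDefinableInScalars) ∧
      (∀ k : ℕ, ¬ ∃ F : BilinStr.DefinableField B k 0, F.carrier = Set.univ)) := by
  constructor
  · intro h
    have := h.isAlgClosed
    exact ⟨fun k m F => ⟨F.isFiniteDimACF h.infinite h.isHomogeneous h.nondegenerate h.two_ne_zero
      h.symm_or_alt, F.isDefinableInScalars h.isHomogeneous⟩,
      fun k ⟨F, hF⟩ => F.carrier_ne_univ h.infinite h.isHomogeneous hF⟩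
  · intro _ _ h
    have := h.isRealClosed
    exact ⟨fun k m F => ⟨F.isFiniteDimRCF h.infinite h.isHomogeneous h.nondegenerate
      (h.posDef_or_alt.imp_left And.left), F.isDefinableInScalars h.isHomogeneous⟩,
      fun k ⟨F, hF⟩ => F.carrier_ne_univ h.infinite h.isHomogeneous hF⟩
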